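/- Groups are structures in the signature $\{\cdot,{}^{-1},1\}$. Let $L=\mathbb Z\wr\mathbb Z$ be the regular restricted wreath product, i.e. the semidirect product $B\rtimes\mathbb Z$, where $B=\bigoplus_{\mathbb Z}\mathbb Z$ and $\mathbb Z$ acts on $B$ by translating the coordinates. Let $\varphi_0,\varphi_1,\dots$ be the standard enumeration of the partial computable functions and let $W_e$ be the domain of $\varphi_e$. Computable infinitary formulas (in countably many variables) are defined as follows. The computable $\Sigma_0$ and $\Pi_0$ formulas are the finitary quantifier-free formulas. For $n>0$, a computable $\Sigma_n$ (respectively $\Pi_n$) formula is a disjunction (respectively conjunction) over a c.e. set of (indices of) formulas $\exists\bar x\,\psi$ (respectively $\forall\bar x\,\psi$), where $\bar x$ is a finite tuple of variables and $\psi$ is a computable $\Pi_m$ (respectively $\Sigma_m$) formula for some $m<n$. A computable d-$\Sigma_2$ sentence is a sentence that is the conjunction of a computable $\Sigma_2$ formula and a computable $\Pi_2$ formula. A Scott sentence of a countable structure $\mathcal A$ is a sentence whose countable models are exactly the isomorphic copies of $\mathcal A$. The index set $I(L)$ is the set of all $e\in\mathbb N$ such that $\varphi_e$ is the characteristic function of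 (the set of codes of the elements of) the atomic diagram of a structure $\mathcal B\cong L$ whose universe is a set of natural numbers. A set $S\subseteq\mathbb N$ is d-$\Sigma_2$ if $S=S_1\setminus S_2$ with $S_1,S_2$ both $\Sigma_2$ in the arithmetical hierarchy; it is $m$-complete d-$\Sigma_2$ if in addition every d-$\Sigma_2$ set is many-one reducible to it. **Theorem.** $L=\mathbb Z\wr\mathbb Z$ has a computable d-$\Sigma_2$ Scott sentence, and its index set $I(L)$ is $m$-complete d-$\Sigma_2$. -/

import Mathlib

namespace GroupScott

/-! ### The signature of groups -/

/-- The function symbols of the signature of groups: `·`, `⁻¹` and `1`. -/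
inductive GroupFunc : ℕ → Type
  | mul : GroupFunc 2
  | inv : GroupFunc 1
  | one : GroupFunc 0

/-- The first-order signature of groups; it has no relation symbols besides equality. -/
def groupLang : FirstOrder.Language.{0, 0} := ⟨GroupFunc, fun _ => Empty⟩

/-- Every group is a structure for the signature of groups. -/
instance groupStructure (G : Type*) [Group G] : groupLang.Structure G where
  funMap {_} f := match f with
    | GroupFunc.mul => fun v => v 0 * v 1
    | GroupFunc.inv => fun v => (v 0)⁻¹
    | GroupFunc.one => fun _ => 1
  RelMap {_} r := r.elim

/-- Terms in the variables `x₀, x₁, x₂, …`. -/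
abbrev GTerm : Type := groupLang.Term ℕ

def tOne : GTerm := FirstOrder.Language.Term.func GroupFunc.one ![]
def tInv (s : GTerm) : GTerm := FirstOrder.Language.Term.func GroupFunc.inv ![s]
def tMul (s t : GTerm) : GTerm := FirstOrder.Language.Term.func GroupFunc.mul ![s, t]

/-! ### Coding of terms and of finitary quantifier-free formulas by natural numbers -/

/-- The coding of terms: `0` codes `1`, and `3a + 1`, `3a + 2`, `3⟨a, b⟩ + 3` code the variable
`x_a`, the inverse of the term `a`, and the product of the terms `a` and `b`. -/
def termOfNat : ℕ → GTerm
  | 0 => tOne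
  | n + 1 =>
    match n % 3 with
    | 0 => FirstOrder.Language.Term.var (n / 3)
    | 1 => tInv (termOfNat (n / 3))
    | _ => tMul (termOfNat (n / 3).unpair.1) (termOfNat (n / 3).unpair.2)
termination_by n => n
decreasing_by
  all_goals
    have h1 : n / 3 < n + 1 := Nat.lt_succ_of_le (Nat.div_le_self n 3)
    first
      | exact h1
      | exact lt_of_le_of_lt (Nat.unpair_left_le _) h1
      | exact lt_of_le_of_lt (Nat.unpair_right_le _) h1

/-- The coding of finitary quantifier-free formulas: `0` codes falsity, and `2⟨a, b⟩ + 1`,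
`2⟨a, b⟩ + 2` code the equation between the terms `a` and `b`, and the implication from the
formula `a` to the formula `b`. -/
def qfOfNat : ℕ → groupLang.Formula ℕ
  | 0 => ⊥
  | n + 1 =>
    match n % 2 with
    | 0 => (termOfNat (n / 2).unpair.1).equal (termOfNat (n / 2).unpair.2)
    | _ => (qfOfNat (n / 2).unpair.1).imp (qfOfNat (n / 2).unpair.2)
termination_by n => n
decreasing_by
  all_goals
    have h1 : n / 2 < n + 1 := Nat.lt_succ_of_le (Nat.div_le_self n 2)
    first
      | exact h1
      | exact lt_of_le_of_lt (Nat.unpair_left_le _) h1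
      | exact lt_of_le_of_lt (Nat.unpair_right_le _) h1

theorem termOfNat_surjective : Function.Surjective termOfNat := by
  intro t
  induction t with
  | var a => exact ⟨3 * a + 1, by rw [termOfNat]; simp⟩
  | @func l f ts ih =>
    choose c hc using ih
    cases f with
    | one => exact ⟨0, by rw [termOfNat, tOne]; congr; exact Subsingleton.elim _ _⟩
    | inv =>
      refine ⟨3 * c 0 + 1 + 1, ?_⟩
      have e1 : (3 * c 0 + 1) % 3 = 1 := by omega
      have e2 : (3 * c 0 + 1) / 3 = c 0 := by omega
      rw [termOfNat]
      simp only [e1, e2, hc, tInv]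
      congr
      funext i
      fin_cases i
      rfl
    | mul =>
      refine ⟨3 * Nat.pair (c 0) (c 1) + 2 + 1, ?_⟩
      have e1 : (3 * Nat.pair (c 0) (c 1) + 2) % 3 = 2 := by omega
      have e2 : (3 * Nat.pair (c 0) (c 1) + 2) / 3 = Nat.pair (c 0) (c 1) := by omega
      rw [termOfNat]
      simp only [e1, e2, hc, tMul, Nat.unpair_pair]
      congr
      funext i
      fin_cases i <;> rfl

/-- Exactly the finitary quantifier-free formulas have codes. -/
theorem range_qfOfNat : Set.range qfOfNat = {φ : groupLang.Formula ℕ | φ.IsQF} := by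
  apply Set.eq_of_subset_of_subset
  · rintro _ ⟨n, rfl⟩
    induction n using Nat.strong_induction_on with
    | _ n ih =>
      cases n with
      | zero => rw [qfOfNat]; exact FirstOrder.Language.BoundedFormula.isQF_bot
      | succ n =>
        have h1 : n / 2 < n + 1 := Nat.lt_succ_of_le (Nat.div_le_self n 2)
        rw [qfOfNat]
        split
        · exact (FirstOrder.Language.BoundedFormula.IsAtomic.equal _ _).isQF
        · exact (ih _ (lt_of_le_of_lt (Nat.unpair_left_le _) h1)).imp
            (ih _ (lt_of_le_of_lt (Nat.unpair_right_le _) h1))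
  · intro φ h
    induction h with
    | falsum => exact ⟨0, by rw [qfOfNat]; rfl⟩
    | of_isAtomic h =>
      cases h with
      | equal s t =>
        let e : ℕ ⊕ Fin 0 ≃ ℕ := Equiv.sumEmpty ℕ (Fin 0)
        obtain ⟨a, ha⟩ := termOfNat_surjective (s.relabel e)
        obtain ⟨b, hb⟩ := termOfNat_surjective (t.relabel e)
        refine ⟨2 * Nat.pair a b + 1, ?_⟩
        have e1 : (2 * Nat.pair a b) % 2 = 0 := by omega
        have e2 : (2 * Nat.pair a b) / 2 = Nat.pair a b := by omega
        have e3 : (Sum.inl : ℕ → ℕ ⊕ Fin 0) ∘ e = id := by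
          funext x
          rcases x with x | x
          · rfl
          · exact x.elim0
        rw [qfOfNat]
        simp only [e1, e2, Nat.unpair_pair, ha, hb, FirstOrder.Language.Term.equal,
          FirstOrder.Language.Term.relabel_relabel, e3, FirstOrder.Language.Term.relabel_id]
      | rel R ts => exact R.elim
    | imp _ _ ih1 ih2 =>
      obtain ⟨a, rfl⟩ := ih1
      obtain ⟨b, rfl⟩ := ih2
      refine ⟨2 * Nat.pair a b + 1 + 1, ?_⟩
      have e1 : (2 * Nat.pair a b + 1) % 2 = 1 := by omega
      have e2 : (2 * Nat.pair a b + 1) / 2 = Nat.pair a b := by omega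
      rw [qfOfNat]
      simp only [e1, e2, Nat.unpair_pair]

/-! ### Infinitary formulas -/

/-- Formulas of `L_{ω₁ω}` in the signature of groups, with variables `x₀, x₁, x₂, …`. The
quantifiers bind a finite tuple of variables. -/
inductive InfFormula : Type
  | qf (φ : groupLang.Formula ℕ) : InfFormula
  | and (φ ψ : InfFormula) : InfFormula
  | bigOr (I : Set ℕ) (f : ℕ → InfFormula) : InfFormula
  | bigAnd (I : Set ℕ) (f : ℕ → InfFormula) : InfFormula
  | ex (xs : List ℕ) (φ : InfFormula) : InfFormula
  | all (xs : List ℕ) (φ : InfFormula) : InfFormula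

namespace InfFormula

/-- Satisfaction in a structure `M` under an assignment `v` of elements of `M` to the variables. -/
def Realize {M : Type*} [groupLang.Structure M] : InfFormula → (ℕ → M) → Prop
  | qf φ, v => φ.Realize v
  | and φ ψ, v => φ.Realize v ∧ ψ.Realize v
  | bigOr I f, v => ∃ k ∈ I, (f k).Realize v
  | bigAnd I f, v => ∀ k ∈ I, (f k).Realize v
  | ex xs φ, v => ∃ w : ℕ → M, (∀ i, i ∉ xs → w i = v i) ∧ φ.Realize w
  | all xs φ, v => ∀ w : ℕ → M, (∀ i, i ∉ xs → w i = v i) → φ.Realize w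

/-- The set of (indices of) free variables. -/
def freeVars : InfFormula → Set ℕ
  | qf φ => {i | i ∈ φ.freeVarFinset}
  | and φ ψ => φ.freeVars ∪ ψ.freeVars
  | bigOr I f => {i | ∃ k ∈ I, i ∈ (f k).freeVars}
  | bigAnd I f => {i | ∃ k ∈ I, i ∈ (f k).freeVars}
  | ex xs φ => {i | i ∈ φ.freeVars ∧ i ∉ xs}
  | all xs φ => {i | i ∈ φ.freeVars ∧ i ∉ xs}

/-- A sentence is a formula without free variables. -/
def IsSentence (φ : InfFormula) : Prop := φ.freeVars = ∅

/-- A sentence is true in `M`. As `M` is non-empty (the signature has the constant `1`), the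
choice of the assignment does not matter for a sentence. -/
def Models (M : Type*) [groupLang.Structure M] (φ : InfFormula) : Prop :=
  ∀ v : ℕ → M, φ.Realize v

end InfFormula

/-! ### Computable infinitary formulas -/

/-- The partial computable function `φ_e`. -/
def phi (e : ℕ) : ℕ →. ℕ := Nat.Partrec.Code.eval (Denumerable.ofNat Nat.Partrec.Code e)

/-- The c.e. set `W_e`, the domain of `φ_e`. -/
def W (e : ℕ) : Set ℕ := {k | (phi e k).Dom}

/-- The number `k`, read as the code of a triple: a finite tuple of variables, a level, and an
index. -/
def triple (k : ℕ) : List ℕ × ℕ × ℕ := Denumerable.ofNat (List ℕ × ℕ × ℕ) k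

/- The computable `Σ_n` and `Π_n` formulas, given by indices. At level `0` the index is a code of a
finitary quantifier-free formula. At level `n + 1` the index `e` stands for the disjunction
(conjunction) over the codes `(xs, m, j)` in the c.e. set `W_e` of the formulas `∃ xs φ`
(`∀ xs φ`), where `φ` is the computable `Π_m` (`Σ_m`) formula with index `j`; levels `m > n` are
read as `n`, so that exactly the levels `m < n + 1` occur. -/
mutual

def sigmaFormula : ℕ → ℕ → InfFormula
  | 0, e => InfFormula.qf (qfOfNat e)
  | n + 1, e => InfFormula.bigOr (W e) fun k =>
      InfFormula.ex (triple k).1 (piFormula (min (triple k).2.1 n) (triple k).2.2)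
termination_by n => n

def piFormula : ℕ → ℕ → InfFormula
  | 0, e => InfFormula.qf (qfOfNat e)
  | n + 1, e => InfFormula.bigAnd (W e) fun k =>
      InfFormula.all (triple k).1 (sigmaFormula (min (triple k).2.1 n) (triple k).2.2)
termination_by n => n

end

/-- A computable d-`Σ_n` sentence: a sentence that is the conjunction of a computable `Σ_n` formula
and a computable `Π_n` formula. -/
def IsComputableDSigmaSentence (n : ℕ) (φ : InfFormula) : Prop :=
  φ.IsSentence ∧ ∃ i j : ℕ, φ = (sigmaFormula n i).and (piFormula n j)

/-- `φ` is a Scott sentence of the structure `A`: it is a sentence, and its countable models are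
exactly the isomorphic copies of the countable structure `A`. (Every countable structure has an
isomorphic copy in `Type`.) -/
def IsScottSentence (A : Type) [groupLang.Structure A] (φ : InfFormula) : Prop :=
  φ.IsSentence ∧ Countable A ∧
    ∀ (M : Type) [groupLang.Structure M] [Countable M],
      φ.Models M ↔ Nonempty (groupLang.Equiv M A)

/-! ### Index sets -/

/-- The atomic diagram of a structure whose universe `U` is a set of natural numbers: the set of
(codes of) the atomic sentences and negated atomic sentences with constants for the elements of `U`
that are true in the structure. The number `2⟨a, b⟩` codes the equation between the terms with
codes `a` and `b`, and `2⟨a, b⟩ + 1` codes its negation, where the variable `x_i` is the constant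
for the element `i`. -/
def atomicDiagram (U : Set ℕ) [groupLang.Structure U] : Set ℕ :=
  {k | ∃ s t : groupLang.Term U,
    termOfNat (k / 2).unpair.1 = s.relabel Subtype.val ∧
    termOfNat (k / 2).unpair.2 = t.relabel Subtype.val ∧
    (k % 2 = 0 ↔ s.realize (id : U → U) = t.realize (id : U → U))}

/-- `f` is the characteristic function of the set `D`. -/
def IsCharFunction (f : ℕ →. ℕ) (D : Set ℕ) : Prop :=
  ∀ k, (k ∈ D → f k = Part.some 1) ∧ (k ∉ D → f k = Part.some 0)

/-- The index set of `A`: the set of all `e` such that `φ_e` is (the characteristic function of)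
the atomic diagram of a structure `B`, with universe a set of natural numbers, such that
`B ≅ A`. -/
def indexSet (A : Type) [groupLang.Structure A] (e : ℕ) : Prop :=
  ∃ (U : Set ℕ) (_ : groupLang.Structure U),
    IsCharFunction (phi e) (atomicDiagram U) ∧ Nonempty (groupLang.Equiv U A)

/-! ### d-`Σ₂` sets and completeness -/

/-- `Σ₂` sets of natural numbers: `p n ↔ ∃ x ∀ y R(n, x, y)` with `R` computable. -/
def IsSigma2 (p : ℕ → Prop) : Prop :=
  ∃ R : ℕ × ℕ × ℕ → Prop, ComputablePred R ∧ ∀ n, p n ↔ ∃ x, ∀ y, R (n, x, y)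

/-- d-`Σ₂` sets of natural numbers: differences of two `Σ₂` sets. -/
def IsDSigma2 (p : ℕ → Prop) : Prop :=
  ∃ q r : ℕ → Prop, IsSigma2 q ∧ IsSigma2 r ∧ ∀ n, p n ↔ q n ∧ ¬ r n

/-- `p` is `m`-complete for the class `Γ`: it belongs to `Γ`, and every member of `Γ` is many-one
reducible to it. -/
def IsMComplete (Γ : (ℕ → Prop) → Prop) (p : ℕ → Prop) : Prop :=
  Γ p ∧ ∀ q, Γ q → q ≤₀ p

/-! ### The group `ℤ ≀ ℤ` -/

/-- The (regular, restricted) wreath product of `G` by `H`: in the semidirect product of the group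
of all functions `H → G` by `H`, where `H` shifts the coordinates by left multiplication, the
subgroup in which the functions have finite support, that is, are in the direct sum of copies of
`G` indexed by `H`. -/
def restrictedWreath (G H : Type*) [Group G] [Group H] : Subgroup (G ≀ᵣ H) where
  carrier := {x | (Function.mulSupport x.left).Finite}
  one_mem' := by simp
  mul_mem' := by
    intro x y hx hy
    rw [Set.mem_ofPred_eq, RegularWreathProduct.mul_left]
    refine Set.Finite.subset (Set.Finite.union hx (Set.Finite.image (x.right * ·) hy))
      ((Function.mulSupport_mul _ _).trans (Set.union_subset_union_right _ ?_))
    intro h hh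
    exact ⟨x.right⁻¹ * h, hh, by simp⟩
  inv_mem' := by
    intro x hx
    rw [Set.mem_ofPred_eq, RegularWreathProduct.inv_left]
    refine Set.Finite.subset (Set.Finite.image (x.right⁻¹ * ·) hx) ?_
    intro h hh
    refine ⟨x.right * h, ?_, by simp⟩
    simpa [Function.mem_mulSupport] using hh

/-- The group `ℤ ≀ ℤ`. -/
abbrev ZwrZ : Type := restrictedWreath (Multiplicative ℤ) (Multiplicative ℤ)

end GroupScott

-- Realise ℤ ≀ ℤ as `Lamp ℤ`, the semidirect product ℤ[T;T⁻¹] ⋊ ℤ in which s acts as T^s; it is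
-- generated by the polynomial 1 in the base and by the shift. The upper bounds rest on a universal
-- (Π₁) condition `Theta a t` that the standard pair satisfies (`theta_gen`) and that forces every
-- pair satisfying it to generate the group (`surjective_of_theta`). It demands that a, t satisfy
-- exactly the equations of the standard pair; that a never arises by applying a non-unit of
-- ℤ[T;T⁻¹], read through t, to an element y commuting with a; and that t is never y^m b with m ≠ 1
-- and b commuting with a. In the group, the equations put a into the base, the third demand makes
-- the shift of t equal to ±1, and the second makes the polynomial of a a unit; a unit and an
-- element acting as T or T⁻¹ generate. Hence a structure is a copy exactly when some pair satisfies
-- `Theta` and every such pair generates (`nonempty_equiv_lamp_iff`). The first clause is Σ₂ and the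
-- second Π₂; both are computable because the word problem and the set of units ±T^j are decidable.
--
-- The same two clauses, read in an atomic diagram, put the index set into d-Σ₂. That φ_e decides
-- the diagram of some structure costs only a further Π₂ clause, since each closure condition is Σ₁
-- in the answers 1 and 0 of φ_e (`DiagramCond`).
--
-- For hardness, attach to each input a subgroup W of the additive group of ℚ[X] and pass to W ≀ ℤ
-- (`valueGroup`), which is a copy of ℤ ≀ ℤ exactly when W is infinite cyclic. W is generated by
-- fractions 2^(-m k), whose exponents are bounded exactly when the given Σ₂ condition holds
-- (`exists_iff_search_bounded`), and by one element for each i, which is an integer if the i-th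
-- instance ∃ y A i y of the given Π₂ condition holds, and a power of the indeterminate otherwise.
-- So W is cyclic exactly when both conditions hold (`nonempty_mulEquiv_weight_iff`). The word
-- problem must be decidable although ∃ y A i y is not. A witness y is therefore coded by a
-- factorial that grows with y: a relation of size N cannot tell a very large integer from an
-- indeterminate, so a search up to N decides it (`linearCombination_weight_eq_zero_iff`,
-- `sum_mul_ne_zero_of_factorial`).

namespace GroupScott
-- Terms and literals by code: recursion, values, isomorphisms.
open FirstOrder

/-! ### Recursion on the codes of terms -/

/-- The code of the variable `x_i`. -/
def codeVar (i : ℕ) : ℕ := 3 * i + 1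

/-- The code of the inverse of the term with code `a`. -/
def codeInv (a : ℕ) : ℕ := 3 * a + 2

/-- The code of the product of the terms with codes `a` and `b`. -/
def codeMul (a b : ℕ) : ℕ := 3 * Nat.pair a b + 3

theorem code_induction {P : ℕ → Prop} (one : P 0) (var : ∀ i, P (codeVar i))
    (inv : ∀ a, P a → P (codeInv a)) (mul : ∀ a b, P a → P b → P (codeMul a b)) (n : ℕ) : P n := by
  induction n using Nat.strong_induction_on with
  | _ n ih =>
    cases n with
    | zero => exact one
    | succ n =>
      have h : n % 3 = 0 ∨ n % 3 = 1 ∨ n % 3 = 2 := by omega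
      rcases h with h | h | h
      · have : n + 1 = codeVar (n / 3) := by unfold codeVar; omega
        rw [this]; exact var _
      · have : n + 1 = codeInv (n / 3) := by unfold codeInv; omega
        rw [this]; exact inv _ (ih _ (by omega))
      · have : n + 1 = codeMul (n / 3).unpair.1 (n / 3).unpair.2 := by
          unfold codeMul; rw [Nat.pair_unpair]; omega
        rw [this]
        have h1 := Nat.unpair_left_le (n / 3)
        have h2 := Nat.unpair_right_le (n / 3)
        exact mul _ _ (ih _ (by omega)) (ih _ (by omega))

section CodeRec

variable {σ : Type*} (one : σ) (var : ℕ → σ) (inv : σ → σ) (mul : σ → σ → σ)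

/-- Recursion on the codes of terms. -/
def codeRec : ℕ → σ
  | 0 => one
  | n + 1 =>
    if n % 3 = 0 then var (n / 3)
    else if n % 3 = 1 then inv (codeRec (n / 3))
    else mul (codeRec (n / 3).unpair.1) (codeRec (n / 3).unpair.2)
termination_by n => n
decreasing_by
  all_goals
    have h1 : n / 3 < n + 1 := Nat.lt_succ_of_le (Nat.div_le_self n 3)
    first
      | exact h1
      | exact lt_of_le_of_lt (Nat.unpair_left_le _) h1
      | exact lt_of_le_of_lt (Nat.unpair_right_le _) h1

@[simp] theorem codeRec_zero : codeRec one var inv mul 0 = one := by rw [codeRec]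

@[simp] theorem codeRec_var (i : ℕ) : codeRec one var inv mul (codeVar i) = var i := by
  have e1 : (3 * i) % 3 = 0 := by omega
  have e2 : (3 * i) / 3 = i := by omega
  rw [codeVar, codeRec, e1, e2]; simp

@[simp] theorem codeRec_inv (a : ℕ) :
    codeRec one var inv mul (codeInv a) = inv (codeRec one var inv mul a) := by
  have e1 : (3 * a + 1) % 3 = 1 := by omega
  have e2 : (3 * a + 1) / 3 = a := by omega
  rw [codeInv, codeRec, e1, e2]; simp

@[simp] theorem codeRec_mul (a b : ℕ) :
    codeRec one var inv mul (codeMul a b) =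
      mul (codeRec one var inv mul a) (codeRec one var inv mul b) := by
  have e1 : (3 * Nat.pair a b + 2) % 3 = 2 := by omega
  have e2 : (3 * Nat.pair a b + 2) / 3 = Nat.pair a b := by omega
  rw [codeMul, codeRec, e1, e2]; simp

end CodeRec

theorem primrec_codeVar : Primrec codeVar :=
  Primrec.succ.comp (Primrec.nat_mul.comp (Primrec.const 3) Primrec.id)

theorem primrec_codeInv : Primrec codeInv :=
  Primrec.nat_add.comp (Primrec.nat_mul.comp (Primrec.const 3) Primrec.id) (Primrec.const 2)

theorem primrec_codeMul : Primrec₂ codeMul :=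
  Primrec.nat_add.comp (Primrec.nat_mul.comp (Primrec.const 3)
    (Primrec₂.natPair.comp Primrec.fst Primrec.snd)) (Primrec.const 3)

/-- Course-of-values recursion: a subterm has a smaller code than the term, so its value can be
looked up in the list of earlier values. Substitution, normal forms and membership of variables are
all computed by this lemma. -/
theorem primrec_codeRec {α σ : Type*} [Primcodable α] [Primcodable σ] {one : α → σ}
    {var : α → ℕ → σ} {inv : α → σ → σ} {mul : α → σ → σ → σ} (h1 : Primrec one)
    (hv : Primrec₂ var) (hi : Primrec₂ inv) (hm : Primrec fun p : α × σ × σ => mul p.1 p.2.1 p.2.2) :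
    Primrec₂ fun a => codeRec (one a) (var a) (inv a) (mul a) := by
  -- The default `one a` for an index out of range is never reached in the recursion.
  let look (a : α) (l : List σ) (i : ℕ) : σ := (l[i]?).getD (one a)
  have hlook : Primrec fun p : (α × List σ) × ℕ => look p.1.1 p.1.2 p.2 :=
    Primrec.option_getD.comp (Primrec.list_getElem?.comp (Primrec.snd.comp Primrec.fst) Primrec.snd)
      (h1.comp (Primrec.fst.comp Primrec.fst))
  let g (a : α) (l : List σ) : σ :=
    l.length.casesOn (one a) fun n =>
      if n % 3 = 0 then var a (n / 3)
      else if n % 3 = 1 then inv a (look a l (n / 3))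
      else mul a (look a l (n / 3).unpair.1) (look a l (n / 3).unpair.2)
  have hg : Primrec₂ g := by
    have hmod : Primrec fun p : (α × List σ) × ℕ => p.2 % 3 :=
      Primrec.nat_mod.comp Primrec.snd (Primrec.const 3)
    have hdiv : Primrec fun p : (α × List σ) × ℕ => p.2 / 3 :=
      Primrec.nat_div.comp Primrec.snd (Primrec.const 3)
    have ha : Primrec fun p : (α × List σ) × ℕ => p.1.1 := Primrec.fst.comp Primrec.fst
    refine Primrec.nat_casesOn (f := fun p : α × List σ => p.2.length)
      (Primrec.list_length.comp Primrec.snd) (h1.comp Primrec.fst) ?_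
    refine Primrec.ite (Primrec.eq.comp hmod (Primrec.const 0)) (hv.comp ha hdiv)
      (Primrec.ite (Primrec.eq.comp hmod (Primrec.const 1))
        (hi.comp ha (hlook.comp (Primrec.pair Primrec.fst hdiv)))
        (hm.comp (Primrec.pair ha (Primrec.pair
          (hlook.comp (Primrec.pair Primrec.fst (Primrec.fst.comp (Primrec.unpair.comp hdiv))))
          (hlook.comp (Primrec.pair Primrec.fst (Primrec.snd.comp (Primrec.unpair.comp hdiv))))))))
  refine Primrec.nat_strong_rec _ (g := fun a l => some (g a l)) (Primrec.option_some.comp hg) ?_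
  intro a n
  congr 1
  cases n with
  | zero => simp [g]
  | succ n =>
    have h0 : n / 3 < n + 1 := by omega
    have h1 := lt_of_le_of_lt (Nat.unpair_left_le (n / 3)) h0
    have h2 := lt_of_le_of_lt (Nat.unpair_right_le (n / 3)) h0
    rw [codeRec]
    simp [g, look, h0, h1, h2]

/-- The substitution of the terms with codes `ρ i` for the variables `x_i`. -/
def codeSubst (ρ : ℕ → ℕ) : ℕ → ℕ := codeRec 0 ρ codeInv codeMul

theorem primrec_codeSubst {α : Type*} [Primcodable α] {ρ : α → ℕ → ℕ} (h : Primrec₂ ρ) :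
    Primrec₂ fun a => codeSubst (ρ a) :=
  primrec_codeRec (Primrec.const 0) h (primrec_codeInv.comp Primrec.snd)
    (primrec_codeMul.comp (Primrec.fst.comp Primrec.snd) (Primrec.snd.comp Primrec.snd))

/-! ### Values of terms -/

section Structure

variable {M : Type*} [groupLang.Structure M]

def sOne (M : Type*) [groupLang.Structure M] : M :=
  Language.Structure.funMap (L := groupLang) GroupFunc.one ![]

def sInv (x : M) : M := Language.Structure.funMap (L := groupLang) GroupFunc.inv ![x]

def sMul (x y : M) : M := Language.Structure.funMap (L := groupLang) GroupFunc.mul ![x, y]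

/-- The value of the term with code `c`. -/
def wordEval (v : ℕ → M) (c : ℕ) : M := (termOfNat c).realize v

theorem termOfNat_zero : termOfNat 0 = tOne := by rw [termOfNat]

theorem termOfNat_var (i : ℕ) : termOfNat (codeVar i) = Language.Term.var i := by
  have e1 : (3 * i) % 3 = 0 := by omega
  have e2 : (3 * i) / 3 = i := by omega
  rw [codeVar, termOfNat]; simp only [e1, e2]

theorem termOfNat_inv (a : ℕ) : termOfNat (codeInv a) = tInv (termOfNat a) := by
  have e1 : (3 * a + 1) % 3 = 1 := by omega
  have e2 : (3 * a + 1) / 3 = a := by omega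
  rw [codeInv, termOfNat]; simp only [e1, e2]

theorem termOfNat_mul (a b : ℕ) : termOfNat (codeMul a b) = tMul (termOfNat a) (termOfNat b) := by
  have e1 : (3 * Nat.pair a b + 2) % 3 = 2 := by omega
  have e2 : (3 * Nat.pair a b + 2) / 3 = Nat.pair a b := by omega
  rw [codeMul, termOfNat]; simp only [e1, e2, Nat.unpair_pair]

@[simp] theorem realize_tOne (v : ℕ → M) : tOne.realize v = sOne M := by
  simp only [tOne, sOne, Language.Term.realize]
  congr 1
  exact Subsingleton.elim _ _

@[simp] theorem realize_tInv (v : ℕ → M) (s : GTerm) : (tInv s).realize v = sInv (s.realize v) := by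
  simp only [tInv, sInv, Language.Term.realize]
  congr 1
  funext i; fin_cases i; rfl

@[simp] theorem realize_tMul (v : ℕ → M) (s t : GTerm) :
    (tMul s t).realize v = sMul (s.realize v) (t.realize v) := by
  simp only [tMul, sMul, Language.Term.realize]
  congr 1
  funext i; fin_cases i <;> rfl

@[simp] theorem wordEval_zero (v : ℕ → M) : wordEval v 0 = sOne M := by
  rw [wordEval, termOfNat_zero]; exact realize_tOne v

@[simp] theorem wordEval_var (v : ℕ → M) (i : ℕ) : wordEval v (codeVar i) = v i := by
  rw [wordEval, termOfNat_var]; rfl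

@[simp] theorem wordEval_inv (v : ℕ → M) (a : ℕ) :
    wordEval v (codeInv a) = sInv (wordEval v a) := by
  rw [wordEval, termOfNat_inv, realize_tInv]; rfl

@[simp] theorem wordEval_mul (v : ℕ → M) (a b : ℕ) :
    wordEval v (codeMul a b) = sMul (wordEval v a) (wordEval v b) := by
  rw [wordEval, termOfNat_mul, realize_tMul]; rfl

theorem wordEval_subst (v : ℕ → M) (ρ : ℕ → ℕ) (c : ℕ) :
    wordEval v (codeSubst ρ c) = wordEval (fun i => wordEval v (ρ i)) c := by
  unfold codeSubst
  induction c using code_induction <;> simp_all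

/-- The truth of the literal with code `k` (an equation for `k` even, an inequation for `k` odd). -/
def litEval (v : ℕ → M) (k : ℕ) : Prop :=
  k % 2 = 0 ↔ wordEval v (k / 2).unpair.1 = wordEval v (k / 2).unpair.2

/-- The code of the equation between the terms with codes `a` and `b`. -/
def codeEq (a b : ℕ) : ℕ := 2 * Nat.pair a b

/-- The code of the inequation between the terms with codes `a` and `b`. -/
def codeNe (a b : ℕ) : ℕ := 2 * Nat.pair a b + 1

@[simp] theorem litEval_codeEq (v : ℕ → M) (a b : ℕ) :
    litEval v (codeEq a b) ↔ wordEval v a = wordEval v b := by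
  simp [litEval, codeEq]

@[simp] theorem litEval_codeNe (v : ℕ → M) (a b : ℕ) :
    litEval v (codeNe a b) ↔ wordEval v a ≠ wordEval v b := by
  have : (2 * Nat.pair a b + 1) / 2 = Nat.pair a b := by omega
  simp [litEval, codeNe, this, Nat.add_mod]

theorem codeEq_or_codeNe (k : ℕ) : ∃ a b, k = codeEq a b ∨ k = codeNe a b := by
  refine ⟨(k / 2).unpair.1, (k / 2).unpair.2, ?_⟩
  simp only [codeEq, codeNe, Nat.pair_unpair]
  omega

theorem primrec_codeEq : Primrec₂ codeEq :=
  Primrec.nat_mul.comp (Primrec.const 2) (Primrec₂.natPair.comp Primrec.fst Primrec.snd)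

theorem primrec_codeNe : Primrec₂ codeNe := Primrec.succ.comp primrec_codeEq

/-- Substitution in literals. -/
def litSubst (ρ : ℕ → ℕ) (k : ℕ) : ℕ :=
  2 * Nat.pair (codeSubst ρ (k / 2).unpair.1) (codeSubst ρ (k / 2).unpair.2) + k % 2

theorem litEval_subst (v : ℕ → M) (ρ : ℕ → ℕ) (k : ℕ) :
    litEval v (litSubst ρ k) ↔ litEval (fun i => wordEval v (ρ i)) k := by
  have h1 : ∀ m, (2 * m + k % 2) / 2 = m := by omega
  have h2 : ∀ m, (2 * m + k % 2) % 2 = k % 2 := by omega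
  simp only [litEval, litSubst, h1, h2, Nat.unpair_pair, wordEval_subst]

theorem primrec_litSubst {α : Type*} [Primcodable α] {ρ : α → ℕ → ℕ} (h : Primrec₂ ρ) :
    Primrec₂ fun a => litSubst (ρ a) := by
  have hd : Primrec fun p : α × ℕ => (p.2 / 2).unpair :=
    Primrec.unpair.comp (Primrec.nat_div.comp Primrec.snd (Primrec.const 2))
  exact Primrec.nat_add.comp (primrec_codeEq.comp
    ((primrec_codeSubst h).comp Primrec.fst (Primrec.fst.comp hd))
    ((primrec_codeSubst h).comp Primrec.fst (Primrec.snd.comp hd)))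
    (Primrec.nat_mod.comp Primrec.snd (Primrec.const 2))

end Structure

section Group

variable {G : Type*} [Group G]

@[simp] theorem sOne_eq : sOne G = 1 := rfl

@[simp] theorem sInv_eq (x : G) : sInv x = x⁻¹ := rfl

@[simp] theorem sMul_eq (x y : G) : sMul x y = x * y := rfl

theorem map_wordEval {K : Type*} [Group K] (h : G →* K) (v : ℕ → G) (c : ℕ) :
    h (wordEval v c) = wordEval (fun i => h (v i)) c := by
  induction c using code_induction <;> simp_all

theorem mem_range_wordEval {v : ℕ → G} {x : G} :
    x ∈ Set.range (wordEval v) ↔ x ∈ Subgroup.closure (Set.range v) := by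
  constructor
  · rintro ⟨c, rfl⟩
    induction c using code_induction with
    | one => simp [one_mem]
    | var i => rw [wordEval_var]; exact Subgroup.subset_closure (Set.mem_range_self i)
    | inv a ha => simpa using ha
    | mul a b ha hb => simpa using mul_mem ha hb
  · intro hx
    induction hx using Subgroup.closure_induction with
    | mem x hx => obtain ⟨i, rfl⟩ := hx; exact ⟨codeVar i, by simp⟩
    | one => exact ⟨0, by simp⟩
    | inv x _ h => obtain ⟨c, rfl⟩ := h; exact ⟨codeInv c, by simp⟩
    | mul x y _ _ h1 h2 =>
      obtain ⟨c, rfl⟩ := h1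
      obtain ⟨d, rfl⟩ := h2
      exact ⟨codeMul c d, by simp⟩

end Group

/-! ### Maps between structures -/

section Equiv

variable {M N : Type*} [groupLang.Structure M] [groupLang.Structure N]

/-- A bijection that commutes with the operations is an isomorphism. -/
def equivOfOps (e : M ≃ N) (h1 : e (sOne M) = sOne N) (hi : ∀ x, e (sInv x) = sInv (e x))
    (hm : ∀ x y, e (sMul x y) = sMul (e x) (e y)) : groupLang.Equiv M N where
  toEquiv := e
  map_fun' := by
    intro n f x
    cases f with
    | one =>
      have h2 : x = ![] := Subsingleton.elim _ _
      have h3 : e ∘ x = ![] := Subsingleton.elim _ _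
      exact (congrArg (fun y => e (Language.Structure.funMap _ y)) h2).trans
        (h1.trans (congrArg (Language.Structure.funMap (L := groupLang) _) h3).symm)
    | inv =>
      have h2 : x = ![x 0] := by funext i; fin_cases i; rfl
      have h3 : e ∘ x = ![e (x 0)] := by funext i; fin_cases i; rfl
      exact (congrArg (fun y => e (Language.Structure.funMap _ y)) h2).trans
        ((hi _).trans (congrArg (Language.Structure.funMap (L := groupLang) _) h3).symm)
    | mul =>
      have h2 : x = ![x 0, x 1] := by funext i; fin_cases i <;> rfl
      have h3 : e ∘ x = ![e (x 0), e (x 1)] := by funext i; fin_cases i <;> rfl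
      exact (congrArg (fun y => e (Language.Structure.funMap _ y)) h2).trans
        ((hm _ _).trans (congrArg (Language.Structure.funMap (L := groupLang) _) h3).symm)
  map_rel' := by intro n r; exact r.elim

theorem equiv_sOne (e : groupLang.Equiv M N) : e (sOne M) = sOne N := by
  refine (e.map_fun _ _).trans (congrArg (Language.Structure.funMap (L := groupLang) _) ?_)
  exact Subsingleton.elim _ _

theorem equiv_sInv (e : groupLang.Equiv M N) (x : M) : e (sInv x) = sInv (e x) := by
  refine (e.map_fun _ _).trans (congrArg (Language.Structure.funMap (L := groupLang) _) ?_)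
  funext i; fin_cases i; rfl

theorem equiv_sMul (e : groupLang.Equiv M N) (x y : M) : e (sMul x y) = sMul (e x) (e y) := by
  refine (e.map_fun _ _).trans (congrArg (Language.Structure.funMap (L := groupLang) _) ?_)
  funext i; fin_cases i <;> rfl

theorem equiv_wordEval (e : groupLang.Equiv M N) (v : ℕ → M) (c : ℕ) :
    e (wordEval v c) = wordEval (fun i => e (v i)) c := by
  induction c using code_induction <;> simp_all [equiv_sOne, equiv_sInv, equiv_sMul]

theorem equiv_litEval (e : groupLang.Equiv M N) (v : ℕ → M) (k : ℕ) :
    litEval (fun i => e (v i)) k ↔ litEval v k := by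
  simp only [litEval, ← equiv_wordEval, e.injective.eq_iff]

/-- Two structures that are generated by sequences satisfying the same equations are isomorphic. -/
theorem nonempty_equiv_of_words {v : ℕ → M} {u : ℕ → N} (hv : Function.Surjective (wordEval v))
    (hu : Function.Surjective (wordEval u))
    (h : ∀ c d, wordEval v c = wordEval v d ↔ wordEval u c = wordEval u d) :
    Nonempty (groupLang.Equiv M N) := by
  choose r hr using hv
  -- The code chosen for an element is arbitrary; the image does not depend on it because equations
  -- transfer.
  have key : ∀ c, wordEval u (r (wordEval v c)) = wordEval u c := fun c => (h _ _).1 (hr _)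
  let F : M → N := fun x => wordEval u (r x)
  have hF : Function.Bijective F := by
    constructor
    · intro x y hxy
      have := (h _ _).2 hxy
      rwa [hr, hr] at this
    · intro y
      obtain ⟨c, rfl⟩ := hu y
      exact ⟨wordEval v c, key c⟩
  refine ⟨equivOfOps (Equiv.ofBijective F hF) ?_ ?_ ?_⟩
  · simpa using key 0
  · intro x
    simpa [hr] using key (codeInv (r x))
  · intro x y
    simpa [hr] using key (codeMul (r x) (r y))

/-- Isomorphic groups are isomorphic structures. -/
theorem nonempty_equiv_iff_mulEquiv {G K : Type*} [Group G] [Group K] :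
    Nonempty (groupLang.Equiv G K) ↔ Nonempty (G ≃* K) := by
  constructor
  · rintro ⟨e⟩
    exact ⟨{ toEquiv := e.toEquiv, map_mul' := fun x y => equiv_sMul e x y }⟩
  · rintro ⟨e⟩
    exact ⟨equivOfOps e.toEquiv (map_one e) (map_inv e) (map_mul e)⟩

end Equiv

end GroupScott
-- The concrete group: Laurent polynomials extended by the shift.
namespace GroupScott
open LaurentPolynomial

noncomputable section

/-! ### The group of pairs of a Laurent polynomial and an integer -/

/-- The semidirect product of the additive group of `R[T;T⁻¹]` by `ℤ`, where `s : ℤ` acts as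
multiplication by `T ^ s`. -/
@[ext] structure Lamp (R : Type*) [CommRing R] where
  poly : R[T;T⁻¹]
  shift : ℤ

namespace Lamp

variable {R : Type*} [CommRing R]

instance : Mul (Lamp R) := ⟨fun x y => ⟨x.poly + T x.shift * y.poly, x.shift + y.shift⟩⟩
instance : One (Lamp R) := ⟨⟨0, 0⟩⟩
instance : Inv (Lamp R) := ⟨fun x => ⟨-(T (-x.shift) * x.poly), -x.shift⟩⟩

theorem mul_poly (x y : Lamp R) : (x * y).poly = x.poly + T x.shift * y.poly := rfl
@[simp] theorem mul_shift (x y : Lamp R) : (x * y).shift = x.shift + y.shift := rfl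
@[simp] theorem one_poly : (1 : Lamp R).poly = 0 := rfl
@[simp] theorem one_shift : (1 : Lamp R).shift = 0 := rfl
theorem inv_poly (x : Lamp R) : x⁻¹.poly = -(T (-x.shift) * x.poly) := rfl
@[simp] theorem inv_shift (x : Lamp R) : x⁻¹.shift = -x.shift := rfl

instance : Group (Lamp R) :=
  Group.ofLeftAxioms
    (fun x y z => by
      ext1
      · simp only [mul_poly, mul_shift, T_add]; ring
      · simp only [mul_shift]; ring)
    (fun x => by
      ext1
      · simp only [mul_poly, one_poly, one_shift, T_zero]; ring
      · simp)
    (fun x => by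
      ext1
      · simp only [mul_poly, inv_poly, inv_shift, one_poly]; ring
      · simp)

/-- The second component, as a homomorphism. -/
def shiftHom : Lamp R →* Multiplicative ℤ where
  toFun x := Multiplicative.ofAdd x.shift
  map_one' := rfl
  map_mul' _ _ := rfl

@[simp] theorem pow_shift (x : Lamp R) (n : ℕ) : (x ^ n).shift = n * x.shift := by
  have := congrArg Multiplicative.toAdd (map_pow (shiftHom (R := R)) x n)
  simpa [shiftHom, toAdd_pow] using this

@[simp] theorem zpow_shift (x : Lamp R) (n : ℤ) : (x ^ n).shift = n * x.shift := by
  have := congrArg Multiplicative.toAdd (map_zpow (shiftHom (R := R)) x n)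
  simpa [shiftHom, toAdd_zpow] using this

/-- The first component of the semidirect product, as a subgroup. -/
def base (p : R[T;T⁻¹]) : Lamp R := ⟨p, 0⟩

@[simp] theorem base_poly (p : R[T;T⁻¹]) : (base p).poly = p := rfl
@[simp] theorem base_shift (p : R[T;T⁻¹]) : (base p).shift = 0 := rfl

theorem base_add (p q : R[T;T⁻¹]) : base (p + q) = base p * base q := by
  ext1
  · simp [mul_poly]
  · simp

theorem base_zero : base (0 : R[T;T⁻¹]) = 1 := rfl

theorem base_neg (p : R[T;T⁻¹]) : base (-p) = (base p)⁻¹ := by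
  rw [eq_inv_iff_mul_eq_one, ← base_add, neg_add_cancel, base_zero]

theorem eq_base_of_shift {x : Lamp R} (h : x.shift = 0) : x = base x.poly := by
  ext1
  · rfl
  · exact h

theorem conj_base (x : Lamp R) (q : R[T;T⁻¹]) : x * base q * x⁻¹ = base (T x.shift * q) := by
  rw [mul_inv_eq_iff_eq_mul]
  ext1
  · simp [mul_poly, add_comm]
  · simp

theorem zpow_conj_base (x : Lamp R) (n : ℤ) (q : R[T;T⁻¹]) :
    x ^ n * base q * (x ^ n)⁻¹ = base (T (n * x.shift) * q) := by
  rw [conj_base, zpow_shift]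

/-- A homomorphism from its values on the two factors of the semidirect product. -/
def lift {S : Type*} [CommRing S] (σ : R[T;T⁻¹] →+* S[T;T⁻¹]) (y : S[T;T⁻¹]) (t : Lamp S)
    (h : ∀ s, σ (T s) = T (s * t.shift)) : Lamp R →* Lamp S where
  toFun x := base (σ x.poly * y) * t ^ x.shift
  map_one' := by simp [base_zero]
  map_mul' x z := by
    have e : σ (x * z).poly * y = σ x.poly * y + T (x.shift * t.shift) * (σ z.poly * y) := by
      rw [mul_poly, map_add, map_mul, h]; ring
    rw [e, base_add, ← zpow_conj_base, mul_shift, zpow_add]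
    group

theorem lift_apply {S : Type*} [CommRing S] (σ : R[T;T⁻¹] →+* S[T;T⁻¹]) (y : S[T;T⁻¹])
    (t : Lamp S) (h : ∀ s, σ (T s) = T (s * t.shift)) (x : Lamp R) :
    lift σ y t h x = base (σ x.poly * y) * t ^ x.shift := rfl

/-- The unit `T ^ n`. -/
def unitT (R : Type*) [CommRing R] (n : ℤ) : R[T;T⁻¹]ˣ :=
  ⟨T n, T (-n), by rw [← T_add, add_neg_cancel, T_zero], by rw [← T_add, neg_add_cancel, T_zero]⟩

theorem unitT_zpow (n s : ℤ) : ((unitT R n ^ s : R[T;T⁻¹]ˣ) : R[T;T⁻¹]) = T (s * n) := by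
  have h : ∀ m : ℕ, ((unitT R n ^ m : R[T;T⁻¹]ˣ) : R[T;T⁻¹]) = T (m * n) := fun m => by
    rw [Units.val_pow_eq_pow_val]; exact T_pow n m
  rcases Int.eq_nat_or_neg s with ⟨m, rfl | rfl⟩
  · rw [zpow_natCast, h]
  · rw [zpow_neg, zpow_natCast]
    refine Units.inv_eq_of_mul_eq_one_right ?_
    rw [h, ← T_add]; simp

/-- The substitution of `T ^ n` for `T`. -/
def substT (n : ℤ) : R[T;T⁻¹] →+* R[T;T⁻¹] := eval₂ C (unitT R n)

theorem substT_T (n s : ℤ) : substT n (T s : R[T;T⁻¹]) = T (s * n) := by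
  rw [substT, eval₂_T, unitT_zpow]

/-- The generator of the base group. -/
def genA : Lamp ℤ := base 1

/-- The generator that acts on the base group as `T`. -/
def genT : Lamp ℤ := ⟨0, 1⟩

/-- A homomorphism into the base group's semidirect product with given images of the
generators. -/
def endo (y : ℤ[T;T⁻¹]) (t : Lamp ℤ) : Lamp ℤ →* Lamp ℤ :=
  lift (substT t.shift) y t fun s => substT_T _ s

theorem endo_genA (y : ℤ[T;T⁻¹]) (t : Lamp ℤ) : endo y t genA = base y := by
  simp [endo, lift_apply, genA]

theorem endo_genT (y : ℤ[T;T⁻¹]) (t : Lamp ℤ) : endo y t genT = t := by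
  simp [endo, lift_apply, genT, base_zero]

theorem endo_base (y p : ℤ[T;T⁻¹]) (t : Lamp ℤ) :
    endo y t (base p) = base (substT t.shift p * y) := by
  simp [endo, lift_apply]

theorem substT_one (p : R[T;T⁻¹]) : substT 1 p = p := by
  induction p using LaurentPolynomial.induction_on' with
  | add p q hp hq => rw [map_add, hp, hq]
  | C_mul_T n a => rw [map_mul, substT_T, substT, eval₂_C, mul_one]

/-- The case of interest is m = n with n * n = 1, where `substT n` becomes its own inverse. -/
theorem substT_substT (m n : ℤ) (p : R[T;T⁻¹]) : substT m (substT n p) = substT (n * m) p := by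
  induction p using LaurentPolynomial.induction_on' with
  | add p q hp hq => rw [map_add, map_add, map_add, hp, hq]
  | C_mul_T s a =>
    simp only [map_mul, substT_T, mul_assoc]
    simp only [substT, eval₂_C]

/-- A unit of the base ring and an element that acts as `T` or `T⁻¹` generate. -/
theorem closure_eq_top {u : ℤ[T;T⁻¹]} (hu : IsUnit u) {t : Lamp ℤ} (ht : t.shift * t.shift = 1) :
    Subgroup.closure {base u, t} = ⊤ := by
  set H := Subgroup.closure {base u, t} with hH
  have hu' : base u ∈ H := Subgroup.subset_closure (by simp)
  have ht' : t ∈ H := Subgroup.subset_closure (by simp)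
  -- As the shift of t is ±1, conjugation by powers of t multiplies by every power of T.
  have h1 : ∀ (n : ℤ) p, base p ∈ H → base (T n * p) ∈ H := by
    intro n p hp
    have e : n = n * t.shift * t.shift := by rw [mul_assoc, ht, mul_one]
    rw [e, ← zpow_conj_base]
    exact mul_mem (mul_mem (zpow_mem ht' _) hp) (inv_mem (zpow_mem ht' _))
  have h2 : ∀ p, base (p * u) ∈ H := by
    intro p
    induction p using LaurentPolynomial.induction_on' with
    | add p q hp hq => rw [add_mul, base_add]; exact mul_mem hp hq
    | C_mul_T n a =>
      rw [mul_comm (C a), mul_assoc]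
      refine h1 _ _ ?_
      induction a using Int.induction_on with
      | zero => simp [base_zero, one_mem]
      | succ i ih => rw [map_add, add_mul, base_add, map_one, one_mul]; exact mul_mem ih hu'
      | pred i ih =>
        rw [map_sub, map_one, sub_mul, one_mul, sub_eq_add_neg, base_add, base_neg]
        exact mul_mem ih (inv_mem hu')
  have h3 : ∀ p, base p ∈ H := by
    intro p
    obtain ⟨v, hv⟩ := hu.exists_left_inv
    have := h2 (p * v)
    rwa [mul_assoc, hv, mul_one] at this
  refine (Subgroup.eq_top_iff' _).2 fun x => ?_
  -- Dividing by the power of t with the same shift leads into the base; `t.shift` is its own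
  -- inverse.
  have h4 : (x * (t ^ (x.shift * t.shift))⁻¹).shift = 0 := by
    rw [mul_shift, inv_shift, zpow_shift, mul_assoc, ht, mul_one, add_neg_cancel]
  have h5 := mul_mem (h3 (x * (t ^ (x.shift * t.shift))⁻¹).poly) (zpow_mem ht' (x.shift * t.shift))
  rwa [← eq_base_of_shift h4, inv_mul_cancel_right] at h5

theorem closure_gen : Subgroup.closure {genA, genT} = ⊤ := closure_eq_top isUnit_one rfl

/-- Commuting means (T^s - 1) p = 0 in a domain, hence T^s = 1 and s = 0. Thus one non-trivial base
element defines the base group without quantifiers. -/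
theorem commute_base_iff {p : ℤ[T;T⁻¹]} (hp : p ≠ 0) (x : Lamp ℤ) :
    x * base p = base p * x ↔ x.shift = 0 := by
  rw [← mul_inv_eq_iff_eq_mul, conj_base, Lamp.ext_iff]
  simp only [base_poly, base_shift, and_true]
  constructor
  · intro h
    have h' : (T x.shift : ℤ[T;T⁻¹]) = 1 := by
      have : ((T x.shift : ℤ[T;T⁻¹]) - 1) * p = 0 := by rw [sub_mul, h, one_mul, sub_self]
      exact sub_eq_zero.1 ((mul_eq_zero.1 this).resolve_right hp)
    have h2 := congrArg degree h'
    rw [← T_zero, degree_T, degree_T] at h2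
    exact_mod_cast h2
  · intro h; rw [h, T_zero, one_mul]

/-- An element that commutes with one of its conjugates different from itself is in the base. -/
theorem shift_eq_zero_of_commute {a t : Lamp ℤ} (h : a * (t * a * t⁻¹) = t * a * t⁻¹ * a)
    (hne : t * a * t⁻¹ ≠ a) : a.shift = 0 := by
  by_contra h0
  apply hne
  set b := t * a * t⁻¹ with hb
  have hs : b.shift = a.shift := by simp [hb]
  -- Conjugates have equal shifts, so commuting reduces to (T^s - 1)(b - a) = 0 in a domain.
  have h1 : a.poly + T a.shift * b.poly = b.poly + T b.shift * a.poly := congrArg poly h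
  rw [hs] at h1
  have h2 : ((T a.shift : ℤ[T;T⁻¹]) - 1) * (b.poly - a.poly) = 0 := by linear_combination h1
  have h3 : ((T a.shift : ℤ[T;T⁻¹]) - 1) ≠ 0 := by
    intro h4
    have h5 := congrArg degree (sub_eq_zero.1 h4)
    rw [← T_zero, degree_T, degree_T] at h5
    exact h0 (by exact_mod_cast h5)
  ext1
  · exact sub_eq_zero.1 ((mul_eq_zero.1 h2).resolve_left h3)
  · exact hs

/-- The units of the ring of integer Laurent polynomials. -/
theorem isUnit_iff {p : ℤ[T;T⁻¹]} : IsUnit p ↔ ∃ j : ℤ, p = T j ∨ p = -T j := by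
  constructor
  · intro hp
    obtain ⟨q, hq⟩ := hp.exists_right_inv
    -- Clearing denominators turns p q = 1 into a factorization of X^(m + n) in ℤ[X]; as X is prime,
    -- p' is a unit times a power of X.
    obtain ⟨m, p', hp'⟩ := exists_T_pow p
    obtain ⟨n, q', hq'⟩ := exists_T_pow q
    have h1 : p' * q' = Polynomial.X ^ (m + n) := by
      apply Polynomial.toLaurent_injective
      rw [map_mul, hp', hq', Polynomial.toLaurent_X_pow, Nat.cast_add, T_add]
      linear_combination (T (m : ℤ) * T (n : ℤ)) * hq
    obtain ⟨i, -, hi⟩ := (dvd_prime_pow Polynomial.prime_X _).1 (Dvd.intro _ h1)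
    obtain ⟨u, hu⟩ := hi.symm
    obtain ⟨r, hr, hr'⟩ := Polynomial.isUnit_iff.1 u.isUnit
    have h2 : p = C r * T (i - m) := by
      have h3 : p * T m = C r * T (i : ℤ) := by
        rw [← hp', ← hu, ← hr', map_mul, Polynomial.toLaurent_X_pow, Polynomial.toLaurent_C,
          mul_comm]
      have h4 := congrArg (· * T (-(m : ℤ))) h3
      simp only [mul_T_assoc, add_neg_cancel, T_zero, mul_one] at h4
      rw [h4, sub_eq_add_neg]
    refine ⟨i - m, ?_⟩
    rcases Int.isUnit_iff.1 hr with rfl | rfl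
    · left; simpa using h2
    · right; simpa using h2
  · rintro ⟨j, rfl | rfl⟩
    · exact isUnit_T j
    · exact (isUnit_T j).neg

/-- The group of pairs of integer Laurent polynomials and integers is the wreath product
of `ℤ` by `ℤ`. -/
def equivZwrZ : Lamp ℤ ≃* ZwrZ :=
  MulEquiv.ofBijective
    (MonoidHom.mk'
      (fun x => (⟨⟨fun h => Multiplicative.ofAdd (x.poly.coeff h.toAdd),
          Multiplicative.ofAdd x.shift⟩, by
        refine Set.Finite.subset (x.poly.coeff.hasFiniteSupport.image Multiplicative.ofAdd) ?_
        intro h hh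
        exact ⟨h.toAdd, by simpa [Function.mem_mulSupport] using hh, rfl⟩⟩ : ZwrZ))
      (fun x y => by
        apply Subtype.ext
        apply RegularWreathProduct.ext
        · funext h
          have e : (x * y).poly.coeff h.toAdd =
              x.poly.coeff h.toAdd + y.poly.coeff (-x.shift + h.toAdd) := by
            rw [mul_poly, AddMonoidAlgebra.coeff_add, Finsupp.add_apply, T,
              AddMonoidAlgebra.coeff_single_mul_apply, one_mul]
          exact congrArg Multiplicative.ofAdd e
        · simp [ofAdd_add]))
    ⟨by
      intro x y h
      have h1 := congrArg (fun z : ZwrZ => z.1.left) h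
      have h2 := congrArg (fun z : ZwrZ => z.1.right) h
      ext1
      · apply LaurentPolynomial.ext
        intro a
        exact Multiplicative.ofAdd.injective (congrFun h1 (Multiplicative.ofAdd a))
      · exact Multiplicative.ofAdd.injective h2, by
      rintro ⟨⟨f, s⟩, hf⟩
      have hf' : (Function.support fun z : ℤ => (f (Multiplicative.ofAdd z)).toAdd).Finite := by
        refine Set.Finite.subset (Set.Finite.image Multiplicative.toAdd hf) ?_
        intro z hz
        exact ⟨Multiplicative.ofAdd z, by simpa [Function.mem_mulSupport] using hz, rfl⟩
      refine ⟨⟨⟨Finsupp.ofSupportFinite _ hf'⟩, s.toAdd⟩, ?_⟩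
      rfl⟩

end Lamp

end

end GroupScott
-- Normal forms of words and the decidable word problem.
namespace GroupScott
open LaurentPolynomial

noncomputable section

/-! ### Words in normal form -/

/-- The entry `(b, (p, m), g)` stands for the generator `g` at the position `p - m`, or for its
inverse, according to the sign `b`. -/
abbrev Entry : Type := Bool × (ℕ × ℕ) × ℕ

/-- A list of entries, and the difference of two natural numbers. -/
abbrev NForm : Type := List Entry × (ℕ × ℕ)

namespace NForm

def entryShift (a b : ℕ) (e : Entry) : Entry := (e.1, (e.2.1.1 + a, e.2.1.2 + b), e.2.2)

def entryNeg (e : Entry) : Entry := (!e.1, e.2)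

def one : NForm := ([], (0, 0))

def inv (x : NForm) : NForm :=
  (x.1.map fun e => entryNeg (entryShift x.2.2 x.2.1 e), (x.2.2, x.2.1))

def mul (x y : NForm) : NForm :=
  (x.1 ++ y.1.map (entryShift x.2.1 x.2.2), (x.2.1 + y.2.1, x.2.2 + y.2.2))

/-- The generator `g` at the position `0`. -/
def gen (g : ℕ) : NForm := ([(true, (0, 0), g)], (0, 0))

/-- The generator that shifts the positions. -/
def shiftGen : NForm := ([], (1, 0))

section Val

variable {R : Type*} [CommRing R] (w : ℕ → R)

def entryPos (e : Entry) : ℤ := e.2.1.1 - e.2.1.2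

def entryVal (e : Entry) : R[T;T⁻¹] := (if e.1 then 1 else -1) * C (w e.2.2) * T (entryPos e)

def listVal (l : List Entry) : R[T;T⁻¹] := (l.map (entryVal w)).sum

/-- The value of a normal form, where the generator `g` has the value `w g`. -/
def val (x : NForm) : Lamp R := ⟨listVal w x.1, x.2.1 - x.2.2⟩

theorem entryVal_shift (a b : ℕ) (e : Entry) :
    entryVal w (entryShift a b e) = T ((a : ℤ) - b) * entryVal w e := by
  have : entryPos (entryShift a b e) = (a - b) + entryPos e := by
    simp only [entryPos, entryShift]; push_cast; ring
  rw [entryVal, this, T_add, entryVal]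
  rcases e with ⟨c, p, g⟩
  cases c <;> simp only [entryShift, Bool.false_eq_true, reduceIte] <;> ring

theorem entryVal_neg (e : Entry) : entryVal w (entryNeg e) = -entryVal w e := by
  rcases e with ⟨b, p, g⟩
  cases b <;> simp [entryVal, entryNeg, entryPos]

@[simp] theorem listVal_nil : listVal w [] = 0 := rfl

@[simp] theorem listVal_cons (e : Entry) (l : List Entry) :
    listVal w (e :: l) = entryVal w e + listVal w l := by simp [listVal]

theorem listVal_append (l l' : List Entry) : listVal w (l ++ l') = listVal w l + listVal w l' := by
  simp [listVal]

theorem listVal_shift (a b : ℕ) (l : List Entry) :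
    listVal w (l.map (entryShift a b)) = T ((a : ℤ) - b) * listVal w l := by
  induction l with
  | nil => simp
  | cons e l ih => rw [List.map_cons, listVal_cons, ih, entryVal_shift, listVal_cons, mul_add]

theorem listVal_neg (l : List Entry) : listVal w (l.map entryNeg) = -listVal w l := by
  induction l with
  | nil => simp
  | cons e l ih => rw [List.map_cons, listVal_cons, ih, entryVal_neg, listVal_cons, neg_add]

theorem val_one : val w one = 1 := by
  ext1 <;> simp [val, one]

theorem val_mul (x y : NForm) : val w (mul x y) = val w x * val w y := by
  ext1
  · simp only [val, mul, Lamp.mul_poly, listVal_append, listVal_shift]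
  · simp only [val, mul, Lamp.mul_shift]; push_cast; ring

theorem val_inv (x : NForm) : val w (inv x) = (val w x)⁻¹ := by
  ext1
  · have : listVal w (inv x).1 = -(T ((x.2.2 : ℤ) - x.2.1) * listVal w x.1) := by
      rw [← listVal_shift, ← listVal_neg, List.map_map]; rfl
    simp only [val, this, Lamp.inv_poly, neg_sub]
  · simp only [val, inv, Lamp.inv_shift]; ring

theorem val_gen (g : ℕ) : val w (gen g) = Lamp.base (C (w g)) := by
  ext1
  · simp [val, gen, entryVal, entryPos]
  · simp [val, gen]

theorem val_shiftGen : val w shiftGen = ⟨0, 1⟩ := by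
  ext1 <;> simp [val, shiftGen]

/-- The multiplicity of the generators at the position `z`. -/
def mult (z : ℤ) (l : List Entry) : ℕ →₀ ℤ :=
  (l.map fun e => if entryPos e = z then Finsupp.single e.2.2 (if e.1 then 1 else -1) else 0).sum

@[simp] theorem mult_nil (z : ℤ) : mult z [] = 0 := rfl

@[simp] theorem mult_cons (z : ℤ) (e : Entry) (l : List Entry) :
    mult z (e :: l) =
      (if entryPos e = z then Finsupp.single e.2.2 (if e.1 then 1 else -1) else 0) + mult z l := by
  simp [mult]

/-- Entries at different positions do not interact, so the word problem splits into integer linear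
relations among the weights, one for each position. -/
theorem coeff_listVal (z : ℤ) (l : List Entry) :
    (listVal w l).coeff z = Finsupp.linearCombination ℤ w (mult z l) := by
  induction l with
  | nil => simp
  | cons e l ih =>
    have h : (entryVal w e).coeff z =
        if entryPos e = z then (if e.1 then 1 else -1) * w e.2.2 else 0 := by
      rcases e with ⟨b, p, g⟩
      have : entryVal w (b, p, g) = .single (entryPos (b, p, g)) ((if b then 1 else -1) * w g) := by
        rw [single_eq_C_mul_T]; cases b <;> simp [entryVal]
      rw [this]
      simp only [AddMonoidAlgebra.coeff_single, Finsupp.single_apply]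
    rw [listVal_cons, AddMonoidAlgebra.coeff_add, Finsupp.add_apply, ih, h, mult_cons, map_add]
    congr 1
    split_ifs <;> simp

theorem mult_eq_zero {z : ℤ} {l : List Entry} (h : ∀ e ∈ l, entryPos e ≠ z) : mult z l = 0 := by
  induction l with
  | nil => rfl
  | cons e l ih =>
    rw [mult_cons, if_neg (h e (by simp)), zero_add, ih fun e he => h e (by simp [he])]

/-- Only positions that occur in the list can carry a non-zero coefficient, so finitely many checks
suffice. -/
theorem listVal_eq_zero_iff (l : List Entry) :
    listVal w l = 0 ↔ ∀ e ∈ l, Finsupp.linearCombination ℤ w (mult (entryPos e) l) = 0 := by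
  constructor
  · intro h e _
    rw [← coeff_listVal, h]; rfl
  · intro h
    apply LaurentPolynomial.ext
    intro z
    by_cases hz : ∃ e ∈ l, entryPos e = z
    · obtain ⟨e, he, rfl⟩ := hz
      rw [coeff_listVal, h e he]; rfl
    · push Not at hz
      rw [coeff_listVal, mult_eq_zero hz, map_zero]; rfl

/-- Bounds the size of the relations that a word can produce, and so how closely the weights must be
approximated. -/
theorem sum_natAbs_mult_le (z : ℤ) (l : List Entry) :
    ((mult z l).sum fun _ c => c.natAbs) ≤ l.length := by
  induction l with
  | nil => simp
  | cons e l ih =>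
    rw [mult_cons, List.length_cons]
    have hadd : ∀ f g : ℕ →₀ ℤ, ((f + g).sum fun _ c => c.natAbs) ≤
        (f.sum fun _ c => c.natAbs) + g.sum fun _ c => c.natAbs := by
      intro f g
      classical
      have h1 := Finsupp.sum_of_support_subset (f + g)
        (Finsupp.support_add (g₁ := f) (g₂ := g)) (fun _ c => c.natAbs) (by simp)
      have h2 := Finsupp.sum_of_support_subset f
        (Finset.subset_union_left (s₂ := g.support)) (fun _ c => c.natAbs) (by simp)
      have h3 := Finsupp.sum_of_support_subset g
        (Finset.subset_union_right (s₁ := f.support)) (fun _ c => c.natAbs) (by simp)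
      rw [h1, h2, h3, ← Finset.sum_add_distrib]
      exact Finset.sum_le_sum fun i _ => Int.natAbs_add_le _ _
    refine (hadd _ _).trans ?_
    have h1 : ((if entryPos e = z then Finsupp.single e.2.2 (if e.1 then (1 : ℤ) else -1) else 0).sum
        fun _ c => c.natAbs) ≤ 1 := by
      split_ifs
      · rw [Finsupp.sum_single_index] <;> simp
      · rw [Finsupp.sum_single_index] <;> simp
      · simp
    omega

theorem support_mult_subset {z : ℤ} {l : List Entry} {g : ℕ} (hg : g ∈ (mult z l).support) :
    ∃ e ∈ l, e.2.2 = g := by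
  induction l with
  | nil => simp at hg
  | cons e l ih =>
    rw [mult_cons] at hg
    classical
    rcases Finset.mem_union.1 (Finsupp.support_add hg) with h | h
    · refine ⟨e, by simp, ?_⟩
      split_ifs at h
      · exact (Finset.mem_singleton.1 (Finsupp.support_single_subset h)).symm
      · exact (Finset.mem_singleton.1 (Finsupp.support_single_subset h)).symm
      · simp at h
    · obtain ⟨e', he', h'⟩ := ih h
      exact ⟨e', by simp [he'], h'⟩

end Val

/-! ### Natural number weights -/

section Weight

variable (ω : ℕ → ℕ)

/-- The total weight of the entries of sign `b` at the position `p - m`. -/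
def sideSum (b : Bool) (q : ℕ × ℕ) (l : List Entry) : ℕ :=
  l.foldr (fun e acc => if e.1 = b ∧ e.2.1.1 + q.2 = q.1 + e.2.1.2 then acc + ω e.2.2 else acc) 0

/-- The vanishing of the value, for the weights `ω`. -/
def IsZero (l : List Entry) : Prop :=
  ∀ e ∈ l, sideSum ω true e.2.1 l = sideSum ω false e.2.1 l

/-- Positive and negative entries are added up separately in ℕ, so that vanishing becomes an
equation between natural numbers, ready for primitive recursion. -/
theorem linearCombination_mult (q : ℕ × ℕ) (l : List Entry) :
    Finsupp.linearCombination ℤ (fun g => (ω g : ℤ)) (mult ((q.1 : ℤ) - q.2) l) =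
      sideSum ω true q l - sideSum ω false q l := by
  induction l with
  | nil => simp [sideSum]
  | cons e l ih =>
    rw [mult_cons, map_add, ih]
    rcases e with ⟨b, p, g⟩
    have h : entryPos (b, p, g) = (q.1 : ℤ) - q.2 ↔ p.1 + q.2 = q.1 + p.2 := by
      simp only [entryPos]; omega
    have hs : ∀ b', sideSum ω b' q ((b, p, g) :: l) =
        if b = b' ∧ p.1 + q.2 = q.1 + p.2 then sideSum ω b' q l + ω g else sideSum ω b' q l :=
      fun _ => rfl
    simp only [h, hs]
    by_cases hp : p.1 + q.2 = q.1 + p.2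
    · cases b <;> simp [hp] <;> ring
    · simp [hp]

theorem isZero_iff (l : List Entry) : IsZero ω l ↔ listVal (fun g => (ω g : ℤ)) l = 0 := by
  rw [listVal_eq_zero_iff]
  refine forall₂_congr fun e _ => ?_
  rw [entryPos, linearCombination_mult, sub_eq_zero, Nat.cast_inj]

/-- The triviality of a normal form, for the weights `ω`. -/
def IsOne (x : NForm) : Prop := IsZero ω x.1 ∧ x.2.1 = x.2.2

theorem isOne_iff (x : NForm) : IsOne ω x ↔ val (fun g => (ω g : ℤ)) x = 1 := by
  rw [IsOne, isZero_iff, Lamp.ext_iff]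
  simp only [val, Lamp.one_poly, Lamp.one_shift]
  refine and_congr_right fun _ => ?_
  omega

/-- A list whose value is `±T ^ j`, where all generators have the weight `1`. -/
def IsUnitList (l : List Entry) : Prop := ∃ e ∈ l, IsZero (fun _ => 1) (entryNeg e :: l)

/-- The units are ±T^j. If the value is such a unit, its coefficient at j is non-zero with that
sign, so an entry with this sign and position must occur: the unit can be found among the entries.
-/
theorem isUnitList_iff (l : List Entry) : IsUnitList l ↔ IsUnit (listVal (fun _ => (1 : ℤ)) l) := by
  have key : ∀ e, IsZero (fun _ => 1) (entryNeg e :: l) ↔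
      listVal (fun _ => (1 : ℤ)) l = entryVal (fun _ => (1 : ℤ)) e := by
    intro e
    rw [isZero_iff, listVal_cons, entryVal_neg]
    simp only [Nat.cast_one]
    rw [neg_add_eq_zero, eq_comm]
  simp only [IsUnitList, key]
  rw [Lamp.isUnit_iff]
  constructor
  · rintro ⟨e, -, he⟩
    refine ⟨entryPos e, ?_⟩
    rw [he]
    rcases e with ⟨b, p, g⟩
    cases b <;> simp [entryVal, entryPos]
  · intro h
    have hex : ∃ (b : Bool) (j : ℤ), listVal (fun _ => (1 : ℤ)) l = (if b then 1 else -1) * T j := by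
      obtain ⟨j, h | h⟩ := h
      · exact ⟨true, j, by simp [h]⟩
      · exact ⟨false, j, by simp [h]⟩
    obtain ⟨b, j, hb⟩ := hex
    have hco : (listVal (fun _ => (1 : ℤ)) l).coeff j = if b then 1 else -1 := by
      have : (if b then (1 : ℤ[T;T⁻¹]) else -1) * T j = .single j (if b then 1 else -1) := by
        rw [single_eq_C_mul_T]; cases b <;> simp
      rw [hb, this, AddMonoidAlgebra.coeff_single, Finsupp.single_eq_same]
    by_contra hno
    push Not at hno
    have hsign : ∀ e ∈ l, entryPos e = j → e.1 = !b := by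
      intro e he hej
      by_contra hne
      apply hno e he
      have : e.1 = b := by revert hne; cases e.1 <;> cases b <;> simp
      rw [hb, entryVal, hej, this]
      simp
    -- If every entry at position j had the opposite sign, the coefficient times the sign would be
    -- non-positive, whereas it is 1.
    have hle : ∀ l' : List Entry, (∀ e ∈ l', entryPos e = j → e.1 = !b) →
        (if b then 1 else -1) * (listVal (fun _ => (1 : ℤ)) l').coeff j ≤ 0 := by
      intro l' hl'
      rw [coeff_listVal]
      induction l' with
      | nil => simp
      | cons e l' ih =>
        rw [mult_cons, map_add, mul_add]
        have h1 := ih fun e he => hl' e (by simp [he])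
        have h2 := hl' e (by simp)
        have h3 : (if b then (1 : ℤ) else -1) * Finsupp.linearCombination ℤ (fun _ : ℕ => (1 : ℤ))
            (if entryPos e = j then Finsupp.single e.2.2 (if e.1 then 1 else -1) else 0) ≤ 0 := by
          split_ifs with hb' hj he he <;> simp_all
        exact add_nonpos h3 h1
    have := hle l hsign
    rw [hco] at this
    cases b <;> simp at this

end Weight

/-! ### Primitive recursiveness -/

section Primrec

theorem primrec_entryShift : Primrec fun p : (ℕ × ℕ) × Entry => entryShift p.1.1 p.1.2 p.2 := by
  have h1 : Primrec fun p : (ℕ × ℕ) × Entry => p.2.2.1 :=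
    Primrec.fst.comp (Primrec.snd.comp Primrec.snd)
  exact Primrec.pair (Primrec.fst.comp Primrec.snd) (Primrec.pair (Primrec.pair
    (Primrec.nat_add.comp (Primrec.fst.comp h1) (Primrec.fst.comp Primrec.fst))
    (Primrec.nat_add.comp (Primrec.snd.comp h1) (Primrec.snd.comp Primrec.fst)))
    (Primrec.snd.comp (Primrec.snd.comp Primrec.snd)))

theorem primrec_entryNeg : Primrec entryNeg :=
  Primrec.pair (Primrec.not.comp Primrec.fst) Primrec.snd

theorem primrec_swap {α β : Type*} [Primcodable α] [Primcodable β] :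
    Primrec fun p : α × β => (p.2, p.1) := Primrec.pair Primrec.snd Primrec.fst

theorem primrec_inv : Primrec inv :=
  Primrec.pair (Primrec.list_map Primrec.fst (primrec_entryNeg.comp (primrec_entryShift.comp
    (Primrec.pair (primrec_swap.comp (Primrec.snd.comp Primrec.fst)) Primrec.snd))))
    (primrec_swap.comp Primrec.snd)

theorem primrec_mul : Primrec₂ mul := by
  have h1 : Primrec fun p : NForm × NForm => p.1.2 := Primrec.snd.comp Primrec.fst
  have h2 : Primrec fun p : NForm × NForm => p.2.2 := Primrec.snd.comp Primrec.snd
  exact Primrec.pair (Primrec.list_append.comp (Primrec.fst.comp Primrec.fst)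
    (Primrec.list_map (Primrec.fst.comp Primrec.snd)
      (primrec_entryShift.comp (Primrec.pair (h1.comp Primrec.fst) Primrec.snd))))
    (Primrec.pair (Primrec.nat_add.comp (Primrec.fst.comp h1) (Primrec.fst.comp h2))
      (Primrec.nat_add.comp (Primrec.snd.comp h1) (Primrec.snd.comp h2)))

variable {α : Type*} [Primcodable α] {ω : α → ℕ → ℕ}

theorem primrec_sideSum (h : Primrec₂ ω) (b : Bool) :
    Primrec fun p : (α × (ℕ × ℕ)) × List Entry => sideSum (ω p.1.1) b p.1.2 p.2 := by
  refine Primrec.list_foldr (α := (α × (ℕ × ℕ)) × List Entry) (f := fun p => p.2)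
    (g := fun _ => 0)
    (h := fun p q => if q.1.1 = b ∧ q.1.2.1.1 + p.1.2.2 = p.1.2.1 + q.1.2.1.2
      then q.2 + ω p.1.1 q.1.2.2 else q.2) Primrec.snd (Primrec.const 0) ?_
  have he : Primrec fun r : ((α × (ℕ × ℕ)) × List Entry) × (Entry × ℕ) => r.2.1 :=
    Primrec.fst.comp Primrec.snd
  have hp : Primrec fun r : ((α × (ℕ × ℕ)) × List Entry) × (Entry × ℕ) => r.2.1.2.1 :=
    Primrec.fst.comp (Primrec.snd.comp he)
  have hq : Primrec fun r : ((α × (ℕ × ℕ)) × List Entry) × (Entry × ℕ) => r.1.1.2 :=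
    Primrec.snd.comp (Primrec.fst.comp Primrec.fst)
  have ha : Primrec fun r : ((α × (ℕ × ℕ)) × List Entry) × (Entry × ℕ) => r.2.2 :=
    Primrec.snd.comp Primrec.snd
  refine Primrec.ite (PrimrecPred.and (Primrec.eq.comp (Primrec.fst.comp he) (Primrec.const b))
    (Primrec.eq.comp (Primrec.nat_add.comp (Primrec.fst.comp hp) (Primrec.snd.comp hq))
      (Primrec.nat_add.comp (Primrec.fst.comp hq) (Primrec.snd.comp hp)))) ?_ ha
  exact Primrec.nat_add.comp ha (h.comp (Primrec.fst.comp (Primrec.fst.comp Primrec.fst))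
    (Primrec.snd.comp (Primrec.snd.comp he)))

theorem primrecPred_isZero (h : Primrec₂ ω) :
    PrimrecPred fun p : α × List Entry => IsZero (ω p.1) p.2 := by
  have hR : PrimrecRel fun (e : Entry) (p : α × List Entry) =>
      sideSum (ω p.1) true e.2.1 p.2 = sideSum (ω p.1) false e.2.1 p.2 := by
    have hs : ∀ b, Primrec fun p : Entry × (α × List Entry) =>
        sideSum (ω p.2.1) b p.1.2.1 p.2.2 := fun b =>
      (primrec_sideSum h b).comp (Primrec.pair (Primrec.pair (Primrec.fst.comp Primrec.snd)
        (Primrec.fst.comp (Primrec.snd.comp Primrec.fst))) (Primrec.snd.comp Primrec.snd))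
    exact Primrec.eq.comp (hs true) (hs false)
  exact hR.forall_mem_list.comp Primrec.snd Primrec.id

theorem primrecPred_isOne (h : Primrec₂ ω) :
    PrimrecPred fun p : α × NForm => IsOne (ω p.1) p.2 :=
  PrimrecPred.and ((primrecPred_isZero h).comp
      (Primrec.pair Primrec.fst (Primrec.fst.comp Primrec.snd)))
    (Primrec.eq.comp (Primrec.fst.comp (Primrec.snd.comp Primrec.snd))
      (Primrec.snd.comp (Primrec.snd.comp Primrec.snd)))

theorem primrecPred_isUnitList : PrimrecPred IsUnitList := by
  have hR : PrimrecRel fun (e : Entry) (l : List Entry) =>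
      IsZero (fun _ => 1) (entryNeg e :: l) :=
    (primrecPred_isZero (α := Unit) (ω := fun _ _ => 1) (Primrec.const 1)).comp
      (Primrec.pair (Primrec.const ()) (Primrec.list_cons.comp
        (primrec_entryNeg.comp Primrec.fst) Primrec.snd))
  exact hR.exists_mem_list.comp Primrec.id Primrec.id

end Primrec

end NForm

end

end GroupScott
-- The universal condition `Theta` that forces a pair to generate.
namespace GroupScott
open LaurentPolynomial

noncomputable section

/-! ### The characterization of the pairs of generators -/

/-- The assignment of `a` to the even and of `t` to the odd variables. -/
def pairVal {M : Type*} (a t : M) (i : ℕ) : M := if i % 2 = 0 then a else t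

/-- The assignment of `a, t, y, b` to `x₀, x₁, x₂, x₃`, and of `b` to the other variables. -/
def quadVal {M : Type*} (a t y b : M) (i : ℕ) : M :=
  if i = 0 then a else if i = 1 then t else if i = 2 then y else b

/-- The substitution of `x_i` and `x_j` for the even and the odd variables. -/
def pairSubst (i j : ℕ) : ℕ → ℕ := fun k => if k % 2 = 0 then codeVar i else codeVar j

theorem wordEval_pairSubst {M : Type*} [groupLang.Structure M] (v : ℕ → M) (i j : ℕ) :
    (fun k => wordEval v (pairSubst i j k)) = pairVal (v i) (v j) := by
  funext k
  simp only [pairSubst, pairVal]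
  split_ifs <;> simp

/-- The normal form of the word with code `c` in the standard generators. -/
def normalForm (c : ℕ) : NForm :=
  codeRec NForm.one (fun i => if i % 2 = 0 then NForm.gen 0 else NForm.shiftGen)
    NForm.inv NForm.mul c

theorem val_normalForm (c : ℕ) : NForm.val (fun _ => (1 : ℤ)) (normalForm c) =
    wordEval (pairVal Lamp.genA Lamp.genT) c := by
  unfold normalForm
  induction c using code_induction with
  | one => simp [NForm.val_one]
  | var i =>
    simp only [codeRec_var, wordEval_var, pairVal]
    split_ifs
    · simp [NForm.val_gen, Lamp.genA]
    · simp [NForm.val_shiftGen, Lamp.genT]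
  | inv a ha => simp [NForm.val_inv, ha]
  | mul a b ha hb => simp [NForm.val_mul, ha, hb]

theorem primrec_normalForm : Primrec normalForm := by
  have := primrec_codeRec (α := Unit) (one := fun _ => NForm.one)
    (var := fun _ i => if i % 2 = 0 then NForm.gen 0 else NForm.shiftGen)
    (inv := fun _ => NForm.inv) (mul := fun _ => NForm.mul) (Primrec.const _)
    (Primrec.ite (Primrec.eq.comp (Primrec.nat_mod.comp Primrec.snd (Primrec.const 2))
      (Primrec.const 0)) (Primrec.const _) (Primrec.const _))
    (NForm.primrec_inv.comp Primrec.snd)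
    (NForm.primrec_mul.comp (Primrec.fst.comp Primrec.snd) (Primrec.snd.comp Primrec.snd))
  exact this.comp (Primrec.const ()) Primrec.id

/-- The truth of the literal with code `k` for the standard generators. -/
def GenLit (k : ℕ) : Prop := litEval (pairVal Lamp.genA Lamp.genT) k

theorem primrecPred_genLit : PrimrecPred GenLit := by
  have hu : Primrec fun k : ℕ => (k / 2).unpair :=
    Primrec.unpair.comp (Primrec.nat_div.comp Primrec.id (Primrec.const 2))
  have h1 : PrimrecPred fun k : ℕ => NForm.IsOne (fun _ => 1) (NForm.mul
      (normalForm (k / 2).unpair.1) (NForm.inv (normalForm (k / 2).unpair.2))) :=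
    (NForm.primrecPred_isOne (α := Unit) (ω := fun _ _ => 1) (Primrec.const 1)).comp
      (Primrec.pair (Primrec.const ()) (NForm.primrec_mul.comp
        (primrec_normalForm.comp (Primrec.fst.comp hu))
        (NForm.primrec_inv.comp (primrec_normalForm.comp (Primrec.snd.comp hu)))))
  have h2 : PrimrecPred fun k : ℕ => k % 2 = 0 :=
    Primrec.eq.comp (Primrec.nat_mod.comp Primrec.id (Primrec.const 2)) (Primrec.const 0)
  refine PrimrecPred.of_eq ((h2.and h1).or (h2.not.and h1.not)) fun k => ?_
  have h3 : NForm.IsOne (fun _ => 1) (NForm.mul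
      (normalForm (k / 2).unpair.1) (NForm.inv (normalForm (k / 2).unpair.2))) ↔
      wordEval (pairVal Lamp.genA Lamp.genT) (k / 2).unpair.1 =
      wordEval (pairVal Lamp.genA Lamp.genT) (k / 2).unpair.2 := by
    rw [NForm.isOne_iff]
    simp only [Nat.cast_one]
    rw [NForm.val_mul, NForm.val_inv, val_normalForm, val_normalForm, mul_inv_eq_one]
  rw [h3, GenLit, litEval]
  tauto

/-- The words in the standard generators whose value is in the base group, but does not generate
it as a module. -/
def NonUnitWord (c : ℕ) : Prop :=
  (wordEval (pairVal Lamp.genA Lamp.genT) c).shift = 0 ∧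
    ¬ IsUnit (wordEval (pairVal Lamp.genA Lamp.genT) c).poly

theorem primrecPred_nonUnitWord : PrimrecPred NonUnitWord := by
  have h1 : PrimrecPred fun c => (normalForm c).2.1 = (normalForm c).2.2 :=
    Primrec.eq.comp (Primrec.fst.comp (Primrec.snd.comp primrec_normalForm))
      (Primrec.snd.comp (Primrec.snd.comp primrec_normalForm))
  have h2 : PrimrecPred fun c => NForm.IsUnitList (normalForm c).1 :=
    NForm.primrecPred_isUnitList.comp (Primrec.fst.comp primrec_normalForm)
  refine PrimrecPred.of_eq (h1.and h2.not) fun c => ?_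
  rw [NonUnitWord, ← val_normalForm, NForm.isUnitList_iff]
  simp only [NForm.val]
  refine and_congr ?_ Iff.rfl
  omega

/-- The code of `x₂ ^ m`. -/
def powCode (m : ℕ) : ℕ := m.rec 0 fun _ c => codeMul (codeVar 2) c

theorem primrec_powCode : Primrec powCode :=
  Primrec.nat_rec₁ _ (primrec_codeMul.comp (Primrec.const _) Primrec.snd)

theorem wordEval_powCode {G : Type*} [Group G] (v : ℕ → G) (m : ℕ) :
    wordEval v (powCode m) = v 2 ^ m := by
  induction m with
  | zero => simp [powCode]
  | succ m ih =>
    have : powCode (m + 1) = codeMul (codeVar 2) (powCode m) := rfl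
    rw [this, wordEval_mul, ih, wordEval_var, sMul_eq, pow_succ']

/-- The code of the equation `x_i x_j = x_j x_i`. -/
def commCode (i j : ℕ) : ℕ :=
  codeEq (codeMul (codeVar i) (codeVar j)) (codeMul (codeVar j) (codeVar i))

open Classical in
/-- The pairs of literals in `x₀, …, x₃` that exclude that `x₀` and `x₁` are like the standard
generators: a literal that fails for the standard generators; `x₀ = p(x₁) x₂` with `x₂` in the
base group and `p` not a unit; `x₁ = x₂ ^ m x₃` with `m ≠ 1` and `x₃` in the base group. -/
def badPair (n : ℕ) : ℕ × ℕ :=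
  if n % 3 = 0 then
    -- The literal with code 1 is 1 ≠ 1, which never holds, so the pair (1, 1) excludes nothing.
    if GenLit (n / 3) then (1, 1)
    else (litSubst (pairSubst 0 1) (n / 3), litSubst (pairSubst 0 1) (n / 3))
  else if n % 3 = 1 then
    if NonUnitWord (n / 3) then
      (commCode 2 0, codeEq (codeVar 0) (codeSubst (pairSubst 2 1) (n / 3)))
    else (1, 1)
  else
    if n / 3 = 1 then (1, 1)
    else (commCode 3 0, codeEq (codeVar 1) (codeMul (powCode (n / 3)) (codeVar 3)))

theorem primrec_pairSubst {α : Type*} [Primcodable α] (i j : ℕ) :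
    Primrec₂ fun _ : α => pairSubst i j :=
  Primrec.ite (Primrec.eq.comp (Primrec.nat_mod.comp Primrec.snd (Primrec.const 2))
    (Primrec.const 0)) (Primrec.const _) (Primrec.const _)

theorem primrec_badPair : Primrec badPair := by
  classical
  have hm : Primrec fun n : ℕ => n % 3 := Primrec.nat_mod.comp Primrec.id (Primrec.const 3)
  have hd : Primrec fun n : ℕ => n / 3 := Primrec.nat_div.comp Primrec.id (Primrec.const 3)
  have h0 : Primrec fun n : ℕ => litSubst (pairSubst 0 1) (n / 3) :=
    (primrec_litSubst (primrec_pairSubst (α := Unit) 0 1)).comp (Primrec.const ()) hd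
  have h1 : Primrec fun n : ℕ => codeSubst (pairSubst 2 1) (n / 3) :=
    (primrec_codeSubst (primrec_pairSubst (α := Unit) 2 1)).comp (Primrec.const ()) hd
  exact Primrec.ite (Primrec.eq.comp hm (Primrec.const 0))
    (Primrec.ite (primrecPred_genLit.comp hd) (Primrec.const _) (Primrec.pair h0 h0))
    (Primrec.ite (Primrec.eq.comp hm (Primrec.const 1))
      (Primrec.ite (primrecPred_nonUnitWord.comp hd)
        (Primrec.pair (Primrec.const _) (primrec_codeEq.comp (Primrec.const _) h1))
        (Primrec.const _))
      (Primrec.ite (Primrec.eq.comp hd (Primrec.const 1)) (Primrec.const _)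
        (Primrec.pair (Primrec.const _) (primrec_codeEq.comp (Primrec.const _)
          (primrec_codeMul.comp (primrec_powCode.comp hd) (Primrec.const _))))))

theorem comp_pairVal {M N : Type*} (e : M → N) (a t : M) :
    (fun i => e (pairVal a t i)) = pairVal (e a) (e t) := by
  funext i; simp only [pairVal]; split_ifs <;> rfl

theorem comp_quadVal {M N : Type*} (e : M → N) (a t y b : M) :
    (fun i => e (quadVal a t y b i)) = quadVal (e a) (e t) (e y) (e b) := by
  funext i; simp only [quadVal]; split_ifs <;> rfl

section Theta

variable {M : Type*} [groupLang.Structure M]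

/-- The pair `(a, t)` is like the standard pair of generators. -/
def Theta (a t : M) : Prop :=
  ∀ (y b : M) (n : ℕ),
    ¬ (litEval (quadVal a t y b) (badPair n).1 ∧ litEval (quadVal a t y b) (badPair n).2)

theorem not_litEval_one (v : ℕ → M) : ¬ litEval v 1 := by
  have : (1 : ℕ) = codeNe 0 0 := rfl
  rw [this, litEval_codeNe]
  simp

/-- The residues of n modulo 3 in `badPair` give the three demands; the trivial pairs drop out. -/
theorem theta_iff {a t : M} : Theta a t ↔
    (∀ k, ¬ GenLit k → ¬ litEval (pairVal a t) k) ∧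
    (∀ y c, NonUnitWord c → sMul y a = sMul a y → a ≠ wordEval (pairVal y t) c) ∧
    (∀ y b m, m ≠ 1 → sMul b a = sMul a b →
      t ≠ sMul (wordEval (quadVal a t y b) (powCode m)) b) := by
  have e0 : ∀ y b : M, (fun k => wordEval (quadVal a t y b) (pairSubst 0 1 k)) = pairVal a t :=
    fun y b => wordEval_pairSubst _ _ _
  have e1 : ∀ y b : M, (fun k => wordEval (quadVal a t y b) (pairSubst 2 1 k)) = pairVal y t :=
    fun y b => wordEval_pairSubst _ _ _
  have q0 : ∀ y b : M, quadVal a t y b 0 = a := fun _ _ => rfl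
  have q1 : ∀ y b : M, quadVal a t y b 1 = t := fun _ _ => rfl
  have q2 : ∀ y b : M, quadVal a t y b 2 = y := fun _ _ => rfl
  have q3 : ∀ y b : M, quadVal a t y b 3 = b := fun _ _ => rfl
  constructor
  · intro h
    refine ⟨fun k hk hl => ?_, fun y c hc hy he => ?_, fun y b m hm hb he => ?_⟩
    · have e : badPair (3 * k) = (litSubst (pairSubst 0 1) k, litSubst (pairSubst 0 1) k) := by
        simp [badPair, hk]
      -- The variables x₂ and x₃ do not occur in this pair of literals, so any values serve.
      have h' := h a a (3 * k)
      rw [e] at h'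
      simp only [litEval_subst, e0, and_self] at h'
      exact h' hl
    · have d1 : (3 * c + 1) % 3 = 1 := by omega
      have d2 : (3 * c + 1) / 3 = c := by omega
      have e : badPair (3 * c + 1) =
          (commCode 2 0, codeEq (codeVar 0) (codeSubst (pairSubst 2 1) c)) := by
        simp [badPair, hc, d1, d2]
      have h' := h y y (3 * c + 1)
      rw [e] at h'
      simp only [commCode, litEval_codeEq, wordEval_mul, wordEval_var, wordEval_subst, e1, q0,
        q2] at h'
      exact h' ⟨hy, he⟩
    · have d1 : (3 * m + 2) % 3 = 2 := by omega
      have d2 : (3 * m + 2) / 3 = m := by omega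
      have e : badPair (3 * m + 2) =
          (commCode 3 0, codeEq (codeVar 1) (codeMul (powCode m) (codeVar 3))) := by
        simp [badPair, hm, d1, d2]
      have h' := h y b (3 * m + 2)
      rw [e] at h'
      simp only [commCode, litEval_codeEq, wordEval_mul, wordEval_var, q0, q1, q3] at h'
      exact h' ⟨hb, he⟩
  · rintro ⟨h0, h1, h2⟩ y b n ⟨hn, hn'⟩
    unfold badPair at hn hn'
    split_ifs at hn hn' with c1 c2 c3 c4 c5
    · exact not_litEval_one _ hn
    · rw [litEval_subst, e0] at hn
      exact h0 _ c2 hn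
    · simp only [commCode, litEval_codeEq, wordEval_mul, wordEval_var, wordEval_subst, e1, q0,
        q2] at hn hn'
      exact h1 _ _ c4 hn hn'
    · exact not_litEval_one _ hn
    · exact not_litEval_one _ hn
    · simp only [commCode, litEval_codeEq, wordEval_mul, wordEval_var, q0, q1, q3] at hn hn'
      exact h2 _ _ _ c5 hn hn'

theorem equiv_theta {N : Type*} [groupLang.Structure N] (e : groupLang.Equiv M N) (a t : M) :
    Theta (e a) (e t) ↔ Theta a t := by
  have key : ∀ y b k, litEval (quadVal (e a) (e t) (e y) (e b)) k ↔ litEval (quadVal a t y b) k :=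
    fun y b k => by rw [← comp_quadVal e, equiv_litEval]
  constructor
  · intro h y b n
    have := h (e y) (e b) n
    rwa [key, key] at this
  · intro h y b n
    obtain ⟨y, rfl⟩ := e.surjective y
    obtain ⟨b, rfl⟩ := e.surjective b
    rw [key, key]
    exact h y b n

/-- Literals include inequations: an equation false for the standard pair is excluded directly, and
a true one holds because its negation is an excluded literal. -/
theorem wordEval_eq_iff_of_theta {a t : M} (h : Theta a t) (c d : ℕ) :
    wordEval (pairVal a t) c = wordEval (pairVal a t) d ↔
      wordEval (pairVal Lamp.genA Lamp.genT) c = wordEval (pairVal Lamp.genA Lamp.genT) d := by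
  have h0 := (theta_iff.1 h).1
  constructor
  · intro h1
    by_contra h2
    refine h0 (codeEq c d) ?_ ((litEval_codeEq _ _ _).2 h1)
    rwa [GenLit, litEval_codeEq]
  · intro h1
    by_contra h2
    refine h0 (codeNe c d) ?_ ((litEval_codeNe _ _ _).2 h2)
    rw [GenLit, litEval_codeNe]
    exact fun h => h h1

end Theta

theorem range_pairVal {M : Type*} (a t : M) : Set.range (pairVal a t) = {a, t} := by
  ext x
  constructor
  · rintro ⟨i, rfl⟩
    simp only [pairVal]
    split_ifs <;> simp
  · rintro (rfl | rfl)
    · exact ⟨0, rfl⟩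
    · exact ⟨1, rfl⟩

theorem surjective_wordEval_pairVal {G : Type*} [Group G] {a t : G} :
    Function.Surjective (wordEval (pairVal a t)) ↔ Subgroup.closure {a, t} = ⊤ := by
  rw [← range_pairVal a t, Subgroup.eq_top_iff']
  simp only [← mem_range_wordEval]
  rfl

-- An element y commuting with the polynomial 1 lies in the base, and a word of value p turns into p
-- y when y replaces 1; from 1 = p y it follows that p is a unit. If t = y^m b with b in the base,
-- comparing shifts shows that m divides 1.
open Lamp in
theorem theta_gen : Theta genA genT := by
  have hs : ∀ x : Lamp ℤ, sMul x genA = sMul genA x → x.shift = 0 := fun x hx =>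
    (commute_base_iff one_ne_zero x).1 hx
  refine theta_iff.2 ⟨fun k hk => hk, fun y c hc hy he => ?_, fun y b m hm hb he => ?_⟩
  · have hy0 := eq_base_of_shift (hs y hy)
    have e1 : wordEval (pairVal y genT) c = endo y.poly genT (wordEval (pairVal genA genT) c) := by
      rw [map_wordEval, comp_pairVal, endo_genA, endo_genT, ← hy0]
    rw [e1, eq_base_of_shift hc.1, endo_base] at he
    have h2 : (1 : ℤ[T;T⁻¹]) = _ * _ := congrArg poly he
    rw [show genT.shift = 1 from rfl, substT_one] at h2
    exact hc.2 (IsUnit.of_mul_eq_one _ h2.symm)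
  · have h1 := congrArg shift he
    rw [wordEval_powCode, sMul_eq, mul_shift, pow_shift, hs b hb, add_zero] at h1
    have h2 : (m : ℤ) ∣ 1 := Dvd.intro _ h1.symm
    have h3 := Int.eq_one_of_dvd_one (by positivity) h2
    exact hm (by exact_mod_cast h3)

-- Equations alone do not suffice: (a², t) and (a, t²) satisfy the same ones as (a, t). The second
-- and third demands exclude just such defects, which the standard generators themselves witness
-- once the equations have forced a into the base.
open Lamp in
theorem surjective_of_theta {a t : Lamp ℤ} (h : Theta a t) :
    Function.Surjective (wordEval (pairVal a t)) := by
  obtain ⟨-, h1, h2⟩ := theta_iff.1 h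
  have heq : ∀ c d, wordEval (pairVal a t) c = wordEval (pairVal a t) d ↔ _ :=
    wordEval_eq_iff_of_theta h
  -- the conjugate of `a` by `t` differs from `a` and commutes with it
  have v0 : ∀ x y : Lamp ℤ, wordEval (pairVal x y) (codeVar 0) = x := fun _ _ => wordEval_var _ _
  have v1 : ∀ x y : Lamp ℤ, wordEval (pairVal x y) (codeVar 1) = y := fun _ _ => wordEval_var _ _
  let conj : ℕ := codeMul (codeMul (codeVar 1) (codeVar 0)) (codeInv (codeVar 1))
  have hconj : ∀ x y : Lamp ℤ, wordEval (pairVal x y) conj = y * x * y⁻¹ := fun x y => by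
    simp only [conj, wordEval_mul, wordEval_inv, v0, v1, sMul_eq, sInv_eq]
  have hne : t * a * t⁻¹ ≠ a := by
    have := (heq conj (codeVar 0)).not
    rw [hconj, hconj, v0, v0] at this
    refine this.2 fun h => ?_
    have h' := mul_inv_eq_iff_eq_mul.1 h
    exact absurd ((commute_base_iff one_ne_zero genT).1 h') one_ne_zero
  have hcomm : a * (t * a * t⁻¹) = t * a * t⁻¹ * a := by
    have := heq (codeMul (codeVar 0) conj) (codeMul conj (codeVar 0))
    simp only [wordEval_mul, hconj, v0, sMul_eq] at this
    refine this.2 ?_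
    rw [genA, conj_base, ← base_add, ← base_add, add_comm]
  have ha : a = base a.poly := eq_base_of_shift (shift_eq_zero_of_commute hcomm hne)
  have hap : a.poly ≠ 0 := by
    intro h0
    rw [ha, h0, base_zero] at hne
    simp at hne
  -- the element `t` acts as `T` or as `T⁻¹`
  have hpow : ∀ (y : Lamp ℤ) (m : ℕ), m ≠ 1 → t.shift ≠ m * y.shift := by
    intro y m hm hs
    have hb : ((y ^ m)⁻¹ * t).shift = 0 := by
      rw [mul_shift, inv_shift, pow_shift, hs, neg_add_cancel]
    refine h2 y ((y ^ m)⁻¹ * t) m hm ?_ ?_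
    · rw [ha]; exact (commute_base_iff hap _).2 hb
    · rw [wordEval_powCode]
      exact (mul_inv_cancel_left _ _).symm
  have ht : t.shift * t.shift = 1 := by
    -- Here y is `genT` or its inverse and m is the absolute value of the shift; m = 0, where t
    -- would be in the base, is covered too.
    have hm : t.shift.natAbs = 1 := by
      by_contra hm
      rcases Int.natAbs_eq t.shift with hk | hk
      · exact hpow genT _ hm (by rw [show genT.shift = 1 from rfl]; omega)
      · exact hpow genT⁻¹ _ hm (by rw [inv_shift, show genT.shift = 1 from rfl]; omega)
    rcases Int.natAbs_eq t.shift with hk | hk <;> rw [hk, hm] <;> rfl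
  -- the polynomial of `a` is a unit
  have hu : IsUnit a.poly := by
    -- With p the polynomial of a and s = ±1 the shift of t, the word is chosen with value p(T^s);
    -- when t replaces `genT`, T becomes T^s and the value becomes p, that is, a.
    obtain ⟨c, hc⟩ := surjective_wordEval_pairVal.2 closure_gen (base (substT t.shift a.poly))
    by_contra hu
    have hnu : NonUnitWord c := by
      refine ⟨by rw [hc]; rfl, ?_⟩
      rw [hc]
      intro hu'
      apply hu
      have := hu'.map (substT t.shift)
      rwa [base_poly, substT_substT, ht, substT_one] at this
    refine h1 genA c hnu ?_ ?_
    · exact (((commute_base_iff one_ne_zero a).2 (by rw [ha]; rfl))).symm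
    · have e1 : wordEval (pairVal genA t) c = endo 1 t (wordEval (pairVal genA genT) c) := by
        rw [map_wordEval, comp_pairVal, endo_genA, endo_genT]; rfl
      rw [e1, hc, endo_base, substT_substT, ht, substT_one, mul_one]
      exact ha
  rw [surjective_wordEval_pairVal, ha]
  exact closure_eq_top hu ht

/-- The characterization of the isomorphic copies of the group. -/
theorem nonempty_equiv_lamp_iff {M : Type*} [groupLang.Structure M] :
    Nonempty (groupLang.Equiv M (Lamp ℤ)) ↔
      (∃ a t : M, Theta a t) ∧
        ∀ a t : M, Theta a t → ∀ x, ∃ c, wordEval (pairVal a t) c = x := by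
  constructor
  · rintro ⟨e⟩
    refine ⟨?_, fun a t h x => ?_⟩
    · obtain ⟨a, ha⟩ := e.surjective Lamp.genA
      obtain ⟨t, ht⟩ := e.surjective Lamp.genT
      exact ⟨a, t, by rw [← equiv_theta e, ha, ht]; exact theta_gen⟩
    · obtain ⟨c, hc⟩ := surjective_of_theta ((equiv_theta e a t).2 h) (e x)
      refine ⟨c, e.injective ?_⟩
      rw [equiv_wordEval, comp_pairVal]
      exact hc
  · rintro ⟨⟨a, t, h⟩, hs⟩
    -- M is not assumed to be a group; the group laws come with the equations between words, as
    -- every element is the value of a word.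
    exact nonempty_equiv_of_words (hs a t h) (surjective_wordEval_pairVal.2 Lamp.closure_gen)
      (wordEval_eq_iff_of_theta h)

theorem nonempty_equiv_zwrZ_iff {M : Type*} [groupLang.Structure M] :
    Nonempty (groupLang.Equiv M ZwrZ) ↔ Nonempty (groupLang.Equiv M (Lamp ℤ)) := by
  obtain ⟨e⟩ := nonempty_equiv_iff_mulEquiv.2 ⟨Lamp.equivZwrZ⟩
  exact ⟨fun ⟨f⟩ => ⟨e.symm.comp f⟩, fun ⟨f⟩ => ⟨e.comp f⟩⟩

end

end GroupScott
-- The computable d-Σ₂ Scott sentence.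
namespace GroupScott
open FirstOrder

noncomputable section

/-! ### Isomorphism invariance of satisfaction -/

/-! ### Codes of formulas -/

/-- Membership is semi-decided by an unbounded search for a preimage. -/
theorem exists_W_eq_range {f : ℕ → ℕ} (hf : Primrec f) : ∃ e, W e = Set.range f := by
  have h : Partrec fun k : ℕ => Nat.rfind fun n => Part.some (decide (f n = k)) := by
    refine Partrec.rfind ?_
    exact (Primrec.eq.decide.comp (hf.comp Primrec.snd) Primrec.fst).to_comp.partrec
  obtain ⟨c, hc⟩ := Nat.Partrec.Code.exists_code.1 (Partrec.nat_iff.1 h)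
  refine ⟨Encodable.encode c, ?_⟩
  ext k
  simp only [W, phi, Denumerable.ofNat_encode, hc, Set.mem_ofPred_eq, Set.mem_range]
  constructor
  · intro hd
    have := Nat.rfind_spec (Part.get_mem hd)
    exact ⟨_, of_decide_eq_true (Part.mem_some_iff.1 this).symm⟩
  · rintro ⟨n, rfl⟩
    exact Nat.rfind_dom.2 ⟨n, by simp, fun _ => trivial⟩

def qfImp (a b : ℕ) : ℕ := 2 * Nat.pair a b + 2

def qfEq (a b : ℕ) : ℕ := 2 * Nat.pair a b + 1

theorem qfOfNat_zero : qfOfNat 0 = ⊥ := by rw [qfOfNat]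

theorem qfOfNat_qfEq (a b : ℕ) : qfOfNat (qfEq a b) = (termOfNat a).equal (termOfNat b) := by
  have e1 : (2 * Nat.pair a b) % 2 = 0 := by omega
  have e2 : (2 * Nat.pair a b) / 2 = Nat.pair a b := by omega
  rw [qfEq, qfOfNat]
  simp only [e1, e2, Nat.unpair_pair]

theorem qfOfNat_qfImp (a b : ℕ) : qfOfNat (qfImp a b) = (qfOfNat a).imp (qfOfNat b) := by
  have e1 : (2 * Nat.pair a b + 1) % 2 = 1 := by omega
  have e2 : (2 * Nat.pair a b + 1) / 2 = Nat.pair a b := by omega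
  rw [qfImp, qfOfNat]
  simp only [e1, e2, Nat.unpair_pair]

theorem primrec_qfImp : Primrec₂ qfImp :=
  Primrec.succ.comp (Primrec.succ.comp primrec_codeEq)

theorem primrec_qfEq : Primrec₂ qfEq := Primrec.succ.comp primrec_codeEq

/-- The code of the literal `k` as a quantifier-free formula. -/
def litFormula (k : ℕ) : ℕ :=
  if k % 2 = 0 then qfEq (k / 2).unpair.1 (k / 2).unpair.2
  else qfImp (qfEq (k / 2).unpair.1 (k / 2).unpair.2) 0

theorem primrec_litFormula : Primrec litFormula := by
  have hu : Primrec fun k : ℕ => (k / 2).unpair :=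
    Primrec.unpair.comp (Primrec.nat_div.comp Primrec.id (Primrec.const 2))
  have he := primrec_qfEq.comp (Primrec.fst.comp hu) (Primrec.snd.comp hu)
  exact Primrec.ite (Primrec.eq.comp (Primrec.nat_mod.comp Primrec.id (Primrec.const 2))
    (Primrec.const 0)) he (primrec_qfImp.comp he (Primrec.const 0))

section Realize

variable {M : Type*} [groupLang.Structure M] (v : ℕ → M)

theorem realize_qfZero : ¬ (qfOfNat 0).Realize v := by
  rw [qfOfNat_zero]; exact id

theorem realize_qfEq (a b : ℕ) : (qfOfNat (qfEq a b)).Realize v ↔ wordEval v a = wordEval v b := by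
  rw [qfOfNat_qfEq, Language.Formula.realize_equal]; rfl

theorem realize_qfImp (a b : ℕ) :
    (qfOfNat (qfImp a b)).Realize v ↔ ((qfOfNat a).Realize v → (qfOfNat b).Realize v) := by
  rw [qfOfNat_qfImp]; exact Language.Formula.realize_imp

theorem realize_litFormula (k : ℕ) : (qfOfNat (litFormula k)).Realize v ↔ litEval v k := by
  unfold litFormula litEval
  split_ifs with h
  · simp [realize_qfEq, h]
  · simp [realize_qfImp, realize_qfEq, realize_qfZero, h]

end Realize

/-- The code of the negated conjunction of two literals. -/
def litNand (p : ℕ × ℕ) : ℕ := qfImp (litFormula p.1) (qfImp (litFormula p.2) 0)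

theorem realize_litNand {M : Type*} [groupLang.Structure M] (v : ℕ → M) (p : ℕ × ℕ) :
    (qfOfNat (litNand p)).Realize v ↔ ¬ (litEval v p.1 ∧ litEval v p.2) := by
  simp only [litNand, realize_qfImp, realize_litFormula, realize_qfZero, not_and]

theorem primrec_litNand : Primrec litNand :=
  primrec_qfImp.comp (primrec_litFormula.comp Primrec.fst)
    (primrec_qfImp.comp (primrec_litFormula.comp Primrec.snd) (Primrec.const 0))

/-! ### Variables -/

/-- The variables of the term with code `c` are among `x₀, …, x_{m-1}`. -/
def VarsBelow (m c : ℕ) : Prop := codeRec True (· < m) id And c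

theorem varsBelow_subst {m : ℕ} {ρ : ℕ → ℕ} (h : ∀ i, VarsBelow m (ρ i)) (c : ℕ) :
    VarsBelow m (codeSubst ρ c) := by
  unfold VarsBelow codeSubst at *
  induction c using code_induction <;> simp_all

theorem wordEval_congr {M : Type*} [groupLang.Structure M] {m c : ℕ} (h : VarsBelow m c)
    {v w : ℕ → M} (hvw : ∀ i < m, v i = w i) : wordEval v c = wordEval w c := by
  unfold VarsBelow at h
  induction c using code_induction <;> simp_all

theorem mem_of_varsBelow {m c : ℕ} (h : VarsBelow m c) :
    ∀ i ∈ ((termOfNat c).relabel (Sum.inl : ℕ → ℕ ⊕ Fin 0)).varFinsetLeft, i < m := by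
  unfold VarsBelow at h
  induction c using code_induction with
  | one => simp [termOfNat_zero, tOne, Language.Term.relabel, Language.Term.varFinsetLeft]
  | var i =>
    simpa [termOfNat_var, Language.Term.relabel, Language.Term.varFinsetLeft] using h
  | inv a ha =>
    simp only [codeRec_inv, id] at h
    have := ha h
    simpa [termOfNat_inv, tInv, Language.Term.relabel, Language.Term.varFinsetLeft] using this
  | mul a b ha hb =>
    simp only [codeRec_mul] at h
    have h1 := ha h.1
    have h2 := hb h.2
    intro i
    simp only [termOfNat_mul, tMul, Language.Term.relabel, Language.Term.varFinsetLeft,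
      Finset.mem_biUnion, Finset.mem_univ, true_and]
    rintro ⟨j, hj⟩
    revert hj
    refine Fin.cases (fun hj => h1 i hj) (fun j => ?_) j
    refine Fin.cases (fun hj => h2 i hj) (fun j => j.elim0) j

/-- The variables of the literal `k` are among `x₀, …, x_{m-1}`. -/
def LitVarsBelow (m k : ℕ) : Prop := VarsBelow m (k / 2).unpair.1 ∧ VarsBelow m (k / 2).unpair.2

theorem litEval_congr {M : Type*} [groupLang.Structure M] {m k : ℕ} (h : LitVarsBelow m k)
    {v w : ℕ → M} (hvw : ∀ i < m, v i = w i) : litEval v k ↔ litEval w k := by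
  rw [litEval, litEval, wordEval_congr h.1 hvw, wordEval_congr h.2 hvw]

theorem mem_freeVars_qfEq {m a b : ℕ} (ha : VarsBelow m a) (hb : VarsBelow m b) :
    ∀ i ∈ (qfOfNat (qfEq a b)).freeVarFinset, i < m := by
  intro i hi
  rw [qfOfNat_qfEq] at hi
  rcases Finset.mem_union.1 hi with h | h
  · exact mem_of_varsBelow ha i h
  · exact mem_of_varsBelow hb i h

theorem mem_freeVars_qfImp {m a b : ℕ} (ha : ∀ i ∈ (qfOfNat a).freeVarFinset, i < m)
    (hb : ∀ i ∈ (qfOfNat b).freeVarFinset, i < m) :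
    ∀ i ∈ (qfOfNat (qfImp a b)).freeVarFinset, i < m := by
  intro i hi
  rw [qfOfNat_qfImp] at hi
  rcases Finset.mem_union.1 hi with h | h
  · exact ha i h
  · exact hb i h

theorem mem_freeVars_qfZero {m : ℕ} : ∀ i ∈ (qfOfNat 0).freeVarFinset, i < m := by
  intro i hi
  rw [qfOfNat_zero] at hi
  exact absurd hi (Finset.notMem_empty i)

theorem mem_freeVars_litFormula {m k : ℕ} (h : LitVarsBelow m k) :
    ∀ i ∈ (qfOfNat (litFormula k)).freeVarFinset, i < m := by
  unfold litFormula
  split_ifs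
  · exact mem_freeVars_qfEq h.1 h.2
  · exact mem_freeVars_qfImp (mem_freeVars_qfEq h.1 h.2) mem_freeVars_qfZero

theorem mem_freeVars_litNand {m : ℕ} {p : ℕ × ℕ} (h1 : LitVarsBelow m p.1)
    (h2 : LitVarsBelow m p.2) : ∀ i ∈ (qfOfNat (litNand p)).freeVarFinset, i < m :=
  mem_freeVars_qfImp (mem_freeVars_litFormula h1)
    (mem_freeVars_qfImp (mem_freeVars_litFormula h2) mem_freeVars_qfZero)

theorem varsBelow_pairSubst {m i j : ℕ} (hi : i < m) (hj : j < m) (k : ℕ) :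
    VarsBelow m (pairSubst i j k) := by
  unfold pairSubst VarsBelow
  split_ifs <;> simpa

theorem varsBelow_powCode {m : ℕ} (hm : 2 < m) (n : ℕ) : VarsBelow m (powCode n) := by
  induction n with
  | zero => simp [powCode, VarsBelow]
  | succ n ih =>
    have : powCode (n + 1) = codeMul (codeVar 2) (powCode n) := rfl
    unfold VarsBelow at *
    rw [this, codeRec_mul, codeRec_var]
    exact ⟨hm, ih⟩

theorem litVarsBelow_codeEq {m a b : ℕ} :
    LitVarsBelow m (codeEq a b) ↔ VarsBelow m a ∧ VarsBelow m b := by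
  simp [LitVarsBelow, codeEq]

theorem litVarsBelow_litSubst {m : ℕ} {ρ : ℕ → ℕ} (h : ∀ i, VarsBelow m (ρ i)) (k : ℕ) :
    LitVarsBelow m (litSubst ρ k) := by
  have h1 : ∀ n, (2 * n + k % 2) / 2 = n := by omega
  simp only [LitVarsBelow, litSubst, h1, Nat.unpair_pair]
  exact ⟨varsBelow_subst h _, varsBelow_subst h _⟩

theorem litVarsBelow_badPair (n : ℕ) :
    LitVarsBelow 4 (badPair n).1 ∧ LitVarsBelow 4 (badPair n).2 := by
  have h1 : LitVarsBelow 4 1 := by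
    simp [LitVarsBelow, VarsBelow]
  have hv : ∀ i < 4, VarsBelow 4 (codeVar i) := fun i hi => by simpa [VarsBelow] using hi
  have hmul : ∀ a b, VarsBelow 4 a → VarsBelow 4 b → VarsBelow 4 (codeMul a b) := fun a b ha hb => by
    unfold VarsBelow at *; rw [codeRec_mul]; exact ⟨ha, hb⟩
  have hc : ∀ i j, i < 4 → j < 4 → LitVarsBelow 4 (commCode i j) := fun i j hi hj =>
    litVarsBelow_codeEq.2 ⟨hmul _ _ (hv i hi) (hv j hj), hmul _ _ (hv j hj) (hv i hi)⟩
  unfold badPair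
  split_ifs
  · exact ⟨h1, h1⟩
  · have := litVarsBelow_litSubst (m := 4) (varsBelow_pairSubst (i := 0) (j := 1) (by omega)
      (by omega)) (n / 3)
    exact ⟨this, this⟩
  · exact ⟨hc _ _ (by omega) (by omega), litVarsBelow_codeEq.2 ⟨hv 0 (by omega),
      varsBelow_subst (varsBelow_pairSubst (by omega) (by omega)) _⟩⟩
  · exact ⟨h1, h1⟩
  · exact ⟨h1, h1⟩
  · exact ⟨hc _ _ (by omega) (by omega), litVarsBelow_codeEq.2 ⟨hv 1 (by omega),
      hmul _ _ (varsBelow_powCode (by omega) _) (hv 3 (by omega))⟩⟩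

/-! ### The Scott sentence -/

theorem exists_sigmaFormula (N : ℕ) {f : ℕ → List ℕ × ℕ × ℕ} (hf : Primrec f) :
    ∃ e, sigmaFormula (N + 1) e = InfFormula.bigOr (Set.range fun n => Encodable.encode (f n))
      fun k => InfFormula.ex (triple k).1 (piFormula (min (triple k).2.1 N) (triple k).2.2) := by
  obtain ⟨e, he⟩ := exists_W_eq_range (Primrec.encode.comp hf)
  exact ⟨e, by rw [sigmaFormula, he]⟩

theorem exists_piFormula (N : ℕ) {f : ℕ → List ℕ × ℕ × ℕ} (hf : Primrec f) :
    ∃ e, piFormula (N + 1) e = InfFormula.bigAnd (Set.range fun n => Encodable.encode (f n))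
      fun k => InfFormula.all (triple k).1 (sigmaFormula (min (triple k).2.1 N) (triple k).2.2) := by
  obtain ⟨e, he⟩ := exists_W_eq_range (Primrec.encode.comp hf)
  exact ⟨e, by rw [piFormula, he]⟩

theorem triple_encode (x : List ℕ × ℕ × ℕ) : triple (Encodable.encode x) = x :=
  Denumerable.ofNat_encode x

/-- The `Π₁` formula that expresses `Theta` for `x₀` and `x₁`. -/
theorem exists_thetaFormula : ∃ e,
    (∀ (M : Type) [groupLang.Structure M] (v : ℕ → M),
      (piFormula 1 e).Realize v ↔ Theta (v 0) (v 1)) ∧ ∀ i ∈ (piFormula 1 e).freeVars, i < 2 := by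
  obtain ⟨e, he⟩ := exists_piFormula 0 (f := fun n => ([2, 3], 0, litNand (badPair n)))
    (Primrec.pair (Primrec.const _) (Primrec.pair (Primrec.const _)
      (primrec_litNand.comp primrec_badPair)))
  refine ⟨e, fun M _ v => ?_, fun i hi => ?_⟩
  · rw [he]
    simp only [InfFormula.Realize, Set.forall_mem_range, triple_encode, Nat.zero_min,
      sigmaFormula, realize_litNand]
    have key : ∀ (w u : ℕ → M) n, (∀ i < 4, w i = u i) →
        (litEval w (badPair n).1 ∧ litEval w (badPair n).2 ↔
          litEval u (badPair n).1 ∧ litEval u (badPair n).2) := fun w u n h => by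
      rw [litEval_congr (litVarsBelow_badPair n).1 h, litEval_congr (litVarsBelow_badPair n).2 h]
    constructor
    · intro h y b n
      let w : ℕ → M := fun i => if i = 2 then y else if i = 3 then b else v i
      have h1 := h n w fun i hi => by
        simp only [List.mem_cons, List.not_mem_nil, or_false, not_or] at hi
        simp [w, hi.1, hi.2]
      rwa [key w (quadVal (v 0) (v 1) y b)] at h1
      intro i hi
      interval_cases i <;> rfl
    · intro h n w hw
      rw [key w (quadVal (v 0) (v 1) (w 2) (w 3))]
      · exact h _ _ _
      · intro i hi
        interval_cases i
        · exact hw 0 (by simp)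
        · exact hw 1 (by simp)
        · rfl
        · rfl
  · rw [he] at hi
    obtain ⟨_, ⟨n, rfl⟩, hi⟩ := hi
    simp only [InfFormula.freeVars, triple_encode, Nat.zero_min, sigmaFormula,
      Set.mem_ofPred_eq, List.mem_cons, List.not_mem_nil, or_false, not_or] at hi
    have := mem_freeVars_litNand (litVarsBelow_badPair n).1 (litVarsBelow_badPair n).2 i hi.1
    omega

/-- The `Σ₁` formula expressing that `x₄` is a word in `x₀` and `x₁` if these satisfy `Theta`. -/
theorem exists_generatedFormula : ∃ e,
    (∀ (M : Type) [groupLang.Structure M] (v : ℕ → M),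
      (sigmaFormula 1 e).Realize v ↔
        (Theta (v 0) (v 1) → ∃ c, wordEval (pairVal (v 0) (v 1)) c = v 4)) ∧
      ∀ i ∈ (sigmaFormula 1 e).freeVars, i = 0 ∨ i = 1 ∨ i = 4 := by
  -- The implication is a disjunction of two existential statements: a counterexample to `Theta`
  -- (even n) or a word for x₄ (odd n).
  let f : ℕ → List ℕ × ℕ × ℕ := fun n =>
    if n % 2 = 0 then ([2, 3], 0, qfImp (litNand (badPair (n / 2))) 0)
    else ([], 0, qfEq (codeSubst (pairSubst 0 1) (n / 2)) (codeVar 4))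
  have hf : Primrec f := by
    have hd : Primrec fun n : ℕ => n / 2 := Primrec.nat_div.comp Primrec.id (Primrec.const 2)
    refine Primrec.ite (Primrec.eq.comp (Primrec.nat_mod.comp Primrec.id (Primrec.const 2))
      (Primrec.const 0))
      (Primrec.pair (Primrec.const _) (Primrec.pair (Primrec.const _)
        (primrec_qfImp.comp (primrec_litNand.comp (primrec_badPair.comp hd)) (Primrec.const _))))
      (Primrec.pair (Primrec.const _) (Primrec.pair (Primrec.const _)
        (primrec_qfEq.comp ?_ (Primrec.const _))))
    exact (primrec_codeSubst (primrec_pairSubst (α := Unit) 0 1)).comp (Primrec.const ()) hd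
  have f0 : ∀ n, f (2 * n) = ([2, 3], 0, qfImp (litNand (badPair n)) 0) := fun n => by simp [f]
  have f1 : ∀ n, f (2 * n + 1) = ([], 0, qfEq (codeSubst (pairSubst 0 1) n) (codeVar 4)) :=
    fun n => by
      have d1 : (2 * n + 1) % 2 = 1 := by omega
      have d2 : (2 * n + 1) / 2 = n := by omega
      simp [f, d1, d2]
  obtain ⟨e, he⟩ := exists_sigmaFormula 0 hf
  refine ⟨e, fun M _ v => ?_, fun i hi => ?_⟩
  · rw [he]
    simp only [InfFormula.Realize, Set.exists_range_iff, triple_encode]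
    have key : ∀ (w u : ℕ → M) n, (∀ i < 4, w i = u i) →
        (litEval w (badPair n).1 ∧ litEval w (badPair n).2 ↔
          litEval u (badPair n).1 ∧ litEval u (badPair n).2) := fun w u n h => by
      rw [litEval_congr (litVarsBelow_badPair n).1 h, litEval_congr (litVarsBelow_badPair n).2 h]
    constructor
    · rintro ⟨n, w, hw, h⟩ hθ
      obtain ⟨m, rfl | rfl⟩ : ∃ m, n = 2 * m ∨ n = 2 * m + 1 := ⟨n / 2, by omega⟩
      · rw [f0] at hw h
        simp only [Nat.zero_min, piFormula, InfFormula.Realize, realize_qfImp, realize_litNand,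
          realize_qfZero, imp_false, not_not] at h
        rw [key w (quadVal (v 0) (v 1) (w 2) (w 3))] at h
        · exact absurd h (hθ _ _ _)
        · intro i hi
          interval_cases i
          · exact hw 0 (by simp)
          · exact hw 1 (by simp)
          · rfl
          · rfl
      · rw [f1] at hw h
        simp only [Nat.zero_min, piFormula, InfFormula.Realize, realize_qfEq, wordEval_subst,
          wordEval_pairSubst, wordEval_var] at h
        have hw' : w = v := funext fun i => hw i (by simp)
        exact ⟨m, hw' ▸ h⟩
    · intro h
      by_cases hθ : Theta (v 0) (v 1)
      · obtain ⟨c, hc⟩ := h hθ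
        refine ⟨2 * c + 1, v, fun _ _ => rfl, ?_⟩
        rw [f1]
        simp only [Nat.zero_min, piFormula, InfFormula.Realize, realize_qfEq, wordEval_subst,
          wordEval_pairSubst, wordEval_var]
        exact hc
      · simp only [Theta, not_forall, not_not] at hθ
        obtain ⟨y, b, n, hn⟩ := hθ
        let w : ℕ → M := fun i => if i = 2 then y else if i = 3 then b else v i
        refine ⟨2 * n, w, fun i hi => ?_, ?_⟩
        · rw [f0] at hi
          simp only [List.mem_cons, List.not_mem_nil, or_false, not_or] at hi
          simp [w, hi.1, hi.2]
        · rw [f0]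
          simp only [Nat.zero_min, piFormula, InfFormula.Realize, realize_qfImp, realize_litNand,
            realize_qfZero, imp_false, not_not]
          rwa [key w (quadVal (v 0) (v 1) y b)]
          intro i hi
          interval_cases i <;> rfl
  · rw [he] at hi
    obtain ⟨_, ⟨n, rfl⟩, hi⟩ := hi
    simp only [InfFormula.freeVars, triple_encode] at hi
    obtain ⟨m, rfl | rfl⟩ : ∃ m, n = 2 * m ∨ n = 2 * m + 1 := ⟨n / 2, by omega⟩
    · simp only [f0, Nat.zero_min, piFormula, InfFormula.freeVars,
        Set.mem_ofPred_eq, List.mem_cons, List.not_mem_nil, or_false, not_or] at hi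
      have := mem_freeVars_qfImp (mem_freeVars_litNand (litVarsBelow_badPair m).1
        (litVarsBelow_badPair m).2) mem_freeVars_qfZero i hi.1
      omega
    · simp only [f1, Nat.zero_min, piFormula, InfFormula.freeVars, qfOfNat_qfEq,
        Set.mem_ofPred_eq, List.not_mem_nil, not_false_eq_true, and_true] at hi
      rcases Finset.mem_union.1 hi with h | h
      · have := mem_of_varsBelow (m := 2) (varsBelow_subst
          (varsBelow_pairSubst (by omega) (by omega)) _) i h
        omega
      · rw [termOfNat_var] at h
        simp only [Language.Term.relabel, Language.Term.varFinsetLeft, Finset.mem_singleton] at h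
        omega

instance : Countable (Lamp ℤ) := by
  have hs := surjective_wordEval_pairVal.2 Lamp.closure_gen
  exact hs.countable

/-- The group `ℤ ≀ ℤ` has a computable d-`Σ₂` Scott sentence. -/
theorem exists_scottSentence :
    ∃ φ : InfFormula, IsComputableDSigmaSentence 2 φ ∧ IsScottSentence ZwrZ φ := by
  obtain ⟨e1, hr1, hf1⟩ := exists_thetaFormula
  obtain ⟨e2, hr2, hf2⟩ := exists_generatedFormula
  -- Both outer formulas have a single disjunct or conjunct, enumerated by a constant function.
  obtain ⟨i, hi⟩ := exists_sigmaFormula 1 (f := fun _ => ([0, 1], 1, e1)) (Primrec.const _)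
  obtain ⟨j, hj⟩ := exists_piFormula 1 (f := fun _ => ([0, 1, 4], 1, e2)) (Primrec.const _)
  have hsent : ((sigmaFormula 2 i).and (piFormula 2 j)).IsSentence := by
    refine Set.eq_empty_of_forall_notMem fun x hx => ?_
    simp only [hi, hj, InfFormula.freeVars, Set.range_const, Set.mem_singleton_iff,
      exists_eq_left, triple_encode, min_self, Set.mem_union, Set.mem_ofPred_eq, List.mem_cons,
      List.not_mem_nil, or_false, not_or] at hx
    rcases hx with ⟨hx, h⟩ | ⟨hx, h⟩
    · have := hf1 x hx; omega
    · have := hf2 x hx; omega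
  refine ⟨_, ⟨hsent, i, j, rfl⟩, hsent, Lamp.equivZwrZ.symm.injective.countable, fun M _ _ => ?_⟩
  rw [nonempty_equiv_zwrZ_iff, nonempty_equiv_lamp_iff]
  have hσ : ∀ v : ℕ → M, (sigmaFormula 2 i).Realize v ↔ ∃ a t : M, Theta a t := by
    intro v
    simp only [hi, InfFormula.Realize, Set.range_const, Set.mem_singleton_iff,
      exists_eq_left, triple_encode, min_self, hr1]
    constructor
    · rintro ⟨w, -, h⟩; exact ⟨_, _, h⟩
    · rintro ⟨a, t, h⟩
      refine ⟨fun i => if i = 0 then a else if i = 1 then t else v i, fun i hi => ?_, h⟩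
      simp only [List.mem_cons, List.not_mem_nil, or_false, not_or] at hi
      simp [hi.1, hi.2]
  have hπ : ∀ v : ℕ → M, (piFormula 2 j).Realize v ↔
      ∀ a t : M, Theta a t → ∀ x, ∃ c, wordEval (pairVal a t) c = x := by
    intro v
    simp only [hj, InfFormula.Realize, Set.range_const, Set.mem_singleton_iff,
      forall_eq, triple_encode, min_self, hr2]
    constructor
    · intro h a t hθ x
      refine h (fun i => if i = 0 then a else if i = 1 then t else if i = 4 then x else v i)
        (fun i hi => ?_) hθ
      simp only [List.mem_cons, List.not_mem_nil, or_false, not_or] at hi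
      simp [hi.1, hi.2]
    · intro h w _ hθ
      exact h _ _ hθ _
  simp only [InfFormula.Models, InfFormula.Realize, hσ, hπ]
  have : Nonempty (ℕ → M) := ⟨fun _ => sOne M⟩
  exact forall_const _

end

end GroupScott
-- Upper bound for the index set: Σ₁ conditions on atomic diagrams.
namespace GroupScott
open FirstOrder

noncomputable section

/-! ### Projections of primitive recursive relations -/

/-- The projections of primitive recursive relations. -/
def IsSigma1 {α : Type} [Primcodable α] (p : α → Prop) : Prop :=
  ∃ R : α → ℕ → Prop, PrimrecRel R ∧ ∀ a, p a ↔ ∃ n, R a n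

namespace IsSigma1

variable {α β : Type} [Primcodable α]

theorem of_primrecPred {p : α → Prop} (h : PrimrecPred p) : IsSigma1 p :=
  ⟨fun a _ => p a, h.comp Primrec.fst, fun a => by simp⟩

theorem comp [Primcodable β] {p : β → Prop} (h : IsSigma1 p) {f : α → β} (hf : Primrec f) :
    IsSigma1 fun a => p (f a) := by
  obtain ⟨R, hR, hp⟩ := h
  exact ⟨fun a n => R (f a) n, hR.comp (hf.comp Primrec.fst) Primrec.snd, fun a => hp (f a)⟩

theorem and {p q : α → Prop} (hp : IsSigma1 p) (hq : IsSigma1 q) : IsSigma1 fun a => p a ∧ q a := by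
  obtain ⟨R, hR, hp⟩ := hp
  obtain ⟨S, hS, hq⟩ := hq
  refine ⟨fun a n => R a n.unpair.1 ∧ S a n.unpair.2, PrimrecPred.and
    (hR.comp Primrec.fst (Primrec.fst.comp (Primrec.unpair.comp Primrec.snd)))
    (hS.comp Primrec.fst (Primrec.snd.comp (Primrec.unpair.comp Primrec.snd))), fun a => ?_⟩
  simp only [hp, hq]
  constructor
  · rintro ⟨⟨m, hm⟩, n, hn⟩
    exact ⟨Nat.pair m n, by simpa using ⟨hm, hn⟩⟩
  · rintro ⟨n, hm, hn⟩
    exact ⟨⟨_, hm⟩, _, hn⟩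

theorem or {p q : α → Prop} (hp : IsSigma1 p) (hq : IsSigma1 q) : IsSigma1 fun a => p a ∨ q a := by
  obtain ⟨R, hR, hp⟩ := hp
  obtain ⟨S, hS, hq⟩ := hq
  refine ⟨fun a n => R a n ∨ S a n, PrimrecPred.or hR hS, fun a => ?_⟩
  simp only [hp, hq, exists_or]

theorem ex [Denumerable β] {p : α → β → Prop} (h : IsSigma1 fun q : α × β => p q.1 q.2) :
    IsSigma1 fun a => ∃ b, p a b := by
  obtain ⟨R, hR, hp⟩ := h
  refine ⟨fun a n => R (a, Denumerable.ofNat β n.unpair.1) n.unpair.2,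
    hR.comp (Primrec.pair Primrec.fst ((Primrec.ofNat β).comp
      (Primrec.fst.comp (Primrec.unpair.comp Primrec.snd))))
      (Primrec.snd.comp (Primrec.unpair.comp Primrec.snd)), fun a => ?_⟩
  constructor
  · rintro ⟨b, hb⟩
    obtain ⟨n, hn⟩ := (hp (a, b)).1 hb
    exact ⟨Nat.pair (Encodable.encode b) n, by simpa using hn⟩
  · rintro ⟨n, hn⟩
    exact ⟨_, (hp (a, _)).2 ⟨_, hn⟩⟩

end IsSigma1

theorem isSigma2_of_isSigma1 {β : Type} [Denumerable β] {p : ℕ → β → Prop}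
    (h : IsSigma1 fun q : ℕ × β => p q.1 q.2) : IsSigma2 fun n => ∃ b, ¬ p n b := by
  obtain ⟨R, hR, hp⟩ := h
  refine ⟨fun q => ¬ R (q.1, Denumerable.ofNat β q.2.1) q.2.2, PrimrecPred.computablePred
    (PrimrecPred.not (hR.comp (Primrec.pair Primrec.fst ((Primrec.ofNat β).comp
      (Primrec.fst.comp Primrec.snd))) (Primrec.snd.comp Primrec.snd))), fun n => ?_⟩
  constructor
  · rintro ⟨b, hb⟩
    refine ⟨Encodable.encode b, fun y hy => hb ((hp (n, b)).2 ⟨y, ?_⟩)⟩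
    simpa using hy
  · rintro ⟨x, hx⟩
    refine ⟨Denumerable.ofNat β x, fun h => ?_⟩
    obtain ⟨y, hy⟩ := (hp (n, _)).1 h
    exact hx y hy

/-- Evaluation with a bound s is primitive recursive, and every convergent computation is seen for
some s. -/
theorem isSigma1_mem_phi (v : ℕ) : IsSigma1 fun q : ℕ × ℕ => v ∈ phi q.1 q.2 := by
  refine ⟨fun q s => Nat.Partrec.Code.evaln s (Denumerable.ofNat Nat.Partrec.Code q.1) q.2 = some v,
    ?_, fun q => Nat.Partrec.Code.evaln_complete⟩
  exact Primrec.eq.comp (Nat.Partrec.Code.primrec_evaln.comp (Primrec.pair (Primrec.pair Primrec.snd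
    ((Primrec.ofNat _).comp (Primrec.fst.comp Primrec.fst))) (Primrec.snd.comp Primrec.fst)))
    (Primrec.const _)

/-! ### Atomic diagrams -/

/-- The variables of the term with code `c` are in `U`. -/
def InVars (U : Set ℕ) (c : ℕ) : Prop := codeRec True (· ∈ U) id And c

theorem inVars_iff (U : Set ℕ) (c : ℕ) : InVars U c ↔ ∀ i ∈ (termOfNat c).varFinset, i ∈ U := by
  unfold InVars
  induction c using code_induction with
  | one => simp [termOfNat_zero, tOne, Language.Term.varFinset]
  | var i => simp [termOfNat_var, Language.Term.varFinset]
  | inv a ha => simpa [termOfNat_inv, tInv, Language.Term.varFinset] using ha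
  | mul a b ha hb =>
    rw [codeRec_mul, ha, hb]
    simp only [termOfNat_mul, tMul, Language.Term.varFinset, Finset.mem_biUnion, Finset.mem_univ,
      true_and]
    constructor
    · rintro ⟨h1, h2⟩ i ⟨j, hj⟩
      revert hj
      refine Fin.cases (fun hj => h1 i hj) (fun j => ?_) j
      exact Fin.cases (fun hj => h2 i hj) (fun j => j.elim0) j
    · intro h
      exact ⟨fun i hi => h i ⟨0, hi⟩, fun i hi => h i ⟨1, hi⟩⟩

theorem mem_varFinset_relabel {β : Type} (f : β → ℕ) (s : groupLang.Term β) :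
    ∀ i ∈ (s.relabel f).varFinset, i ∈ Set.range f := by
  induction s with
  | var b => simp [Language.Term.relabel, Language.Term.varFinset]
  | func g ts ih =>
    intro i hi
    simp only [Language.Term.relabel, Language.Term.varFinset, Finset.mem_biUnion, Finset.mem_univ,
      true_and] at hi
    obtain ⟨j, hj⟩ := hi
    exact ih j i hj

theorem exists_relabel_eq_of_inVars {U : Set ℕ} {c : ℕ} (h : InVars U c) :
    ∃ s : groupLang.Term U, termOfNat c = s.relabel Subtype.val := by
  unfold InVars at h
  induction c using code_induction with
  | one =>
    refine ⟨Language.Term.func GroupFunc.one ![], ?_⟩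
    rw [termOfNat_zero]
    exact congrArg (Language.Term.func (L := groupLang) GroupFunc.one) (Subsingleton.elim _ _)
  | var i =>
    rw [codeRec_var] at h
    exact ⟨Language.Term.var ⟨i, h⟩, termOfNat_var i⟩
  | inv a ha =>
    rw [codeRec_inv] at h
    obtain ⟨s, hs⟩ := ha h
    refine ⟨Language.Term.func GroupFunc.inv ![s], ?_⟩
    rw [termOfNat_inv]
    refine congrArg (Language.Term.func (L := groupLang) GroupFunc.inv) ?_
    funext i; fin_cases i; exact hs
  | mul a b ha hb =>
    rw [codeRec_mul] at h
    obtain ⟨s, hs⟩ := ha h.1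
    obtain ⟨t, ht⟩ := hb h.2
    refine ⟨Language.Term.func GroupFunc.mul ![s, t], ?_⟩
    rw [termOfNat_mul]
    refine congrArg (Language.Term.func (L := groupLang) GroupFunc.mul) ?_
    funext i; fin_cases i
    · exact hs
    · exact ht

open Classical in
/-- The assignment of `i` to `x_i` for `i ∈ U`. -/
def selfVal (U : Set ℕ) [groupLang.Structure U] (i : ℕ) : U :=
  if h : i ∈ U then ⟨i, h⟩ else sOne U

theorem selfVal_coe {U : Set ℕ} [groupLang.Structure U] (u : U) : selfVal U u = u := by
  simp [selfVal]

theorem selfVal_eq {U : Set ℕ} [groupLang.Structure U] {i : ℕ} (h : i ∈ U) :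
    selfVal U i = ⟨i, h⟩ := by
  simp [selfVal, h]

/-- Trades terms over `U` for codes. Once the variables lie in `U`, the values of `selfVal` outside
`U` are irrelevant. -/
theorem mem_atomicDiagram {U : Set ℕ} [groupLang.Structure U] {k : ℕ} :
    k ∈ atomicDiagram U ↔
      InVars U (k / 2).unpair.1 ∧ InVars U (k / 2).unpair.2 ∧ litEval (selfVal U) k := by
  have hval : ∀ (c : ℕ) (s : groupLang.Term U), termOfNat c = s.relabel Subtype.val →
      s.realize (id : U → U) = wordEval (selfVal U) c := by
    intro c s h
    have : selfVal U ∘ (Subtype.val : U → ℕ) = id := funext fun u => selfVal_coe u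
    rw [wordEval, h, Language.Term.realize_relabel, this]
  constructor
  · rintro ⟨s, t, hs, ht, h⟩
    rw [hval _ _ hs, hval _ _ ht] at h
    refine ⟨(inVars_iff _ _).2 ?_, (inVars_iff _ _).2 ?_, h⟩
    · rw [hs]; simpa using mem_varFinset_relabel Subtype.val s
    · rw [ht]; simpa using mem_varFinset_relabel Subtype.val t
  · rintro ⟨h1, h2, h⟩
    obtain ⟨s, hs⟩ := exists_relabel_eq_of_inVars h1
    obtain ⟨t, ht⟩ := exists_relabel_eq_of_inVars h2
    refine ⟨s, t, hs, ht, ?_⟩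
    rwa [hval _ _ hs, hval _ _ ht]

theorem inVars_var {U : Set ℕ} {i : ℕ} : InVars U (codeVar i) ↔ i ∈ U := by simp [InVars]

theorem inVars_zero {U : Set ℕ} : InVars U 0 := by simp [InVars]

theorem inVars_inv {U : Set ℕ} {a : ℕ} : InVars U (codeInv a) ↔ InVars U a := by simp [InVars]

theorem inVars_mul {U : Set ℕ} {a b : ℕ} : InVars U (codeMul a b) ↔ InVars U a ∧ InVars U b := by
  simp [InVars]

theorem inVars_subst {U : Set ℕ} {ρ : ℕ → ℕ} (h : ∀ i, InVars U (ρ i)) (c : ℕ) :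
    InVars U (codeSubst ρ c) := by
  unfold InVars codeSubst at *
  induction c using code_induction <;> simp_all

section Diagram

variable {U : Set ℕ} [groupLang.Structure U]

theorem codeEq_mem_atomicDiagram {a b : ℕ} : codeEq a b ∈ atomicDiagram U ↔
    InVars U a ∧ InVars U b ∧ wordEval (selfVal U) a = wordEval (selfVal U) b := by
  rw [mem_atomicDiagram, litEval_codeEq]
  simp [codeEq]

theorem codeNe_mem_atomicDiagram {a b : ℕ} : codeNe a b ∈ atomicDiagram U ↔
    InVars U a ∧ InVars U b ∧ wordEval (selfVal U) a ≠ wordEval (selfVal U) b := by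
  have : (2 * Nat.pair a b + 1) / 2 = Nat.pair a b := by omega
  rw [mem_atomicDiagram, litEval_codeNe]
  simp [codeNe, this]

theorem litSubst_mem_atomicDiagram {ρ : ℕ → U} {k : ℕ} :
    litSubst (fun i => codeVar (ρ i)) k ∈ atomicDiagram U ↔ litEval ρ k := by
  have h1 : ∀ n, (2 * n + k % 2) / 2 = n := by omega
  have h2 : ∀ i, InVars U (codeVar (ρ i)) := fun i => inVars_var.2 (ρ i).2
  have h3 : (fun i => wordEval (selfVal U) (codeVar (ρ i))) = ρ := by
    funext i; rw [wordEval_var, selfVal_coe]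
  rw [mem_atomicDiagram, litEval_subst, h3]
  simp [litSubst, h1, inVars_subst h2]

end Diagram

/-- The structure with the given operations. -/
@[reducible] def structureOfOps {M : Type*} (one : M) (inv : M → M) (mul : M → M → M) :
    groupLang.Structure M where
  funMap {_} f := match f with
    | GroupFunc.mul => fun v => mul (v 0) (v 1)
    | GroupFunc.inv => fun v => inv (v 0)
    | GroupFunc.one => fun _ => one
  RelMap {_} r := r.elim

/-- The closure conditions on the set of literals of an atomic diagram, for the terms `a, b, c, d`
and with positive (negative) information `Y` (`N`) on the membership. -/
def DiagramCond (Y N : ℕ → Prop) (a b c d : ℕ) : Prop :=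
  -- `Y` and `N` occur only positively, so every clause is Σ₁ even if φ_e is partial. This clause
  -- makes φ_e total with values 0 and 1.
  (Y a ∨ N a) ∧
  Y (codeEq 0 0) ∧
  (N (codeEq (codeInv a) (codeInv a)) ∨ Y (codeEq a a)) ∧
  (N (codeEq (codeMul a b) (codeMul a b)) ∨ (Y (codeEq a a) ∧ Y (codeEq b b))) ∧
  (N (codeEq a b) ∨ (Y (codeEq a a) ∧ Y (codeEq b b))) ∧
  (N (codeNe a b) ∨ (Y (codeEq a a) ∧ Y (codeEq b b))) ∧
  (N (codeEq a a) ∨ N (codeEq b b) ∨ (Y (codeEq a b) ∧ N (codeNe a b)) ∨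
    (N (codeEq a b) ∧ Y (codeNe a b))) ∧
  (N (codeEq a b) ∨ Y (codeEq b a)) ∧
  (N (codeEq a b) ∨ N (codeEq b c) ∨ Y (codeEq a c)) ∧
  (N (codeEq a b) ∨ Y (codeEq (codeInv a) (codeInv b))) ∧
  (N (codeEq a b) ∨ N (codeEq c d) ∨ Y (codeEq (codeMul a c) (codeMul b d))) ∧
  -- The last two clauses let every meaningful term be equal to a constant, and keep different
  -- constants apart.
  (N (codeEq a a) ∨ ∃ i, Y (codeEq a (codeVar i))) ∧
  (N (codeEq (codeVar a) (codeVar b)) ∨ a = b)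

theorem diagramCond_atomicDiagram (U : Set ℕ) [groupLang.Structure U] (a b c d : ℕ) :
    DiagramCond (· ∈ atomicDiagram U) (· ∉ atomicDiagram U) a b c d := by
  have hvar : ∀ i j, i ∈ U → j ∈ U → selfVal U i = selfVal U j → i = j := by
    intro i j hi hj h
    rw [selfVal_eq hi, selfVal_eq hj] at h
    exact congrArg Subtype.val h
  unfold DiagramCond
  simp only [codeEq_mem_atomicDiagram, codeNe_mem_atomicDiagram, inVars_inv, inVars_mul,
    inVars_zero, inVars_var, wordEval_inv, wordEval_mul, wordEval_var]
  refine ⟨em _, by simp, ?_, ?_, ?_, ?_, ?_, ?_, ?_, ?_, ?_, ?_, ?_⟩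
  · tauto
  · tauto
  · tauto
  · tauto
  · tauto
  · by_cases h : wordEval (selfVal U) a = wordEval (selfVal U) b <;> (simp [h]; try tauto)
  · by_cases h : wordEval (selfVal U) a = wordEval (selfVal U) b <;> (simp [h]; try tauto)
  · by_cases h : wordEval (selfVal U) a = wordEval (selfVal U) b <;> (simp [h]; try tauto)
  · by_cases h : wordEval (selfVal U) a = wordEval (selfVal U) b <;>
      by_cases h' : wordEval (selfVal U) c = wordEval (selfVal U) d <;> (simp [h, h']; try tauto)
  · by_cases h : InVars U a
    · refine Or.inr ⟨(wordEval (selfVal U) a : U), h, Subtype.prop _, ?_⟩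
      rw [selfVal_coe]
    · exact Or.inl fun h' => h h'.1
  · by_cases h : a = b
    · exact Or.inr h
    · exact Or.inl fun h' => h (hvar a b h'.1 h'.2.1 h'.2.2)

/-- A Henkin-style reconstruction: the universe consists of the i for which D contains x_i = x_i,
and an operation is read off from the constant that D equates with the corresponding term. -/
theorem exists_structure_of_diagramCond {D : Set ℕ}
    (h : ∀ a b c d, DiagramCond (· ∈ D) (· ∉ D) a b c d) :
    ∃ (U : Set ℕ) (_ : groupLang.Structure U), D = atomicDiagram U := by
  -- D signals that a term mentions only elements of the universe by containing its equation with
  -- itself.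
  let V : ℕ → Prop := fun a => codeEq a a ∈ D
  have hone : V 0 := (h 0 0 0 0).2.1
  have hinv : ∀ a, V (codeInv a) → V a := fun a => by
    have := (h a a a a).2.2.1; simp only [V]; tauto
  have hmul : ∀ a b, V (codeMul a b) → V a ∧ V b := fun a b => by
    have := (h a b a a).2.2.2.1; simp only [V]; tauto
  have hE : ∀ {a b}, codeEq a b ∈ D → V a ∧ V b := fun {a b} => by
    have := (h a b a a).2.2.2.2.1; simp only [V]; tauto
  have hN : ∀ {a b}, codeNe a b ∈ D → V a ∧ V b := fun {a b} => by
    have := (h a b a a).2.2.2.2.2.1; simp only [V]; tauto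
  have hEN : ∀ {a b}, V a → V b → (codeNe a b ∈ D ↔ codeEq a b ∉ D) := fun {a b} => by
    have := (h a b a a).2.2.2.2.2.2.1; simp only [V]; tauto
  have hsymm : ∀ {a b}, codeEq a b ∈ D → codeEq b a ∈ D := fun {a b} => by
    have := (h a b a a).2.2.2.2.2.2.2.1; tauto
  have htrans : ∀ {a b c}, codeEq a b ∈ D → codeEq b c ∈ D → codeEq a c ∈ D := fun {a b c} => by
    have := (h a b c a).2.2.2.2.2.2.2.2.1; tauto
  have hcinv : ∀ {a b}, codeEq a b ∈ D → codeEq (codeInv a) (codeInv b) ∈ D := fun {a b} => by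
    have := (h a b a a).2.2.2.2.2.2.2.2.2.1; tauto
  have hcmul : ∀ {a b c d}, codeEq a b ∈ D → codeEq c d ∈ D →
      codeEq (codeMul a c) (codeMul b d) ∈ D := fun {a b c d} => by
    have := (h a b c d).2.2.2.2.2.2.2.2.2.2.1; tauto
  have hex : ∀ {a}, V a → ∃ i, codeEq a (codeVar i) ∈ D := fun {a} => by
    have := (h a a a a).2.2.2.2.2.2.2.2.2.2.2.1; simp only [V]; tauto
  have huniq : ∀ {i j}, codeEq (codeVar i) (codeVar j) ∈ D → i = j := fun {i j} => by
    have := (h i j i i).2.2.2.2.2.2.2.2.2.2.2.2; tauto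
  let U : Set ℕ := {i | V (codeVar i)}
  have hex' : ∀ a, V a → ∃ u : U, codeEq a (codeVar u) ∈ D := fun a ha => by
    obtain ⟨i, hi⟩ := hex ha
    exact ⟨⟨i, (hE hi).2⟩, hi⟩
  obtain ⟨one, h1⟩ := hex' 0 hone
  choose inv hi using fun u : U => hex' (codeInv (codeVar u)) (hcinv u.2)
  choose mul hm using fun u v : U => hex' (codeMul (codeVar u) (codeVar v)) (hcmul u.2 v.2)
  let _ : groupLang.Structure U := structureOfOps one inv mul
  have hV : ∀ c, InVars U c → codeEq c (codeVar (wordEval (selfVal U) c : U)) ∈ D := by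
    intro c hc
    induction c using code_induction with
    | one => rw [wordEval_zero]; exact h1
    | var i =>
      rw [inVars_var] at hc
      rw [wordEval_var, selfVal_eq hc]
      exact hc
    | inv a ha =>
      rw [inVars_inv] at hc
      rw [wordEval_inv]
      exact htrans (hcinv (ha hc)) (hi _)
    | mul a b ha hb =>
      rw [inVars_mul] at hc
      rw [wordEval_mul]
      exact htrans (hcmul (ha hc.1) (hb hc.2)) (hm _ _)
  have hI : ∀ c, V c → InVars U c := by
    intro c hc
    induction c using code_induction with
    | one => exact inVars_zero
    | var i => exact inVars_var.2 hc
    | inv a ha => exact inVars_inv.2 (ha (hinv a hc))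
    | mul a b ha hb => exact inVars_mul.2 ⟨ha (hmul a b hc).1, hb (hmul a b hc).2⟩
  have key : ∀ {a b}, codeEq a b ∈ D ↔ codeEq a b ∈ atomicDiagram U := by
    intro a b
    rw [codeEq_mem_atomicDiagram]
    constructor
    · intro hab
      have ha := hI a (hE hab).1
      have hb := hI b (hE hab).2
      refine ⟨ha, hb, Subtype.ext (huniq ?_)⟩
      exact htrans (hsymm (hV a ha)) (htrans hab (hV b hb))
    · rintro ⟨ha, hb, hab⟩
      have := hV b hb
      rw [← hab] at this
      exact htrans (hV a ha) (hsymm this)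
  refine ⟨U, inferInstance, Set.ext fun k => ?_⟩
  obtain ⟨a, b, rfl | rfl⟩ := codeEq_or_codeNe k
  · exact key
  · have hVI : ∀ c, V c ↔ InVars U c := fun c => ⟨hI c, fun hc => (hE (hV c hc)).1⟩
    have hab : codeNe a b ∈ D ↔ V a ∧ V b ∧ codeEq a b ∉ D :=
      ⟨fun hD => ⟨(hN hD).1, (hN hD).2, (hEN (hN hD).1 (hN hD).2).1 hD⟩,
        fun ⟨ha, hb, hD⟩ => (hEN ha hb).2 hD⟩
    rw [hab, key, codeEq_mem_atomicDiagram, codeNe_mem_atomicDiagram, hVI, hVI]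
    tauto

/-! ### The index set is d-`Σ₂` -/

/-- The substitution of `x_a, x_t, x_y, x_b` for `x₀, …, x₃`. -/
def quadSubst (a t y b : ℕ) : ℕ → ℕ := fun i => codeVar (quadVal a t y b i)

/-- The failure of `Theta`, in terms of the diagram. -/
def NotTheta (Y N : ℕ → Prop) (a t : ℕ) : Prop :=
  N (codeEq (codeVar a) (codeVar a)) ∨ N (codeEq (codeVar t) (codeVar t)) ∨
    ∃ q : ℕ × ℕ × ℕ, Y (codeEq (codeVar q.1) (codeVar q.1)) ∧
      Y (codeEq (codeVar q.2.1) (codeVar q.2.1)) ∧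
      Y (litSubst (quadSubst a t q.1 q.2.1) (badPair q.2.2).1) ∧
      Y (litSubst (quadSubst a t q.1 q.2.1) (badPair q.2.2).2)

/-- The pair `(a, t)` generates the element `i` or fails `Theta`, in terms of the diagram. -/
def GeneratesOrNot (Y N : ℕ → Prop) (a t i : ℕ) : Prop :=
  NotTheta Y N a t ∨ N (codeEq (codeVar i) (codeVar i)) ∨
    ∃ c, Y (codeEq (codeSubst (pairSubst a t) c) (codeVar i))

section Iso

variable {U : Set ℕ} [groupLang.Structure U]

theorem codeVar_mem_atomicDiagram {i : ℕ} :
    codeEq (codeVar i) (codeVar i) ∈ atomicDiagram U ↔ i ∈ U := by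
  simp [codeEq_mem_atomicDiagram, inVars_var]

theorem notTheta_iff (a t : U) :
    NotTheta (· ∈ atomicDiagram U) (· ∉ atomicDiagram U) a t ↔ ¬ Theta a t := by
  have key : ∀ (y b : U) k, litSubst (quadSubst a t y b) k ∈ atomicDiagram U ↔
      litEval (quadVal a t y b) k := fun y b k => by
    rw [← litSubst_mem_atomicDiagram]
    have : quadSubst a t y b = fun i => codeVar (quadVal a t y b i : U) := by
      funext i
      rw [quadSubst, ← comp_quadVal Subtype.val]
    rw [this]
  simp only [NotTheta, codeVar_mem_atomicDiagram, a.2, t.2, not_true, false_or, Theta, not_forall,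
    not_not]
  constructor
  · rintro ⟨⟨y, b, n⟩, hy, hb, h1, h2⟩
    exact ⟨⟨y, hy⟩, ⟨b, hb⟩, n, (key _ _ _).1 h1, (key _ _ _).1 h2⟩
  · rintro ⟨y, b, n, h1, h2⟩
    exact ⟨(y, b, n), y.2, b.2, (key _ _ _).2 h1, (key _ _ _).2 h2⟩

/-- Numbers outside `U` count as failing `Theta` or as already generated, so quantifiers over `U`
become quantifiers over ℕ, and isomorphism becomes a property of the diagram alone. -/
theorem nonempty_equiv_lamp_iff_diagram : Nonempty (groupLang.Equiv U (Lamp ℤ)) ↔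
    (∃ p : ℕ × ℕ, ¬ NotTheta (· ∈ atomicDiagram U) (· ∉ atomicDiagram U) p.1 p.2) ∧
    ∀ a t i, GeneratesOrNot (· ∈ atomicDiagram U) (· ∉ atomicDiagram U) a t i := by
  have hU : ∀ {a t : ℕ}, ¬ NotTheta (· ∈ atomicDiagram U) (· ∉ atomicDiagram U) a t →
      a ∈ U ∧ t ∈ U := by
    intro a t h
    simp only [NotTheta, codeVar_mem_atomicDiagram] at h
    tauto
  have hgen : ∀ (a t x : U), (∃ c, wordEval (pairVal a t) c = x) ↔
      ∃ c, codeEq (codeSubst (pairSubst a t) c) (codeVar x) ∈ atomicDiagram U := by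
    intro a t x
    refine exists_congr fun c => ?_
    have h1 : ∀ i, InVars U (pairSubst a t i) := fun i => by
      unfold pairSubst; split_ifs <;> simp [inVars_var]
    rw [codeEq_mem_atomicDiagram, wordEval_subst, wordEval_pairSubst, wordEval_var, selfVal_coe,
      selfVal_coe, selfVal_coe, inVars_var]
    simp [inVars_subst h1]
  rw [nonempty_equiv_lamp_iff]
  refine and_congr ?_ ?_
  · constructor
    · rintro ⟨a, t, h⟩
      exact ⟨(a, t), by rw [notTheta_iff]; exact not_not.2 h⟩
    · rintro ⟨⟨a, t⟩, h⟩
      obtain ⟨ha, ht⟩ := hU h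
      exact ⟨⟨a, ha⟩, ⟨t, ht⟩, not_not.1 ((notTheta_iff ⟨a, ha⟩ ⟨t, ht⟩).not.1 h)⟩
  · constructor
    · intro h a t i
      by_contra hno
      simp only [GeneratesOrNot, not_or, codeVar_mem_atomicDiagram, not_not] at hno
      obtain ⟨h1, hi, h2⟩ := hno
      obtain ⟨ha, ht⟩ := hU h1
      have h3 := not_not.1 ((notTheta_iff ⟨a, ha⟩ ⟨t, ht⟩).not.1 h1)
      exact h2 ((hgen ⟨a, ha⟩ ⟨t, ht⟩ ⟨i, hi⟩).1 (h _ _ h3 _))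
    · intro h a t hθ x
      rcases h a t x with h | h | h
      · exact absurd hθ ((notTheta_iff a t).1 h)
      · exact absurd (codeVar_mem_atomicDiagram.2 x.2) h
      · exact (hgen a t x).2 h

end Iso

theorem primrec_quadVal : Primrec fun p : (ℕ × ℕ × ℕ × ℕ) × ℕ =>
    quadVal p.1.1 p.1.2.1 p.1.2.2.1 p.1.2.2.2 p.2 := by
  have h := Primrec.fst (α := ℕ × ℕ × ℕ × ℕ) (β := ℕ)
  have h2 := Primrec.snd.comp h
  have h3 := Primrec.snd.comp h2
  exact Primrec.ite (Primrec.eq.comp Primrec.snd (Primrec.const 0)) (Primrec.fst.comp h)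
    (Primrec.ite (Primrec.eq.comp Primrec.snd (Primrec.const 1)) (Primrec.fst.comp h2)
      (Primrec.ite (Primrec.eq.comp Primrec.snd (Primrec.const 2)) (Primrec.fst.comp h3)
        (Primrec.snd.comp h3)))

section Sigma1

variable {α : Type} [Primcodable α] {Y N : α → ℕ → Prop}

theorem isSigma1_diagramCond (hY : IsSigma1 fun q : α × ℕ => Y q.1 q.2)
    (hN : IsSigma1 fun q : α × ℕ => N q.1 q.2) :
    IsSigma1 fun p : α × (ℕ × ℕ × ℕ × ℕ) =>
      DiagramCond (Y p.1) (N p.1) p.2.1 p.2.2.1 p.2.2.2.1 p.2.2.2.2 := by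
  have y : ∀ {f : α × (ℕ × ℕ × ℕ × ℕ) → ℕ}, Primrec f → IsSigma1 fun p => Y p.1 (f p) :=
    fun hf => hY.comp (Primrec.pair Primrec.fst hf)
  have n : ∀ {f : α × (ℕ × ℕ × ℕ × ℕ) → ℕ}, Primrec f → IsSigma1 fun p => N p.1 (f p) :=
    fun hf => hN.comp (Primrec.pair Primrec.fst hf)
  have p2 := Primrec.snd (α := α) (β := ℕ × ℕ × ℕ × ℕ)
  have a := Primrec.fst.comp p2
  have b := Primrec.fst.comp (Primrec.snd.comp p2)
  have c := Primrec.fst.comp (Primrec.snd.comp (Primrec.snd.comp p2))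
  have d := Primrec.snd.comp (Primrec.snd.comp (Primrec.snd.comp p2))
  have E := fun {f g : α × (ℕ × ℕ × ℕ × ℕ) → ℕ} (hf : Primrec f) (hg : Primrec g) =>
    primrec_codeEq.comp hf hg
  have E' := fun {f g : α × (ℕ × ℕ × ℕ × ℕ) → ℕ} (hf : Primrec f) (hg : Primrec g) =>
    primrec_codeNe.comp hf hg
  have I := fun {f : α × (ℕ × ℕ × ℕ × ℕ) → ℕ} (hf : Primrec f) => primrec_codeInv.comp hf
  have M := fun {f g : α × (ℕ × ℕ × ℕ × ℕ) → ℕ} (hf : Primrec f) (hg : Primrec g) =>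
    primrec_codeMul.comp hf hg
  have vab := (y (E a a)).and (y (E b b))
  refine ((y a).or (n a)).and ((y (Primrec.const _)).and
    (((n (E (I a) (I a))).or (y (E a a))).and (((n (E (M a b) (M a b))).or vab).and
    (((n (E a b)).or vab).and (((n (E' a b)).or vab).and
    (((n (E a a)).or ((n (E b b)).or (((y (E a b)).and (n (E' a b))).or
      ((n (E a b)).and (y (E' a b)))))).and
    (((n (E a b)).or (y (E b a))).and (((n (E a b)).or ((n (E b c)).or (y (E a c)))).and
    (((n (E a b)).or (y (E (I a) (I b)))).and
    (((n (E a b)).or ((n (E c d)).or (y (E (M a c) (M b d))))).and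
    (((n (E a a)).or ?_).and ((n (E (primrec_codeVar.comp a) (primrec_codeVar.comp b))).or
      (IsSigma1.of_primrecPred (Primrec.eq.comp a b))))))))))))))
  refine IsSigma1.ex (p := fun (p : α × (ℕ × ℕ × ℕ × ℕ)) i => Y p.1 (codeEq p.2.1 (codeVar i))) ?_
  exact hY.comp (Primrec.pair (Primrec.fst.comp Primrec.fst)
    (primrec_codeEq.comp (a.comp Primrec.fst) (primrec_codeVar.comp Primrec.snd)))

theorem isSigma1_notTheta (hY : IsSigma1 fun q : α × ℕ => Y q.1 q.2)
    (hN : IsSigma1 fun q : α × ℕ => N q.1 q.2) :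
    IsSigma1 fun p : α × (ℕ × ℕ) => NotTheta (Y p.1) (N p.1) p.2.1 p.2.2 := by
  have a := Primrec.fst.comp (Primrec.snd (α := α) (β := ℕ × ℕ))
  have t := Primrec.snd.comp (Primrec.snd (α := α) (β := ℕ × ℕ))
  have E : ∀ {γ : Type} [Primcodable γ] {f : γ → ℕ}, Primrec f →
      Primrec fun c => codeEq (codeVar (f c)) (codeVar (f c)) := fun hf =>
    primrec_codeEq.comp (primrec_codeVar.comp hf) (primrec_codeVar.comp hf)
  refine (hN.comp (Primrec.pair Primrec.fst (E a))).or
    ((hN.comp (Primrec.pair Primrec.fst (E t))).or (IsSigma1.ex ?_))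
  have x := Primrec.fst.comp (Primrec.fst (α := α × (ℕ × ℕ)) (β := ℕ × ℕ × ℕ))
  have y := Primrec.fst.comp (Primrec.snd (α := α × (ℕ × ℕ)) (β := ℕ × ℕ × ℕ))
  have b := Primrec.fst.comp (Primrec.snd.comp (Primrec.snd (α := α × (ℕ × ℕ)) (β := ℕ × ℕ × ℕ)))
  have n := Primrec.snd.comp (Primrec.snd.comp (Primrec.snd (α := α × (ℕ × ℕ)) (β := ℕ × ℕ × ℕ)))
  have hs : Primrec₂ fun (q : ℕ × ℕ × ℕ × ℕ) k => litSubst (quadSubst q.1 q.2.1 q.2.2.1 q.2.2.2) k :=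
    primrec_litSubst (ρ := fun q : ℕ × ℕ × ℕ × ℕ => quadSubst q.1 q.2.1 q.2.2.1 q.2.2.2)
      (primrec_codeVar.comp primrec_quadVal)
  have hq := Primrec.pair (a.comp (Primrec.fst (α := α × (ℕ × ℕ)) (β := ℕ × ℕ × ℕ)))
    (Primrec.pair (t.comp Primrec.fst) (Primrec.pair y b))
  exact (hY.comp (Primrec.pair x (E y))).and ((hY.comp (Primrec.pair x (E b))).and
    ((hY.comp (Primrec.pair x (hs.comp hq (Primrec.fst.comp (primrec_badPair.comp n))))).and
      (hY.comp (Primrec.pair x (hs.comp hq (Primrec.snd.comp (primrec_badPair.comp n)))))))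

theorem isSigma1_generatesOrNot (hY : IsSigma1 fun q : α × ℕ => Y q.1 q.2)
    (hN : IsSigma1 fun q : α × ℕ => N q.1 q.2) :
    IsSigma1 fun p : α × (ℕ × ℕ × ℕ) =>
      GeneratesOrNot (Y p.1) (N p.1) p.2.1 p.2.2.1 p.2.2.2 := by
  have a := Primrec.fst.comp (Primrec.snd (α := α) (β := ℕ × ℕ × ℕ))
  have t := Primrec.fst.comp (Primrec.snd.comp (Primrec.snd (α := α) (β := ℕ × ℕ × ℕ)))
  have i := Primrec.snd.comp (Primrec.snd.comp (Primrec.snd (α := α) (β := ℕ × ℕ × ℕ)))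
  refine ((isSigma1_notTheta hY hN).comp (Primrec.pair Primrec.fst (Primrec.pair a t))).or
    ((hN.comp (Primrec.pair Primrec.fst (primrec_codeEq.comp (primrec_codeVar.comp i)
      (primrec_codeVar.comp i)))).or (IsSigma1.ex ?_))
  have hs : Primrec₂ fun (q : ℕ × ℕ) c => codeSubst (pairSubst q.1 q.2) c := by
    refine primrec_codeSubst (ρ := fun q : ℕ × ℕ => pairSubst q.1 q.2) ?_
    exact Primrec.ite (Primrec.eq.comp (Primrec.nat_mod.comp Primrec.snd (Primrec.const 2))
      (Primrec.const 0)) (primrec_codeVar.comp (Primrec.fst.comp Primrec.fst))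
      (primrec_codeVar.comp (Primrec.snd.comp Primrec.fst))
  exact hY.comp (Primrec.pair (Primrec.fst.comp Primrec.fst) (primrec_codeEq.comp
    (hs.comp (Primrec.pair (a.comp Primrec.fst) (t.comp Primrec.fst)) Primrec.snd)
    (primrec_codeVar.comp (i.comp Primrec.fst))))

end Sigma1

/-- The existence of a `Theta` pair is the Σ₂ part. Being a diagram and generation by all `Theta`
pairs are both universally quantified Σ₁ conditions, so one Π₂ condition holds them together. -/
theorem isDSigma2_indexSet : IsDSigma2 (indexSet ZwrZ) := by
  let Y : ℕ → ℕ → Prop := fun e k => 1 ∈ phi e k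
  let N : ℕ → ℕ → Prop := fun e k => 0 ∈ phi e k
  have hY : IsSigma1 fun q : ℕ × ℕ => Y q.1 q.2 := isSigma1_mem_phi 1
  have hN : IsSigma1 fun q : ℕ × ℕ => N q.1 q.2 := isSigma1_mem_phi 0
  let P : ℕ → (ℕ × ℕ × ℕ × ℕ) × (ℕ × ℕ × ℕ) → Prop := fun e p =>
    DiagramCond (Y e) (N e) p.1.1 p.1.2.1 p.1.2.2.1 p.1.2.2.2 ∧
      GeneratesOrNot (Y e) (N e) p.2.1 p.2.2.1 p.2.2.2
  refine ⟨fun e => ∃ p : ℕ × ℕ, ¬ NotTheta (Y e) (N e) p.1 p.2, fun e => ∃ p, ¬ P e p,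
    isSigma2_of_isSigma1 (isSigma1_notTheta hY hN), isSigma2_of_isSigma1 ?_, fun e => ?_⟩
  · exact ((isSigma1_diagramCond hY hN).comp (Primrec.pair Primrec.fst
        (Primrec.fst.comp Primrec.snd))).and ((isSigma1_generatesOrNot hY hN).comp
      (Primrec.pair Primrec.fst (Primrec.snd.comp Primrec.snd)))
  · have hchar : ∀ (D : Set ℕ), IsCharFunction (phi e) D → Y e = (· ∈ D) ∧ N e = (· ∉ D) := by
      intro D hD
      have h01 : ∀ k, k ∈ D → Y e k ∧ ¬ N e k := fun k hk => by simp [Y, N, (hD k).1 hk]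
      have h02 : ∀ k, k ∉ D → ¬ Y e k ∧ N e k := fun k hk => by simp [Y, N, (hD k).2 hk]
      constructor <;> funext k <;> by_cases hk : k ∈ D <;>
        simp [hk, h01 k, h02 k]
    constructor
    · rintro ⟨U, _, hU, hiso⟩
      obtain ⟨e1, e2⟩ := hchar _ hU
      rw [nonempty_equiv_zwrZ_iff, nonempty_equiv_lamp_iff_diagram, ← e1, ← e2] at hiso
      refine ⟨hiso.1, ?_⟩
      rintro ⟨p, hp⟩
      refine hp ⟨?_, hiso.2 _ _ _⟩
      rw [e1, e2]
      exact diagramCond_atomicDiagram U _ _ _ _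
    · rintro ⟨hθ, hP⟩
      push Not at hP
      -- The zeros are arbitrary; the totality clause involves only k.
      have htot : ∀ k, Y e k ∨ N e k := fun k => (hP ((k, 0, 0, 0), (0, 0, 0))).1.1
      have hD : IsCharFunction (phi e) {k | Y e k} := fun k =>
        ⟨fun hk => Part.eq_some_iff.2 hk, fun hk => Part.eq_some_iff.2 ((htot k).resolve_left hk)⟩
      obtain ⟨e1, e2⟩ := hchar _ hD
      obtain ⟨U, _, hU⟩ := exists_structure_of_diagramCond (D := {k | Y e k}) fun a b c d => by
        have := (hP ((a, b, c, d), (0, 0, 0))).1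
        rwa [e1, e2] at this
      rw [hU] at hD e1 e2
      refine ⟨U, _, hD, ?_⟩
      rw [nonempty_equiv_zwrZ_iff, nonempty_equiv_lamp_iff_diagram, ← e1, ← e2]
      exact ⟨hθ, fun a t i => (hP ((0, 0, 0, 0), (a, t, i))).2⟩

end

end GroupScott
-- Computable presentations from a primitive recursive word problem.
namespace GroupScott

noncomputable section

/-! ### Computable presentations -/

section Presentation

variable {R : Type} [CommRing R]

/-- The group of the values of the normal forms. -/
def valueGroup (w : ℕ → R) : Subgroup (Lamp R) where
  carrier := Set.range (NForm.val w)
  one_mem' := ⟨_, NForm.val_one w⟩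
  mul_mem' := by
    rintro _ _ ⟨x, rfl⟩ ⟨y, rfl⟩
    exact ⟨_, NForm.val_mul w x y⟩
  inv_mem' := by
    rintro _ ⟨x, rfl⟩
    exact ⟨_, NForm.val_inv w x⟩

/-- The normal form with code `i`. -/
def decodeForm (i : ℕ) : NForm := (Encodable.decode (α := NForm) i).getD NForm.one

theorem decodeForm_encode (x : NForm) : decodeForm (Encodable.encode x) = x := by
  simp [decodeForm]

theorem primrec_decodeForm : Primrec decodeForm :=
  Primrec.option_getD.comp Primrec.decode (Primrec.const _)

/-- The least codes of the values of the normal forms. -/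
def leastCodes (w : ℕ → R) : Set ℕ :=
  {i | ∀ j ∈ List.range i, NForm.val w (decodeForm j) ≠ NForm.val w (decodeForm i)}

/-- The bijection of the least codes with the values. -/
def leastCodesEquiv (w : ℕ → R) : leastCodes w ≃ valueGroup w :=
  Equiv.ofBijective (fun i => ⟨NForm.val w (decodeForm i), _, rfl⟩) ⟨by
    intro i j h
    have h' : NForm.val w (decodeForm i) = NForm.val w (decodeForm j) := congrArg Subtype.val h
    rcases lt_trichotomy (i : ℕ) j with hij | hij | hij
    · exact absurd h' (j.2 i (List.mem_range.2 hij))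
    · exact Subtype.ext hij
    · exact absurd h'.symm (i.2 j (List.mem_range.2 hij)), by
    classical
    rintro ⟨_, x, rfl⟩
    have hex : ∃ i, NForm.val w (decodeForm i) = NForm.val w x :=
      ⟨Encodable.encode x, by rw [decodeForm_encode]⟩
    refine ⟨⟨Nat.find hex, fun j hj h => ?_⟩, Subtype.ext (Nat.find_spec hex)⟩
    exact Nat.find_min hex (List.mem_range.1 hj) (h.trans (Nat.find_spec hex))⟩

/-- The structure on the least codes. -/
instance leastCodesStructure (w : ℕ → R) : groupLang.Structure (leastCodes w) :=
  structureOfOps ((leastCodesEquiv w).symm 1)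
    (fun x => (leastCodesEquiv w).symm (leastCodesEquiv w x)⁻¹)
    (fun x y => (leastCodesEquiv w).symm (leastCodesEquiv w x * leastCodesEquiv w y))

/-- The bijection of the least codes with the values is an isomorphism. -/
def leastCodesIso (w : ℕ → R) : groupLang.Equiv (leastCodes w) (valueGroup w) :=
  equivOfOps (leastCodesEquiv w) ((leastCodesEquiv w).apply_symm_apply _)
    (fun _ => (leastCodesEquiv w).apply_symm_apply _)
    (fun _ _ => (leastCodesEquiv w).apply_symm_apply _)

/-- The normal form of a term in the least codes. -/
def substForm (c : ℕ) : NForm := codeRec NForm.one decodeForm NForm.inv NForm.mul c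

/-- Terms in elements of the universe are evaluated on normal forms; the operations on least codes
never have to be computed. -/
theorem val_substForm (w : ℕ → R) {c : ℕ} (hc : InVars (leastCodes w) c) :
    NForm.val w (substForm c) =
      (leastCodesIso w (wordEval (selfVal (leastCodes w)) c) : Lamp R) := by
  unfold substForm
  induction c using code_induction with
  | one =>
    rw [codeRec_zero, NForm.val_one, wordEval_zero, equiv_sOne]; rfl
  | var i =>
    rw [inVars_var] at hc
    rw [codeRec_var, wordEval_var, selfVal_eq hc]; rfl
  | inv a ha =>
    rw [inVars_inv] at hc
    rw [codeRec_inv, NForm.val_inv, ha hc, wordEval_inv, equiv_sInv]; rfl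
  | mul a b ha hb =>
    rw [inVars_mul] at hc
    rw [codeRec_mul, NForm.val_mul, ha hc.1, hb hc.2, wordEval_mul, equiv_sMul]; rfl

theorem mem_atomicDiagram_leastCodes (w : ℕ → R) (k : ℕ) :
    k ∈ atomicDiagram (leastCodes w) ↔
      InVars (leastCodes w) (k / 2).unpair.1 ∧ InVars (leastCodes w) (k / 2).unpair.2 ∧
        (k % 2 = 0 ↔ NForm.val w (NForm.mul (substForm (k / 2).unpair.1)
          (NForm.inv (substForm (k / 2).unpair.2))) = 1) := by
  rw [mem_atomicDiagram]
  refine and_congr_right fun h1 => and_congr_right fun h2 => ?_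
  rw [litEval, NForm.val_mul, NForm.val_inv, mul_inv_eq_one, val_substForm w h1,
    val_substForm w h2, ← Subtype.ext_iff, (leastCodesIso w).injective.eq_iff]

theorem primrec_substForm : Primrec substForm :=
  (primrec_codeRec (α := Unit) (one := fun _ => NForm.one) (var := fun _ => decodeForm)
    (inv := fun _ => NForm.inv) (mul := fun _ => NForm.mul) (Primrec.const _)
    (primrec_decodeForm.comp Primrec.snd) (NForm.primrec_inv.comp Primrec.snd)
    (NForm.primrec_mul.comp (Primrec.fst.comp Primrec.snd) (Primrec.snd.comp Primrec.snd))).comp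
    (Primrec.const ()) Primrec.id

/-- Comparing i with an earlier code is an instance of the word problem, and there are finitely many
earlier codes. -/
theorem primrecRel_mem_leastCodes {w : ℕ → ℕ → R}
    (hw : PrimrecRel fun (n : ℕ) (x : NForm) => NForm.val (w n) x = 1) :
    PrimrecRel fun n i => i ∈ leastCodes (w n) := by
  have hR : PrimrecRel fun (j : ℕ) (p : ℕ × ℕ) =>
      NForm.val (w p.1) (decodeForm j) ≠ NForm.val (w p.1) (decodeForm p.2) := by
    refine PrimrecPred.not (PrimrecPred.of_eq (hw.comp (Primrec.fst.comp Primrec.snd)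
      (NForm.primrec_mul.comp (primrec_decodeForm.comp Primrec.fst)
        (NForm.primrec_inv.comp (primrec_decodeForm.comp (Primrec.snd.comp Primrec.snd)))))
      fun p => ?_)
    rw [NForm.val_mul, NForm.val_inv, mul_inv_eq_one]
  exact hR.forall_mem_list.comp (Primrec.list_range.comp Primrec.snd) Primrec.id

theorem primrecRel_inVars {U : ℕ → Set ℕ} (hU : PrimrecRel fun n i => i ∈ U n) :
    PrimrecRel fun n c => InVars (U n) c := by
  classical
  have h := primrec_codeRec (α := ℕ) (one := fun _ => true) (var := fun n i => decide (i ∈ U n))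
    (inv := fun _ => id) (mul := fun _ => and) (Primrec.const _) hU.decide
    Primrec.snd (Primrec.and.comp (Primrec.fst.comp Primrec.snd) (Primrec.snd.comp Primrec.snd))
  refine PrimrecPred.of_eq (Primrec.eq.comp h (Primrec.const true)) fun p => ?_
  rcases p with ⟨n, c⟩
  unfold InVars
  induction c using code_induction <;> simp_all

/-- The s-m-n theorem: curry a program for the characteristic function of Q. -/
theorem exists_index {Q : ℕ → ℕ → Prop} (hQ : PrimrecRel Q) :
    ∃ f : ℕ → ℕ, Computable f ∧ ∀ n, IsCharFunction (phi (f n)) {k | Q n k} := by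
  classical
  have hF : Primrec fun m : ℕ => if Q m.unpair.1 m.unpair.2 then 1 else 0 :=
    Primrec.ite (hQ.comp (Primrec.fst.comp Primrec.unpair) (Primrec.snd.comp Primrec.unpair))
      (Primrec.const 1) (Primrec.const 0)
  obtain ⟨c, hc⟩ := Nat.Partrec.Code.exists_code.1 (Partrec.nat_iff.1 hF.to_comp.partrec)
  refine ⟨fun n => Encodable.encode (Nat.Partrec.Code.curry c n), ?_, fun n k => ?_⟩
  · exact (Primrec.encode.comp (Nat.Partrec.Code.primrec₂_curry.comp (Primrec.const c)
      Primrec.id)).to_comp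
  · have h : phi (Encodable.encode (Nat.Partrec.Code.curry c n)) k =
        Part.some (if Q n k then 1 else 0) := by
      rw [phi, Denumerable.ofNat_encode, Nat.Partrec.Code.eval_curry, hc]
      simp
    rw [h]
    exact ⟨fun hk => congrArg Part.some (if_pos hk), fun hk => congrArg Part.some (if_neg hk)⟩

/-- A sequence of groups of values with a primitive recursive word problem has computable
presentations. -/
theorem exists_index_valueGroup {w : ℕ → ℕ → R}
    (hw : PrimrecRel fun (n : ℕ) (x : NForm) => NForm.val (w n) x = 1) :
    ∃ f : ℕ → ℕ, Computable f ∧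
      ∀ n, IsCharFunction (phi (f n)) (atomicDiagram (leastCodes (w n))) := by
  have hu : Primrec fun p : ℕ × ℕ => (p.2 / 2).unpair :=
    Primrec.unpair.comp (Primrec.nat_div.comp Primrec.snd (Primrec.const 2))
  have hI := primrecRel_inVars (primrecRel_mem_leastCodes hw)
  have h0 : PrimrecPred fun p : ℕ × ℕ => p.2 % 2 = 0 :=
    Primrec.eq.comp (Primrec.nat_mod.comp Primrec.snd (Primrec.const 2)) (Primrec.const 0)
  have h1 : PrimrecPred fun p : ℕ × ℕ => NForm.val (w p.1) (NForm.mul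
      (substForm (p.2 / 2).unpair.1) (NForm.inv (substForm (p.2 / 2).unpair.2))) = 1 :=
    hw.comp Primrec.fst (NForm.primrec_mul.comp
      (primrec_substForm.comp (Primrec.fst.comp hu))
      (NForm.primrec_inv.comp (primrec_substForm.comp (Primrec.snd.comp hu))))
  have hQ : PrimrecRel fun n k => k ∈ atomicDiagram (leastCodes (w n)) := by
    refine PrimrecPred.of_eq (((hI.comp Primrec.fst (Primrec.fst.comp hu)).and
      (hI.comp Primrec.fst (Primrec.snd.comp hu))).and
      ((h0.and h1).or (h0.not.and h1.not))) fun p => ?_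
    refine Iff.trans ?_ (mem_atomicDiagram_leastCodes (w p.1) p.2).symm
    tauto
  exact exists_index hQ

theorem IsCharFunction.eq {f : ℕ →. ℕ} {D E : Set ℕ} (hD : IsCharFunction f D)
    (hE : IsCharFunction f E) : D = E := by
  ext k
  by_cases h1 : k ∈ D <;> by_cases h2 : k ∈ E <;> simp only [h1, h2]
  · have := ((hD k).1 h1).symm.trans ((hE k).2 h2)
    simp at this
  · have := ((hD k).2 h1).symm.trans ((hE k).1 h2)
    simp at this

/-- Any other structure V decided by φ_e has the same diagram, and isomorphism with the group
depends only on the diagram; V need not be compared with `U` directly. -/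
theorem indexSet_iff {e : ℕ} {U : Set ℕ} [groupLang.Structure U]
    (h : IsCharFunction (phi e) (atomicDiagram U)) :
    indexSet ZwrZ e ↔ Nonempty (groupLang.Equiv U (Lamp ℤ)) := by
  constructor
  · rintro ⟨V, _, hV, hiso⟩
    rw [nonempty_equiv_zwrZ_iff, nonempty_equiv_lamp_iff_diagram] at hiso
    rw [nonempty_equiv_lamp_iff_diagram, h.eq hV]
    exact hiso
  · intro hiso
    exact ⟨U, _, h, nonempty_equiv_zwrZ_iff.2 hiso⟩

/-- A sequence of groups of values with a primitive recursive word problem is reducible to the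
index set. -/
theorem exists_reduction {w : ℕ → ℕ → R}
    (hw : PrimrecRel fun (n : ℕ) (x : NForm) => NForm.val (w n) x = 1) :
    ∃ f : ℕ → ℕ, Computable f ∧
      ∀ n, indexSet ZwrZ (f n) ↔ Nonempty (valueGroup (w n) ≃* Lamp ℤ) := by
  obtain ⟨f, hf, h⟩ := exists_index_valueGroup hw
  refine ⟨f, hf, fun n => ?_⟩
  rw [indexSet_iff (h n), ← nonempty_equiv_iff_mulEquiv]
  exact ⟨fun ⟨e⟩ => ⟨e.comp (leastCodesIso (w n)).symm⟩, fun ⟨e⟩ => ⟨e.comp (leastCodesIso (w n))⟩⟩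

end Presentation

end

end GroupScott
-- Cyclicity of the coefficient group as the criterion for ℤ ≀ ℤ.
namespace GroupScott
open LaurentPolynomial

noncomputable section

/-! ### Cyclic coefficient groups -/

section Cyclic

variable {R : Type} [CommRing R]

theorem mapRingHom_T (s : ℤ) :
    AddMonoidAlgebra.mapRingHom ℤ (Int.castRingHom R) (T s) = T s := by
  rw [T, AddMonoidAlgebra.mapRingHom_single, map_one]
  rfl

/-- The homomorphism that extends the coefficients and multiplies by `y`. -/
def scaleHom (R : Type) [CommRing R] (y : R) : Lamp ℤ →* Lamp R where
  toFun x := ⟨AddMonoidAlgebra.mapRingHom ℤ (Int.castRingHom R) x.poly * C y, x.shift⟩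
  map_one' := by ext1 <;> simp
  map_mul' x z := by
    ext1
    · simp only [Lamp.mul_poly, map_add, map_mul, mapRingHom_T]
      ring
    · rfl

theorem scaleHom_injective [CharZero R] [IsDomain R] {y : R} (hy : y ≠ 0) :
    Function.Injective (scaleHom R y) := by
  refine (injective_iff_map_eq_one _).2 fun x hx => ?_
  have h1 : AddMonoidAlgebra.mapRingHom ℤ (Int.castRingHom R) x.poly * C y = 0 :=
    congrArg Lamp.poly hx
  ext1
  · apply LaurentPolynomial.ext
    intro z
    have h2 := congrArg (fun p : R[T;T⁻¹] => p.coeff z) h1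
    rw [mul_comm, ← single_eq_C] at h2
    simp only [AddMonoidAlgebra.coeff_single_mul_apply, AddMonoidAlgebra.coeff_mapRingHom] at h2
    have h3 := (mul_eq_zero.1 h2).resolve_left hy
    simpa using h3
  · have h : (scaleHom R y x).shift = (1 : Lamp R).shift := by rw [hx]
    exact h

theorem val_scale {w : ℕ → R} {y : R} {c : ℕ → ℤ} (h : ∀ j, w j = c j • y) (x : NForm) :
    NForm.val w x = scaleHom R y (NForm.val c x) := by
  have hl : ∀ l, NForm.listVal w l =
      AddMonoidAlgebra.mapRingHom ℤ (Int.castRingHom R) (NForm.listVal c l) * C y := by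
    intro l
    induction l with
    | nil => simp
    | cons e l ih =>
      have he : NForm.entryVal w e =
          AddMonoidAlgebra.mapRingHom ℤ (Int.castRingHom R) (NForm.entryVal c e) * C y := by
        rw [NForm.entryVal, NForm.entryVal, map_mul, map_mul, mapRingHom_T, h]
        rcases e with ⟨b, p, g⟩
        cases b <;> simp <;> ring
      rw [NForm.listVal_cons, NForm.listVal_cons, ih, he, map_add, add_mul]
  ext1
  · exact hl x.1
  · rfl

/-- Multiplying coefficients by y = `w i` ≠ 0 embeds `Lamp ℤ`, and its image is the whole group of
values because all weights are integer multiples of y. -/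
theorem nonempty_mulEquiv_of_cyclic [CharZero R] [IsDomain R] {w : ℕ → R} {i : ℕ} (hi : w i ≠ 0)
    (h : ∀ j, ∃ c : ℤ, w j = c • w i) : Nonempty (valueGroup w ≃* Lamp ℤ) := by
  choose c hc using h
  have hr : (scaleHom R (w i)).range = valueGroup w := by
    apply le_antisymm
    · rw [MonoidHom.range_eq_map, ← Lamp.closure_gen, MonoidHom.map_closure,
        Subgroup.closure_le]
      rintro _ ⟨x, rfl | rfl, rfl⟩
      · refine ⟨NForm.gen i, ?_⟩
        rw [NForm.val_gen]
        ext1 <;> simp [scaleHom, Lamp.genA]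
      · refine ⟨NForm.shiftGen, ?_⟩
        rw [NForm.val_shiftGen]
        ext1 <;> simp [scaleHom, Lamp.genT]
    · rintro _ ⟨x, rfl⟩
      exact ⟨_, (val_scale hc x).symm⟩
  exact ⟨((MonoidHom.ofInjective (scaleHom_injective hi)).trans
    (MulEquiv.subgroupCongr hr)).symm⟩

/-- The augmentation, and the shift. -/
def augHom (R : Type) [CommRing R] : Lamp R →* Multiplicative (R × ℤ) where
  toFun x := Multiplicative.ofAdd (eval₂ (RingHom.id R) 1 x.poly, x.shift)
  map_one' := by simp
  map_mul' x y := by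
    rw [← ofAdd_add]
    congr 1
    ext1
    · simp [Lamp.mul_poly, -T_mul, eval₂_T]
    · rfl

/-- Setting T = 1 maps the group into the abelian group R × ℤ. The image is spanned by the images A,
B of two generators and contains (0, 1) and all (`w j`, 0). As the second coordinate attains 1, the
combinations of A and B with second coordinate 0 are the multiples of a single element. -/
theorem exists_cyclic_of_mulEquiv {w : ℕ → R} (e : valueGroup w ≃* Lamp ℤ) :
    ∃ g : R, ∀ j, ∃ c : ℤ, w j = c • g := by
  let ψ : Lamp ℤ →* Multiplicative (R × ℤ) :=
    ((augHom R).comp (valueGroup w).subtype).comp e.symm.toMonoidHom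
  obtain ⟨A, hA⟩ : ∃ A, ψ Lamp.genA = Multiplicative.ofAdd A := ⟨_, rfl⟩
  obtain ⟨B, hB⟩ : ∃ B, ψ Lamp.genT = Multiplicative.ofAdd B := ⟨_, rfl⟩
  have hmem : ∀ x : NForm, ∃ m n : ℤ, m • A + n • B =
      (eval₂ (RingHom.id R) 1 (NForm.val w x).poly, (NForm.val w x).shift) := by
    intro x
    have h1 : ψ (e ⟨NForm.val w x, x, rfl⟩) ∈ ψ.range := ⟨_, rfl⟩
    rw [MonoidHom.range_eq_map, ← Lamp.closure_gen, MonoidHom.map_closure, Set.image_pair, hA, hB,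
      Subgroup.mem_closure_pair] at h1
    obtain ⟨m, n, h⟩ := h1
    refine ⟨m, n, Multiplicative.ofAdd.injective ?_⟩
    rw [ofAdd_add, ofAdd_zsmul, ofAdd_zsmul, h]
    simp [ψ, augHom]
  obtain ⟨m0, n0, h0⟩ := hmem NForm.shiftGen
  rw [NForm.val_shiftGen] at h0
  have h0s : m0 * A.2 + n0 * B.2 = 1 := by simpa using congrArg Prod.snd h0
  -- By `h0s`, `A.2` and `B.2` are coprime, so m `A.2` + n `B.2` = 0 makes (m, n) the multiple of
  -- (`B.2`, -`A.2`) by n0 m - m0 n.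
  refine ⟨B.2 • A.1 - A.2 • B.1, fun j => ?_⟩
  obtain ⟨m, n, h⟩ := hmem (NForm.gen j)
  rw [NForm.val_gen] at h
  have hs : m * A.2 + n * B.2 = 0 := by simpa using congrArg Prod.snd h
  have hw : m • A.1 + n • B.1 = w j := by simpa using congrArg Prod.fst h
  refine ⟨n0 * m - m0 * n, ?_⟩
  have e1 : m = (n0 * m - m0 * n) * B.2 := by linear_combination m0 * hs - m * h0s
  have e2 : n = -((n0 * m - m0 * n) * A.2) := by linear_combination n0 * hs - n * h0s
  rw [← hw, smul_sub, smul_smul, smul_smul, ← e1]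
  have e3 : (n0 * m - m0 * n) * A.2 = -n := by rw [eq_neg_iff_add_eq_zero]; linarith
  rw [e3, neg_smul, sub_neg_eq_add]

end Cyclic

end

end GroupScott
-- Tools for hardness: primitive recursive matrices, bounded search, factorials.
namespace GroupScott
open Polynomial

noncomputable section

/-! ### Primitive recursive matrices -/

/-- A `Σ₂` set has a definition with a primitive recursive matrix. -/
theorem IsSigma2.exists_primrec {p : ℕ → Prop} (hp : IsSigma2 p) :
    ∃ R : ℕ → ℕ → ℕ → Prop, PrimrecPred (fun t : (ℕ × ℕ) × ℕ => R t.1.1 t.1.2 t.2) ∧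
      ∀ n, p n ↔ ∃ x, ∀ y, R n x y := by
  obtain ⟨R, ⟨_, hR⟩, hp⟩ := hp
  let F : ℕ → ℕ := fun k => bif decide (R (Denumerable.ofNat (ℕ × ℕ × ℕ) k)) then 1 else 0
  have hF : Computable F := Computable.cond (hR.comp (Primrec.ofNat _).to_comp)
    (Computable.const 1) (Computable.const 0)
  obtain ⟨c, hc⟩ := Nat.Partrec.Code.exists_code.1 (Partrec.nat_iff.1 hF.partrec)
  have hFe : ∀ n x y, F (Encodable.encode (n, x, y)) = if R (n, x, y) then 1 else 0 := by
    intro n x y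
    simp only [F, Denumerable.ofNat_encode, Bool.cond_decide]
  -- The universal quantifier absorbs a time bound: R holds for all y exactly when no pair (y, s)
  -- shows the program answering 0 within the bound s.
  refine ⟨fun n x z => Nat.Partrec.Code.evaln z.unpair.2 c
    (Encodable.encode (n, x, z.unpair.1)) ≠ some 0, ?_, fun n => ?_⟩
  · have hz := Primrec.unpair.comp (Primrec.snd (α := ℕ × ℕ) (β := ℕ))
    have h1 := Primrec.fst (α := ℕ × ℕ) (β := ℕ)
    exact PrimrecPred.not (Primrec.eq.comp (Nat.Partrec.Code.primrec_evaln.comp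
      (Primrec.pair (Primrec.pair (Primrec.snd.comp hz) (Primrec.const c))
        (Primrec.encode.comp (Primrec.pair (Primrec.fst.comp h1)
          (Primrec.pair (Primrec.snd.comp h1) (Primrec.fst.comp hz))))))
      (Primrec.const (some 0)))
  · rw [hp]
    refine exists_congr fun x => ⟨fun h z hz => ?_, fun h y => ?_⟩
    · have := Nat.Partrec.Code.evaln_sound (Option.mem_def.2 hz)
      rw [hc] at this
      have := Part.mem_some_iff.1 this
      rw [hFe, if_pos (h _)] at this
      exact zero_ne_one this
    · by_contra hy
      have h0 : 0 ∈ c.eval (Encodable.encode (n, x, y)) := by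
        rw [hc]
        exact Part.mem_some_iff.2 (by rw [hFe, if_neg hy])
      obtain ⟨s, hs⟩ := Nat.Partrec.Code.evaln_complete.1 h0
      exact h (Nat.pair y s) (by simpa using hs)

theorem primrec_pow : Primrec₂ ((· ^ ·) : ℕ → ℕ → ℕ) := Primrec₂.unpaired'.1 Nat.Primrec.pow

theorem primrec_factorial : Primrec Nat.factorial := by
  have h : Primrec₂ fun (n m : ℕ) => (n + 1) * m :=
    Primrec.nat_mul.comp (Primrec.succ.comp Primrec.fst) Primrec.snd
  refine (Primrec.nat_rec₁ 1 h).of_eq fun n => ?_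
  induction n with
  | zero => rfl
  | succ n ih => rw [Nat.factorial_succ, ← ih]

/-! ### Bounded search -/

section Search

open Classical

/-- The least number below `N` with the property `P`, and `N` if there is none. -/
def search (P : ℕ → Prop) (N : ℕ) : ℕ := (List.range N).findIdx fun y => decide (P y)

theorem search_le (P : ℕ → Prop) (N : ℕ) : search P N ≤ N := by
  simpa [search] using List.findIdx_le_length (xs := List.range N) (p := fun y => decide (P y))

theorem search_spec {P : ℕ → Prop} {N : ℕ} (h : search P N < N) : P (search P N) := by
  have := List.findIdx_getElem (xs := List.range N) (p := fun y => decide (P y))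
    (w := by simpa [search] using h)
  simpa [search] using this

theorem not_of_lt_search {P : ℕ → Prop} {N y : ℕ} (h : y < search P N) : ¬ P y := by
  have := List.not_of_lt_findIdx (xs := List.range N) (p := fun y => decide (P y)) h
  simpa using this

theorem primrec_search {α : Type} [Primcodable α] {P : α → ℕ → Prop} (hP : PrimrecRel P) :
    Primrec₂ fun a N => search (P a) N := by
  refine Primrec.list_findIdx (Primrec.list_range.comp Primrec.snd) ?_
  exact (hP.comp (Primrec.fst.comp Primrec.fst) Primrec.snd).decide

end Search

/-! ### Factorials dominate bounded combinations -/

/-- Among the odd g in the support take the one with the largest factorial, (K + 1)!. Pairing with g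
/ 2 keeps the arguments of the factorials distinct, so every other term is at most |c| K!; the |c|
of the other terms add up to at most K, and K · K! < (K + 1)!. -/
theorem sum_mul_ne_zero_of_factorial {f : ℕ →₀ ℤ} {v : ℕ → ℚ} {y : ℕ → ℕ}
    (h0 : ∀ g ∈ f.support, g % 2 = 0 → |v g| ≤ 1)
    (h1 : ∀ g ∈ f.support, g % 2 = 1 → v g = ((Nat.pair (g / 2) (y g)).factorial : ℚ))
    (hbig : ∃ g ∈ f.support, g % 2 = 1 ∧ (f.sum fun _ c => c.natAbs) < y g) :
    (f.sum fun g c => (c : ℚ) * v g) ≠ 0 := by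
  classical
  obtain ⟨g1, hg1, ho1, hb1⟩ := hbig
  obtain ⟨g0, hg0, hmax⟩ := Finset.exists_max_image (f.support.filter fun g => g % 2 = 1)
    (fun g => Nat.pair (g / 2) (y g)) ⟨g1, Finset.mem_filter.2 ⟨hg1, ho1⟩⟩
  obtain ⟨hs0, ho0⟩ := Finset.mem_filter.1 hg0
  obtain ⟨K, hK⟩ : ∃ K, Nat.pair (g0 / 2) (y g0) = K + 1 := by
    refine Nat.exists_eq_succ_of_ne_zero ?_
    have h2 := hmax g1 (Finset.mem_filter.2 ⟨hg1, ho1⟩)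
    have h3 := Nat.right_le_pair (g1 / 2) (y g1)
    omega
  have hQ : (f.sum fun _ c => c.natAbs) < K + 1 := by
    have h2 := hmax g1 (Finset.mem_filter.2 ⟨hg1, ho1⟩)
    have h3 := Nat.right_le_pair (g1 / 2) (y g1)
    omega
  have hv0 : v g0 = ((K + 1).factorial : ℚ) := by rw [h1 g0 hs0 ho0, hK]
  have hother : ∀ g ∈ f.support.erase g0, |(f g : ℚ) * v g| ≤ (f g).natAbs * (K.factorial : ℚ) := by
    intro g hg
    obtain ⟨hne, hs⟩ := Finset.mem_erase.1 hg
    have hc : |(f g : ℚ)| = ((f g).natAbs : ℚ) := by rw [Nat.cast_natAbs, Int.cast_abs]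
    rw [abs_mul, hc]
    refine mul_le_mul_of_nonneg_left ?_ (Nat.cast_nonneg _)
    rcases Nat.mod_two_eq_zero_or_one g with he | ho
    · exact (h0 g hs he).trans (by exact_mod_cast Nat.one_le_of_lt K.factorial_pos)
    · rw [h1 g hs ho, Nat.abs_cast]
      have hle := hmax g (Finset.mem_filter.2 ⟨hs, ho⟩)
      have hne' : Nat.pair (g / 2) (y g) ≠ K + 1 := by
        intro h
        have := (Nat.pair_eq_pair.1 (h.trans hK.symm)).1
        omega
      exact_mod_cast Nat.factorial_le (by omega)
  intro hsum
  rw [Finsupp.sum, ← Finset.add_sum_erase _ _ hs0, hv0, add_eq_zero_iff_eq_neg] at hsum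
  have hle : |(f g0 : ℚ) * ((K + 1).factorial : ℚ)| ≤
      ∑ g ∈ f.support.erase g0, ((f g).natAbs * (K.factorial : ℚ)) := by
    rw [hsum, abs_neg]
    exact (Finset.abs_sum_le_sum_abs _ _).trans (Finset.sum_le_sum hother)
  rw [← Finset.sum_mul, abs_mul, Nat.abs_cast] at hle
  have hQ' : ((∑ g ∈ f.support.erase g0, (f g).natAbs : ℕ) : ℚ) ≤ K := by
    have h2 : ∑ g ∈ f.support.erase g0, (f g).natAbs ≤ f.sum fun _ c => c.natAbs :=
      Finset.sum_le_sum_of_subset (Finset.erase_subset _ _)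
    exact_mod_cast (by omega : ∑ g ∈ f.support.erase g0, (f g).natAbs ≤ K)
  have hf0 : (1 : ℚ) ≤ |(f g0 : ℚ)| := by
    exact_mod_cast Int.one_le_abs (Finsupp.mem_support_iff.1 hs0)
  have hKpos : (0 : ℚ) < K.factorial := by exact_mod_cast K.factorial_pos
  push_cast [Nat.factorial_succ] at hle hQ'
  nlinarith [mul_le_mul_of_nonneg_right hQ' hKpos.le,
    mul_le_mul_of_nonneg_right hf0 (by positivity : (0 : ℚ) ≤ ((K : ℚ) + 1) * K.factorial)]

end

end GroupScott
-- The weights and the many-one reduction.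
namespace GroupScott
open Polynomial

noncomputable section

/-! ### The weights -/

section Weights

open Classical

variable (m : ℕ → ℕ) (A : ℕ → ℕ → Prop)

/-- The weight of the generator `2k` is `2 ^ (-m k)`; that of the generator `2i + 1` is the
factorial of `⟨i, y⟩` for the least `y` with `A i y`, and an indeterminate if there is none. -/
def weight (g : ℕ) : ℚ[X] :=
  if g % 2 = 0 then C (2 ^ m (g / 2))⁻¹
  else if h : ∃ y, A (g / 2) y then C ((Nat.pair (g / 2) (Nat.find h)).factorial : ℚ)
  -- Positive exponents, different for different i, make these generators independent of the
  -- constants and of each other.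
  else X ^ (g / 2 + 1)

/-- Integers that satisfy the same relations of size at most `N` as the weights. -/
def approx (N g : ℕ) : ℕ :=
  if g % 2 = 0 then 2 ^ (N - m (g / 2))
  -- The search covers y ≤ N; a failure returns N + 1, which exceeds the size of every relation
  -- considered.
  else 2 ^ N * (Nat.pair (g / 2) (search (A (g / 2)) (N + 1))).factorial

variable {m A}

theorem weight_even (k : ℕ) : weight m A (2 * k) = C (2 ^ m k)⁻¹ := by
  simp [weight]

theorem weight_odd {i : ℕ} (h : ∃ y, A i y) :
    ∃ c : ℕ, weight m A (2 * i + 1) = C (c : ℚ) := by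
  have e1 : (2 * i + 1) % 2 ≠ 0 := by omega
  have e2 : (2 * i + 1) / 2 = i := by omega
  rw [weight, if_neg e1, dif_pos (by rwa [e2])]
  exact ⟨_, rfl⟩

theorem weight_odd_of_not {i : ℕ} (h : ¬ ∃ y, A i y) : weight m A (2 * i + 1) = X ^ (i + 1) := by
  have e1 : (2 * i + 1) % 2 ≠ 0 := by omega
  have e2 : (2 * i + 1) / 2 = i := by omega
  rw [weight, if_neg e1, e2, dif_neg h]

theorem coeff_weight {g i : ℕ} (hi : ¬ ∃ y, A i y) :
    (weight m A g).coeff (i + 1) = if g = 2 * i + 1 then 1 else 0 := by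
  by_cases hg : g = 2 * i + 1
  · rw [if_pos hg, hg, weight_odd_of_not hi, coeff_X_pow, if_pos rfl]
  · rw [if_neg hg, weight]
    split_ifs
    · exact coeff_C_succ
    · exact coeff_C_succ
    · rw [coeff_X_pow, if_neg (by omega)]

/-- 2^N clears the denominators 2^(m k) since m k ≤ k ≤ N, and a successful bounded search finds the
true least witness. -/
theorem approx_eq {N g : ℕ} (hm : ∀ k, m k ≤ k) (hg : g ≤ N)
    (hs : g % 2 = 1 → search (A (g / 2)) (N + 1) < N + 1) :
    C (2 ^ N : ℚ) * weight m A g = C (approx m A N g : ℚ) := by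
  rw [weight, approx]
  rcases Nat.mod_two_eq_zero_or_one g with he | ho
  · rw [if_pos he, if_pos he, ← C_mul]
    have hle : m (g / 2) ≤ N := (hm _).trans (by omega)
    congr 1
    push_cast
    rw [pow_sub₀ _ two_ne_zero hle]
  · have hne : g % 2 ≠ 0 := by omega
    have h1 := search_spec (hs ho)
    have hex : ∃ y, A (g / 2) y := ⟨_, h1⟩
    have hfind : Nat.find hex = search (A (g / 2)) (N + 1) := by
      refine (Nat.find_eq_iff hex).2 ⟨h1, fun y hy => not_of_lt_search hy⟩
    rw [if_neg hne, if_neg hne, dif_pos hex, ← C_mul, hfind]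
    push_cast
    rfl

/-- If all witnesses needed are at most N, the two sides differ by the factor 2^N. Otherwise neither
vanishes: an odd generator in the support has a witness beyond N or none, and neither a factorial
that large nor an indeterminate can be cancelled by a relation of size at most N. -/
theorem linearCombination_weight_eq_zero_iff {N : ℕ} {f : ℕ →₀ ℤ} (hm : ∀ k, m k ≤ k)
    (hsum : (f.sum fun _ c => c.natAbs) ≤ N) (hsupp : ∀ g ∈ f.support, g ≤ N) :
    Finsupp.linearCombination ℤ (weight m A) f = 0 ↔
      Finsupp.linearCombination ℤ (fun g => (approx m A N g : ℤ)) f = 0 := by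
  have hL : Finsupp.linearCombination ℤ (weight m A) f = f.sum fun g c => (c : ℚ[X]) * weight m A g := by
    simp [Finsupp.linearCombination_apply]
  have hRc : ((Finsupp.linearCombination ℤ (fun g => (approx m A N g : ℤ)) f : ℤ) : ℚ) =
      f.sum fun g c => (c : ℚ) * (approx m A N g : ℚ) := by
    simp [Finsupp.linearCombination_apply, Finsupp.sum]
  have h2 : (2 : ℚ) ^ N ≠ 0 := by positivity
  by_cases hs : ∀ g ∈ f.support, g % 2 = 1 → search (A (g / 2)) (N + 1) < N + 1
  · have key : C (2 ^ N : ℚ) * Finsupp.linearCombination ℤ (weight m A) f =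
        C ((Finsupp.linearCombination ℤ (fun g => (approx m A N g : ℤ)) f : ℤ) : ℚ) := by
      rw [hL, hRc, Finsupp.mul_sum, Finsupp.sum, Finsupp.sum, map_sum]
      refine Finset.sum_congr rfl fun g hg => ?_
      rw [mul_left_comm, approx_eq hm (hsupp g hg) (hs g hg), C_mul]
      simp
    rw [← mul_eq_zero_iff_left (C_ne_zero.2 h2), key, C_eq_zero, Int.cast_eq_zero]
  · push Not at hs
    obtain ⟨g1, hg1, ho1, hs1⟩ := hs
    refine iff_of_false ?_ ?_
    · by_cases hr : ∀ g ∈ f.support, g % 2 = 1 → ∃ y, A (g / 2) y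
      · have hex : ∀ g, ∃ y, ∀ h : ∃ y, A (g / 2) y, y = Nat.find h := by
          intro g
          by_cases h : ∃ y, A (g / 2) y
          · exact ⟨Nat.find h, fun _ => rfl⟩
          · exact ⟨0, fun h' => absurd h' h⟩
        choose y hy using hex
        let v : ℕ → ℚ := fun g => if g % 2 = 0 then (2 ^ m (g / 2))⁻¹ else
          ((Nat.pair (g / 2) (y g)).factorial : ℚ)
        have hv : ∀ g ∈ f.support, weight m A g = C (v g) := by
          intro g hg
          rw [weight]
          rcases Nat.mod_two_eq_zero_or_one g with he | ho
          · simp only [v, if_pos he]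
          · have hne : g % 2 ≠ 0 := by omega
            simp only [v, if_neg hne, dif_pos (hr g hg ho), hy g (hr g hg ho)]
        have h := sum_mul_ne_zero_of_factorial (f := f) (v := v) (y := y) ?_ ?_
          ⟨g1, hg1, ho1, ?_⟩
        · intro h0
          refine h (C_eq_zero.1 ?_)
          rw [← h0, hL, Finsupp.sum, Finsupp.sum, map_sum]
          refine Finset.sum_congr rfl fun g hg => ?_
          rw [hv g hg, C_mul]
          simp
        · intro g _ he
          simp only [v, if_pos he]
          rw [abs_of_pos (by positivity)]
          exact inv_le_one_of_one_le₀ (one_le_pow₀ one_le_two)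
        · intro g _ ho
          have hne : g % 2 ≠ 0 := by omega
          simp only [v, if_neg hne]
        · rw [hy g1 (hr g1 hg1 ho1)]
          by_contra hlt
          exact not_of_lt_search (N := N + 1) (by omega) (Nat.find_spec (hr g1 hg1 ho1))
      · push Not at hr
        obtain ⟨g, hg, ho, hA⟩ := hr
        intro h0
        -- The coefficient of this power isolates g, since no other weight involves it.
        have hc := congrArg (fun p : ℚ[X] => p.coeff (g / 2 + 1)) h0
        have hne : ¬ ∃ y, A (g / 2) y := by simpa using hA
        have e : 2 * (g / 2) + 1 = g := by omega
        have hc' : ∀ g', ((f g' : ℚ[X]) * weight m A g').coeff (g / 2 + 1) =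
            if g' = g then (f g' : ℚ) else 0 := by
          intro g'
          rw [← C_eq_intCast, coeff_C_mul, coeff_weight hne, e]
          simp
        simp only [hL, Finsupp.sum, finsetSum_coeff, hc', coeff_zero, Finset.sum_ite_eq',
          if_pos hg] at hc
        exact Finsupp.mem_support_iff.1 hg (by exact_mod_cast hc)
    -- After division by 2^N the even approximations are at most 1 and the odd ones are factorials,
    -- as domination requires.
    · have h := sum_mul_ne_zero_of_factorial (f := f)
        (v := fun g => (approx m A N g : ℚ) / 2 ^ N)
        (y := fun g => search (A (g / 2)) (N + 1)) ?_ ?_ ⟨g1, hg1, ho1, by omega⟩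
      · intro h0
        refine h ?_
        have h3 : (f.sum fun g c => (c : ℚ) * ((approx m A N g : ℚ) / 2 ^ N)) =
            (f.sum fun g c => (c : ℚ) * (approx m A N g : ℚ)) / 2 ^ N := by
          rw [Finsupp.sum, Finsupp.sum, Finset.sum_div]
          exact Finset.sum_congr rfl fun g _ => (mul_div_assoc _ _ _).symm
        rw [h3, ← hRc, h0, Int.cast_zero, zero_div]
      · intro g _ he
        simp only [approx, if_pos he]
        rw [abs_of_nonneg (by positivity), div_le_one (by positivity)]
        push_cast
        exact pow_le_pow_right₀ one_le_two (Nat.sub_le _ _)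
      · intro g _ ho
        have hne : g % 2 ≠ 0 := by omega
        simp only [approx, if_neg hne]
        push_cast
        exact mul_div_cancel_left₀ _ h2

/-- A bound for the length and for the generators. -/
def entryBound (l : List Entry) : ℕ := l.foldr (fun e s => e.2.2 + 1 + s) 0

theorem length_le_entryBound (l : List Entry) : l.length ≤ entryBound l := by
  induction l with
  | nil => rfl
  | cons e l ih =>
    have : entryBound (e :: l) = e.2.2 + 1 + entryBound l := rfl
    rw [List.length_cons, this]
    omega

theorem le_entryBound {l : List Entry} {e : Entry} (he : e ∈ l) :
    e.2.2 ≤ entryBound l := by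
  induction l with
  | nil => simp at he
  | cons e' l ih =>
    have : entryBound (e' :: l) = e'.2.2 + 1 + entryBound l := rfl
    rw [this]
    rcases List.mem_cons.1 he with rfl | h
    · omega
    · have := ih h
      omega

/-- `entryBound` bounds the length of the list, hence the size of each relation, and all generators
that occur; so one N serves every position. -/
theorem val_weight_eq_one_iff (hm : ∀ k, m k ≤ k) (x : NForm) :
    NForm.val (weight m A) x = 1 ↔ NForm.IsOne (approx m A (entryBound x.1)) x := by
  rw [NForm.isOne_iff, Lamp.ext_iff, Lamp.ext_iff]
  refine and_congr ?_ Iff.rfl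
  refine (NForm.listVal_eq_zero_iff (weight m A) x.1).trans
    (Iff.trans ?_ (NForm.listVal_eq_zero_iff _ x.1).symm)
  refine forall₂_congr fun e _ => linearCombination_weight_eq_zero_iff hm
    ((NForm.sum_natAbs_mult_le _ _).trans (length_le_entryBound _)) fun g hg => ?_
  obtain ⟨e', he', rfl⟩ := NForm.support_mult_subset hg
  exact le_entryBound he'

/-- Since m 0 = 0, the number 1 is a weight, so a common divisor p of the weights is a rational
constant: 1 = c₀ p bounds 2^(m k) by |c₀|, and no X^(i+1) is a multiple of p. Conversely, the
fraction with the largest exponent divides all the weights. -/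
theorem nonempty_mulEquiv_weight_iff (m0 : m 0 = 0) :
    Nonempty (valueGroup (weight m A) ≃* Lamp ℤ) ↔
      (∃ M, ∀ k, m k ≤ M) ∧ ∀ i, ∃ y, A i y := by
  constructor
  · rintro ⟨e⟩
    obtain ⟨p, hp⟩ := exists_cyclic_of_mulEquiv e
    obtain ⟨c0, hc0⟩ := hp (2 * 0)
    rw [weight_even, m0, pow_zero, inv_one, C_1] at hc0
    have hp0 : p.natDegree = 0 := by
      have hu : IsUnit p := by
        refine IsUnit.of_mul_eq_one (c0 : ℚ[X]) ?_
        rw [hc0, zsmul_eq_mul, mul_comm]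
      exact natDegree_eq_zero_of_isUnit hu
    obtain ⟨g, rfl⟩ := natDegree_eq_zero.1 hp0
    have hg : (1 : ℚ) = c0 * g := by
      have := congrArg (fun q : ℚ[X] => q.coeff 0) hc0
      simpa using this
    refine ⟨⟨c0.natAbs, fun k => ?_⟩, fun i => ?_⟩
    · obtain ⟨c, hc⟩ := hp (2 * k)
      rw [weight_even] at hc
      have h1 : ((2 : ℚ) ^ m k)⁻¹ = c * g := by
        have := congrArg (fun q : ℚ[X] => q.coeff 0) hc
        simpa using this
      have h2 : (c0 : ℚ) = c * 2 ^ m k := by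
        have h3 : (2 : ℚ) ^ m k ≠ 0 := by positivity
        have h4 : (1 : ℚ) = c * g * 2 ^ m k := by rw [← h1, inv_mul_cancel₀ h3]
        linear_combination c0 * h4 - c * 2 ^ m k * hg
      have h5 : c0 = c * 2 ^ m k := by exact_mod_cast h2
      have h6 : c0 ≠ 0 := by
        rintro rfl
        simp at hg
      have h7 : 2 ^ m k ≤ c0.natAbs := by
        rw [h5, Int.natAbs_mul, Int.natAbs_pow]
        refine Nat.le_mul_of_pos_left _ (Int.natAbs_pos.2 ?_)
        rintro rfl
        exact h6 (by rw [h5, zero_mul])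
      exact (Nat.lt_two_pow_self.le).trans h7
    · by_contra hi
      obtain ⟨c, hc⟩ := hp (2 * i + 1)
      rw [weight_odd_of_not hi] at hc
      have := congrArg (fun q : ℚ[X] => q.coeff (i + 1)) hc
      rw [zsmul_eq_mul, ← C_eq_intCast, ← C_mul, coeff_C_succ] at this
      simp at this
  · rintro ⟨⟨M, hM⟩, hA⟩
    have hfin : (Set.range m).Finite := (Set.finite_Iic M).subset (by rintro _ ⟨k, rfl⟩; exact hM k)
    obtain ⟨_, ⟨k0, rfl⟩, hk0⟩ := Set.exists_max_image _ id hfin ⟨_, Set.mem_range_self 0⟩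
    have hmax : ∀ k, m k ≤ m k0 := fun k => hk0 _ ⟨k, rfl⟩
    have h2 : (2 : ℚ) ^ m k0 ≠ 0 := by positivity
    refine nonempty_mulEquiv_of_cyclic (i := 2 * k0) ?_ fun j => ?_
    · rw [weight_even]
      exact C_ne_zero.2 (inv_ne_zero h2)
    · rw [weight_even]
      obtain ⟨k, rfl | rfl⟩ := Nat.even_or_odd' j
      · refine ⟨2 ^ (m k0 - m k), ?_⟩
        rw [weight_even, zsmul_eq_mul, ← C_eq_intCast, ← C_mul]
        congr 1
        push_cast
        rw [pow_sub₀ (2 : ℚ) two_ne_zero (hmax k)]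
        field_simp
      · obtain ⟨c, hc⟩ := weight_odd (m := m) (hA k)
        refine ⟨c * 2 ^ m k0, ?_⟩
        rw [hc, zsmul_eq_mul, ← C_eq_intCast, ← C_mul]
        congr 1
        push_cast
        field_simp

end Weights

/-! ### Hardness of the index set -/

theorem primrec_entryBound : Primrec entryBound := by
  refine Primrec.list_foldr (α := List Entry) (h := fun _ p => p.1.2.2 + 1 + p.2) Primrec.id
    (Primrec.const 0) ?_
  have h := Primrec.snd (α := List Entry) (β := Entry × ℕ)
  exact Primrec.nat_add.comp (Primrec.succ.comp (Primrec.snd.comp (Primrec.snd.comp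
    (Primrec.fst.comp h)))) (Primrec.snd.comp h)

theorem primrec_approx {m : ℕ → ℕ → ℕ} {A : ℕ → ℕ → ℕ → Prop} (hm : Primrec₂ m)
    (hA : PrimrecRel fun (p : ℕ × ℕ) y => A p.1 p.2 y) :
    Primrec₂ fun (p : ℕ × ℕ) g => approx (m p.1) (A p.1) p.2 g := by
  have n := Primrec.fst.comp (Primrec.fst (α := ℕ × ℕ) (β := ℕ))
  have N := Primrec.snd.comp (Primrec.fst (α := ℕ × ℕ) (β := ℕ))
  have g := Primrec.snd (α := ℕ × ℕ) (β := ℕ)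
  have i := Primrec.nat_div.comp g (Primrec.const 2)
  have two := Primrec.const (α := (ℕ × ℕ) × ℕ) 2
  exact Primrec.ite (Primrec.eq.comp (Primrec.nat_mod.comp g two) (Primrec.const 0))
    (primrec_pow.comp two (Primrec.nat_sub.comp N (hm.comp n i)))
    (Primrec.nat_mul.comp (primrec_pow.comp two N) (primrec_factorial.comp
      (Primrec₂.natPair.comp i ((primrec_search hA).comp (Primrec.pair n i)
        (Primrec.succ.comp N)))))

/-- Stage k returns the least x not refuted below k. A true witness bounds all answers; without one,
the finitely many x ≤ M are all refuted by some stage, whose answer then exceeds M. -/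
theorem exists_iff_search_bounded {P : ℕ → ℕ → Prop} :
    (∃ x, ∀ y, P x y) ↔ ∃ M, ∀ k, search (fun x => ∀ y < k, P x y) k ≤ M := by
  constructor
  · rintro ⟨x, hx⟩
    refine ⟨x, fun k => ?_⟩
    by_contra h
    exact not_of_lt_search (not_le.1 h) fun y _ => hx y
  · rintro ⟨M, hM⟩
    by_contra! h
    choose y hy using h
    obtain ⟨B, hB⟩ : ∃ B, ∀ x ∈ Finset.range (M + 1), y x ≤ B :=
      ⟨(Finset.range (M + 1)).sup y, fun x hx => Finset.le_sup hx⟩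
    -- The stage exceeds M, so the search has succeeded, and exceeds B, so every x ≤ M has been
    -- refuted.
    have hlt : search (fun x => ∀ y < M + B + 1, P x y) (M + B + 1) < M + B + 1 :=
      (hM _).trans_lt (by omega)
    have hx := hM (M + B + 1)
    exact hy _ (search_spec hlt _ ((hB _ (Finset.mem_range.2 (by omega))).trans_lt (by omega)))

/-- The Σ₂ part q drives the exponents m, and the Π₂ part ¬ r supplies the predicate A; the
coefficient group is cyclic exactly when both hold. -/
theorem manyOneReducible_indexSet {p : ℕ → Prop} (hp : IsDSigma2 p) : p ≤₀ indexSet ZwrZ := by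
  classical
  obtain ⟨q, r, hq, hr, hp⟩ := hp
  obtain ⟨Q, hQ, hq⟩ := hq.exists_primrec
  obtain ⟨R, hR, hr⟩ := hr.exists_primrec
  let m : ℕ → ℕ → ℕ := fun n k => search (fun x => ∀ y < k, Q n x y) k
  let A : ℕ → ℕ → ℕ → Prop := fun n i y => ¬ R n i y
  have hm : Primrec₂ m := by
    have h1 : PrimrecRel fun (y : ℕ) (p : ℕ × ℕ) => Q p.1 p.2 y :=
      hQ.comp (Primrec.pair Primrec.snd Primrec.fst)
    have h2 : PrimrecRel fun (p : ℕ × ℕ) (x : ℕ) => ∀ y ∈ List.range p.2, Q p.1 x y :=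
      h1.forall_mem_list.comp (Primrec.list_range.comp (Primrec.snd.comp Primrec.fst))
        (Primrec.pair (Primrec.fst.comp Primrec.fst) Primrec.snd)
    have h3 := (primrec_search h2).comp (Primrec.id (α := ℕ × ℕ)) Primrec.snd
    refine h3.of_eq fun p => ?_
    simp only [m, List.mem_range, id]
  have hA : PrimrecRel fun (p : ℕ × ℕ) y => A p.1 p.2 y := PrimrecPred.not hR
  have hw : PrimrecRel fun (n : ℕ) (x : NForm) => NForm.val (weight (m n) (A n)) x = 1 := by
    have h1 := (NForm.primrecPred_isOne (primrec_approx hm hA)).comp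
      (Primrec.pair (Primrec.pair (Primrec.fst (α := ℕ) (β := NForm))
        (primrec_entryBound.comp (Primrec.fst.comp Primrec.snd))) Primrec.snd)
    exact PrimrecPred.of_eq h1 fun p => (val_weight_eq_one_iff (fun k => search_le _ k) p.2).symm
  obtain ⟨f, hf, h⟩ := exists_reduction hw
  refine ⟨f, hf, fun n => ?_⟩
  have m0 : m n 0 = 0 := Nat.le_zero.1 (search_le _ 0)
  rw [h, nonempty_mulEquiv_weight_iff m0, hp, hq, hr, exists_iff_search_bounded]
  simp only [m, A, not_exists, not_forall]

end

end GroupScott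

theorem mainTheorem9 :
    (∃ φ : GroupScott.InfFormula,
      GroupScott.IsComputableDSigmaSentence 2 φ ∧
        GroupScott.IsScottSentence GroupScott.ZwrZ φ) ∧
    GroupScott.IsMComplete GroupScott.IsDSigma2 (GroupScott.indexSet GroupScott.ZwrZ) :=
  ⟨GroupScott.exists_scottSentence, GroupScott.isDSigma2_indexSet,
  fun _ => GroupScott.manyOneReducible_indexSet⟩
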